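/- **Conventions.** Fix $a\in\mathbb R$ (the rotation parameter of the Kerr black hole) and put $s=2$. For $m\in\mathbb Z$ and $\omega\in\mathbb R$ consider on $x=\cos\theta\in(-1,1)$ the eigenvalue problem $$\frac{d}{dx}\Big((1-x^2)\frac{dS}{dx}\Big)+\Big(s-\frac{(m+sx)^2}{1-x^2}-a^2\omega^2(1-x^2)-2a\omega s x\Big)S=-\Lambda S ,\qquad S \text{ real-valued and bounded on } (-1,1).$$ Its eigenvalues are simple. List them in increasing order with labels $l=\max(|m|,s),\max(|m|,s)+1,\dots$, and let $S_{ml}(\cdot\,;\omega)$ be the eigenfunction of the $l$-th eigenvalue with unit norm in $L^2((-1,1),dx)$ which is positive near $x=1$. Put $Y_{ml}(\theta,\varphi;\omega)=(2\pi)^{-1/2}S_{ml}(\cos\theta;\omega)e^{im\varphi}$. These are the spin-$2$-weighted spheroidal harmonics of frequency $\omega$; for $\omega=0$ they are the spin-$2$-weighted spherical harmonics. With $\mathrm{vol}_{\mathbb S^2}=\sin\theta\,d\theta\,d\varphi$ and $h\in L^2_vL^2_{\mathbb S^2}$, let $\check h(\omega,\theta,\varphi)=(2\pi)^{-1/2}\int_{\mathbb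 R}e^{i\omega v}h(v,\theta,\varphi)\,dv$ be the Fourier transform in $v$ (in the $L^2$ sense), and set $$\check h_{S(ml)}(\omega)=\int_{\mathbb S^2}\check h(\omega,\cdot)\,\overline{Y_{ml}(\cdot\,;0)}\,\mathrm{vol}_{\mathbb S^2},\qquad \check h_{ml}(\omega)=\int_{\mathbb S^2}\check h(\omega,\cdot)\,\overline{Y_{ml}(\cdot\,;\omega)}\,\mathrm{vol}_{\mathbb S^2}.$$ For $k\in\mathbb N_0$ and an open interval $\Omega$, $H^{k+1/2}(\Omega)$ is the space of $f\in L^2(\Omega)$ whose weak derivatives of order $\le k$ lie in $L^2(\Omega)$ and for which $g=\partial^kf$ satisfies $\iint_{\Omega\times\Omega}\frac{|g(\omega)-g(\xi)|^2}{|\omega-\xi|^2}\,d\omega\,d\xi<\infty$. **Proposition.** For every $m_0\in\mathbb Z$ and $l_0\in\mathbb N$ with $l_0\ge 2$ and $|m_0|\le l_0$ there is $\delta_0=\delta_0(m_0,l_0)>0$ (depending also on the fixed $a$, but not on $p$ or $h$) such that the following holds. Let $p\ge 1$ be an integer and let $h\in L^2_vL^2_{\mathbb S^2}$ have a weak derivative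 $\partial_vh\in L^2_vL^2_{\mathbb S^2}$, with $$\int_{\mathbb R}\int_{\mathbb S^2}(1+|v|^{2(p-1)})|h|^2\,\mathrm{vol}_{\mathbb S^2}\,dv<\infty,\qquad \int_{\mathbb R}\int_{\mathbb S^2}(1+|v|^{2p-1})|\partial_vh|^2\,\mathrm{vol}_{\mathbb S^2}\,dv<\infty .$$ Then for every $0<\delta<\delta_0$, $$\check h_{S(m_0l_0)}\in H^{p-1/2}\big((-\delta,\delta)\big)\iff \check h_{m_0l_0}\in H^{p-1/2}\big((-\delta,\delta)\big).$$ -/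

import Mathlib

open MeasureTheory Set Filter
open scoped Topology FourierTransform

noncomputable section

/-! ### Weak derivatives and the Sobolev spaces of order `k` and `k + 1/2` on an open set -/

/-- `g` is the `k`-th weak derivative of `f` on the open set `Ω ⊆ ℝ`
(for functions with values in a real normed space, with Bochner integrals). -/
def HasWeakDerivOn {E : Type*} [NormedAddCommGroup E] [NormedSpace ℝ E]
    (k : ℕ) (Ω : Set ℝ) (f g : ℝ → E) : Prop :=
  LocallyIntegrableOn f Ω ∧ LocallyIntegrableOn g Ω ∧
    ∀ χ : ℝ → ℝ, ContDiff ℝ (⊤ : ℕ∞) χ → HasCompactSupport χ → tsupport χ ⊆ Ω →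
      ∫ x in Ω, iteratedDeriv k χ x • f x = (-1 : ℝ) ^ k • ∫ x in Ω, χ x • g x

/-- `f ∈ H^k(Ω)`: the weak derivatives of order `0, …, k` exist and lie in `L²(Ω)`. -/
def MemSobolevNat (k : ℕ) (Ω : Set ℝ) (f : ℝ → ℂ) : Prop :=
  MemLp f 2 (volume.restrict Ω) ∧
    ∀ j ≤ k, ∃ g : ℝ → ℂ, HasWeakDerivOn j Ω f g ∧ MemLp g 2 (volume.restrict Ω)

/-- `f ∈ H^{1/2}(Ω)`, by the Gagliardo semi-norm:
`f ∈ L²(Ω)` and `(f(ω) - f(ξ)) / |ω - ξ| ∈ L²(Ω × Ω)`. -/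
def MemSobolevHalf (Ω : Set ℝ) (f : ℝ → ℂ) : Prop :=
  MemLp f 2 (volume.restrict Ω) ∧
    MemLp (fun z : ℝ × ℝ => (f z.1 - f z.2) / ((|z.1 - z.2| : ℝ) : ℂ)) 2
      ((volume.restrict Ω).prod (volume.restrict Ω))

/-- `f ∈ H^{k + 1/2}(Ω)`: `f ∈ H^k(Ω)` and its `k`-th weak derivative lies in `H^{1/2}(Ω)`. -/
def MemSobolevNatAddHalf (k : ℕ) (Ω : Set ℝ) (f : ℝ → ℂ) : Prop :=
  MemSobolevNat k Ω f ∧ ∃ g : ℝ → ℂ, HasWeakDerivOn k Ω f g ∧ MemSobolevHalf Ω g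

/-! ### The round sphere in polar coordinates `(θ, φ) ∈ (0, π) × (0, 2π)` -/

/-- The measure `sin θ dθ dφ` on `(0, π) × (0, 2π)`. -/
def sphereVol : Measure (ℝ × ℝ) :=
  ((volume.restrict (Ioo 0 Real.pi)).withDensity fun θ => ENNReal.ofReal (Real.sin θ)).prod
    (volume.restrict (Ioo 0 (2 * Real.pi)))

/-- `L²(𝕊²)`; a spin-weighted function is represented by its values in the coordinates `(θ, φ)`. -/
abbrev SphereL2 : Type := Lp ℂ 2 sphereVol

/-- `L²_v L²_{𝕊²}`. -/
abbrev LineSphereL2 : Type := Lp SphereL2 2 (volume : Measure ℝ)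

/-! ### Spin-weighted spheroidal harmonics -/

/-- `S` is an eigenfunction, with eigenvalue `Λ`, of the angular operator of azimuthal number `m`
and frequency `ω`. Up to sign, this operator arises from the Carter operator
`a² sin² θ ∂_v² - 2 i s a cos θ ∂_v + Δ_[s]` by `∂_v ↦ -i ω`, `∂_φ ↦ i m`, where the
spin-weighted Laplacian `Δ_[s]` becomes
`(sin θ)⁻¹ ∂_θ (sin θ ∂_θ) - (m + s cos θ)² / sin² θ + s`; it is written here in the variable
`x = cos θ ∈ (-1, 1)`. Boundedness at the two poles is the regularity condition that singles out
the eigenfunctions among all the solutions of the equation. Values outside `(-1, 1)` are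
irrelevant. -/
def IsSpheroidalEigenfunction (s : ℤ) (a : ℝ) (m : ℤ) (ω Λ : ℝ) (S : ℝ → ℝ) : Prop :=
  ContDiffOn ℝ 2 S (Ioo (-1) 1) ∧
  (∃ C : ℝ, ∀ x ∈ Ioo (-1 : ℝ) 1, |S x| ≤ C) ∧
  (∃ x ∈ Ioo (-1 : ℝ) 1, S x ≠ 0) ∧
  ∀ x ∈ Ioo (-1 : ℝ) 1,
    deriv (fun y => (1 - y ^ 2) * deriv S y) x
      + (s - (m + s * x) ^ 2 / (1 - x ^ 2) - a ^ 2 * ω ^ 2 * (1 - x ^ 2) - 2 * a * ω * s * x) * S x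
      = -Λ * S x

/-- `Λ` is an eigenvalue of the angular operator. -/
def IsSpheroidalEigenvalue (s : ℤ) (a : ℝ) (m : ℤ) (ω Λ : ℝ) : Prop :=
  ∃ S : ℝ → ℝ, IsSpheroidalEigenfunction s a m ω Λ S

/-- `S = S_{ml}^{[s]}(· ; ω)`: the eigenvalues, which are simple, are listed in increasing order
with `l = max(|m|, |s|), max(|m|, |s|) + 1, …`, and `S` is the eigenfunction of the `l`-th one that
has norm `1` in `L²((-1, 1), dx)` and is positive near `x = 1`. The last condition selects one of
the two unit eigenfunctions `±S`, consistently in `ω`. -/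
def IsSpheroidalS (s : ℤ) (a : ℝ) (m : ℤ) (l : ℕ) (ω : ℝ) (S : ℝ → ℝ) : Prop :=
  (∃ Λ : ℝ, IsSpheroidalEigenfunction s a m ω Λ S ∧
    {μ : ℝ | μ < Λ ∧ IsSpheroidalEigenvalue s a m ω μ}.encard
      + (max m.natAbs s.natAbs : ℕ) = (l : ℕ∞)) ∧
  ∫ x in Ioo (-1 : ℝ) 1, S x ^ 2 = 1 ∧
  ∀ᶠ x in 𝓝[<] (1 : ℝ), 0 < S x

open Classical in
/-- The function `S_{ml}^{[s]}(x; ω)` of `x = cos θ ∈ (-1, 1)`. -/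
def spheroidalS (s : ℤ) (a : ℝ) (m : ℤ) (l : ℕ) (ω : ℝ) : ℝ → ℝ :=
  if h : ∃ S : ℝ → ℝ, IsSpheroidalS s a m l ω S then h.choose else 0

/-- The spin-weighted spheroidal harmonic `Y_{ml}^{[s]}(θ, φ; ω) = S_{ml}^{[s]}(cos θ; ω) e^{imφ}`,
normalised in `L²(𝕊²)`. For `ω = 0` it is the spin-weighted spherical harmonic. -/
def spheroidalY (s : ℤ) (a : ℝ) (m : ℤ) (l : ℕ) (ω : ℝ) (z : ℝ × ℝ) : ℂ :=
  ((√(2 * Real.pi))⁻¹ * spheroidalS s a m l ω (Real.cos z.1) : ℝ)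
    * Complex.exp (Complex.I * m * z.2)

/-! ### Fourier transform in `v` and projections -/

/-- `ȟ(ω) = (2π)^{-1/2} ∫ e^{iωv} h(v) dv`, in the sense of Plancherel, for `h ∈ L²_v L²_{𝕊²}`.
(Mathlib's inverse transform is `∫ e^{2πiξv} h(v) dv` at `ξ`.) -/
def fourierV (h : LineSphereL2) (ω : ℝ) : SphereL2 :=
  (√(2 * Real.pi))⁻¹ • (𝓕⁻ h : LineSphereL2) (ω / (2 * Real.pi))

/-- `ȟ_{S(ml)}(ω)`: the coefficient of `ȟ(ω)` along the spin-weighted spherical harmonic. -/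
def sphericalCoeff (s : ℤ) (a : ℝ) (m : ℤ) (l : ℕ) (h : LineSphereL2) (ω : ℝ) : ℂ :=
  ∫ z, fourierV h ω z * (starRingEnd ℂ) (spheroidalY s a m l 0 z) ∂sphereVol

/-- `ȟ_{ml}(ω)`: the coefficient of `ȟ(ω)` along the spin-weighted spheroidal harmonic of
frequency `ω`. -/
def spheroidalCoeff (s : ℤ) (a : ℝ) (m : ℤ) (l : ℕ) (h : LineSphereL2) (ω : ℝ) : ℂ :=
  ∫ z, fourierV h ω z * (starRingEnd ℂ) (spheroidalY s a m l ω z) ∂sphereVol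

end

/-! The two coefficients differ by a constant times `⟨Y(ω) - Y(0), ȟ(ω)⟩`, where `Y(ω)` is the
spheroidal harmonic as an element of `L²(𝕊²)`. If `Y` is analytic in `ω` near `0`, then `Y(ω) - Y(0)
= ω G(ω)` with `G` analytic. The factor `ω` can be moved onto `ȟ`, where it produces, up to a factor
`i`, the transform of `∂_v h`. So the difference is a smooth curve paired with the transform of `∂_v
h`, and the weight `|v|^(2p-1)` on `∂_v h` is exactly what `H^(p-1/2)` requires: each of `p - 1`
derivatives falls on `G` or multiplies by `iv`, and the last half derivative is measured by the
Gagliardo kernel, whose Fourier side is `|v|`. This is `memSobolevNatAddHalf_inner_angularFourier`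
and `exists_memSobolevNatAddHalf_inner_sub`. The two coefficients thus differ by an element of the
space in question.

Analyticity comes from perturbation theory at a simple eigenvalue. With `α = |m + 2|`, `β = |m - 2|`
and `ρ = (1 - x)^α (1 + x)^β`, the substitution `S = √ρ u` turns the operator at `ω = 0` into the
Jacobi operator. Its polynomial eigenfunctions give a Hilbert basis of `L²((-1, 1))`, with
eigenvalues `k (k + α + β + 1)` separated by at least `1`. The frequency enters only through the
bounded symmetric multiplication `4aωx + a²ω²(1 - x²)`. The inverse function theorem gives analytic
branches of weak eigenpairs (`exists_analytic_branch`). For small `ω` these branches exhaust the low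
spectrum, which fixes the labelling (`exists_analytic_eigenpair`).

Weak eigenvectors must then be matched with bounded classical eigenfunctions. A bounded solution has
no flux through the poles, so Green's formula makes it weak (`IsJacobiSystem.green`). Conversely, a
weak solution is recovered from its source by two integrations and is bounded
(`exists_eq_jacobiPot`). Finally, the sign is continuous in `ω`: solutions have no zero in an
interval `(y, 1)` independent of `ω`, so the sign is that of the integral over `(y, 1)`, a
continuous functional on `L²` (`exists_analytic_spheroidalS`). -/

noncomputable section

/-! ### Hilbert-space-valued Fourier transform on the line: derivatives, translations, Gagliardo
semi-norm. -/

section Fourier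

open scoped SchwartzMap ContDiff

set_option linter.unusedSectionVars false

variable {H : Type*} [NormedAddCommGroup H] [InnerProductSpace ℂ H] [CompleteSpace H]

/-- A weak derivative on the line tested against real test functions may be tested against complex
Schwartz functions. -/
lemma integral_deriv_smul_of_weakDeriv_real {h dh : ℝ → H} (hh : MemLp h 2 volume)
    (hdh : MemLp dh 2 volume)
    (hw : ∀ χ : ℝ → ℝ, ContDiff ℝ ∞ χ → HasCompactSupport χ →
      ∫ x, deriv χ x • h x = -∫ x, χ x • dh x)
    (χ : ℝ → ℂ) (hχ : ContDiff ℝ ∞ χ) (hc : HasCompactSupport χ) :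
    ∫ x, deriv χ x • h x = -∫ x, χ x • dh x := by
  have hre : ContDiff ℝ ∞ fun x => (χ x).re := Complex.reCLM.contDiff.comp hχ
  have him : ContDiff ℝ ∞ fun x => (χ x).im := Complex.imCLM.contDiff.comp hχ
  have hcre : HasCompactSupport fun x => (χ x).re := hc.comp_left (g := Complex.re) rfl
  have hcim : HasCompactSupport fun x => (χ x).im := hc.comp_left (g := Complex.im) rfl
  have hlh := hh.locallyIntegrable one_le_two
  have hldh := hdh.locallyIntegrable one_le_two
  have int {ξ : ℝ → ℝ} (h1 : ContDiff ℝ ∞ ξ) (h2 : HasCompactSupport ξ) :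
      Integrable (fun x => ξ x • dh x) ∧ Integrable (fun x => deriv ξ x • h x) :=
    ⟨hldh.integrable_smul_left_of_hasCompactSupport h1.continuous h2,
      hlh.integrable_smul_left_of_hasCompactSupport (h1.continuous_deriv (by simp)) h2.deriv⟩
  have hd : ∀ x, deriv χ x = ((deriv (fun x => (χ x).re) x : ℝ) : ℂ)
      + Complex.I * ((deriv (fun x => (χ x).im) x : ℝ) : ℂ) := by
    intro x
    have h1 := (hχ.differentiable (by simp) x).hasDerivAt
    have h2 : HasDerivAt (fun x => (χ x).re) (deriv χ x).re x :=
      Complex.reCLM.hasFDerivAt.comp_hasDerivAt x h1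
    have h3 : HasDerivAt (fun x => (χ x).im) (deriv χ x).im x :=
      Complex.imCLM.hasFDerivAt.comp_hasDerivAt x h1
    rw [h2.deriv, h3.deriv, mul_comm, Complex.re_add_im]
  have e1 : ∀ x, deriv χ x • h x = deriv (fun x => (χ x).re) x • h x
      + Complex.I • (deriv (fun x => (χ x).im) x • h x) := by
    intro x
    rw [hd x, add_smul, mul_smul, Complex.coe_smul, Complex.coe_smul]
  have e2 : ∀ x, χ x • dh x = (χ x).re • dh x + Complex.I • ((χ x).im • dh x) := by
    intro x
    conv_lhs => rw [← Complex.re_add_im (χ x), add_smul, mul_comm, mul_smul, Complex.coe_smul,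
      Complex.coe_smul]
  simp_rw [e1, e2]
  rw [integral_add (int hre hcre).2 ((int him hcim).2.fun_smul Complex.I),
    integral_add (int hre hcre).1 ((int him hcim).1.fun_smul Complex.I), integral_smul, integral_smul,
    hw _ hre hcre, hw _ him hcim, smul_neg]
  abel

/-- A weak derivative on the line may be tested against Schwartz functions. -/
lemma integral_deriv_smul_of_weakDeriv {h dh : ℝ → H} (hh : MemLp h 2 volume)
    (hdh : MemLp dh 2 volume)
    (hw : ∀ χ : ℝ → ℝ, ContDiff ℝ ∞ χ → HasCompactSupport χ →
      ∫ x, deriv χ x • h x = -∫ x, χ x • dh x)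
    (ψ : 𝓢(ℝ, ℂ)) : ∫ x, deriv ψ x • h x = -∫ x, ψ x • dh x := by
  obtain ⟨b, -, hbc, hb, hbr, hb0⟩ :=
    exists_contDiff_tsupport_subset (E := ℝ) (n := ⊤) (s := univ) (x := 0) univ_mem
  have hb' : ContDiff ℝ ∞ b := hb
  -- The cutoffs `b (c n * x)` are dilations of one bump with `b 0 = 1`: they tend to `1` pointwise,
  -- while their derivatives carry a factor `c n` and vanish in the limit.
  set c : ℕ → ℝ := fun n => ((n : ℝ) + 1)⁻¹ with hcdef
  have hc0 : ∀ n, c n ≠ 0 := fun n => by positivity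
  have hc1 : ∀ n, |c n| ≤ 1 := fun n => by
    rw [abs_of_pos (by positivity)]; exact inv_le_one_of_one_le₀ (by linarith [n.cast_nonneg (α := ℝ)])
  have hclim : Tendsto c atTop (𝓝 0) := tendsto_inv_atTop_zero.comp
    (tendsto_atTop_add_const_right _ _ tendsto_natCast_atTop_atTop)
  obtain ⟨M, hM⟩ := hbc.deriv.exists_bound_of_continuous (hb'.continuous_deriv (by simp))
  have hψd : Continuous (deriv ψ) := (ψ.smooth ⊤).continuous_deriv (by simp)
  set χ : ℕ → ℝ → ℂ := fun n x => (b (c n * x) : ℂ) * ψ x with hχ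
  have hbs (n) : ContDiff ℝ ∞ fun x => b (c n * x) := hb'.comp (contDiff_const.mul contDiff_id)
  have hχs (n) : ContDiff ℝ ∞ (χ n) :=
    (Complex.ofRealCLM.contDiff.comp (hbs n)).mul (ψ.smooth ⊤)
  have hbcs (n) : HasCompactSupport fun x => b (c n * x) :=
    hbc.comp_homeomorph (Homeomorph.mulLeft₀ (c n) (hc0 n))
  have hχc (n) : HasCompactSupport (χ n) :=
    ((hbcs n).comp_left (g := fun r : ℝ => (r : ℂ)) rfl).mul_right
  have key (n) := integral_deriv_smul_of_weakDeriv_real hh hdh hw (χ n) (hχs n) (hχc n)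
  have hdχ (n x) : deriv (χ n) x
      = ((deriv b (c n * x) * c n : ℝ) : ℂ) * ψ x + (b (c n * x) : ℂ) * deriv ψ x := by
    have h1 : HasDerivAt (fun x => b (c n * x)) (deriv b (c n * x) * c n) x := by
      have := ((hb'.differentiable (by simp) (c n * x)).hasDerivAt).comp x
        ((hasDerivAt_id x).const_mul (c n))
      simpa [Function.comp_def] using this
    have h2 := (ψ.differentiable x).hasDerivAt
    exact (h1.ofReal_comp.mul h2).deriv
  have hb1 : ∀ y, |b y| ≤ 1 := fun y => by
    have := hbr (mem_range_self y)
    rw [abs_of_nonneg this.1]; exact this.2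
  have hψ2 := ψ.memLp 2 volume
  have hψd2 : MemLp (deriv ψ) 2 volume := (SchwartzMap.derivCLM ℂ ℂ ψ).memLp 2 volume
  have hbt (x) : Tendsto (fun n => b (c n * x)) atTop (𝓝 1) := by
    rw [← hb0]
    refine (hb'.continuous.tendsto 0).comp ?_
    simpa using hclim.mul_const x
  have i1 : Integrable (fun x => ‖ψ x‖ * ‖dh x‖) := hψ2.norm.integrable_mul hdh.norm
  have i2 : Integrable (fun x => M * (‖ψ x‖ * ‖h x‖) + ‖deriv ψ x‖ * ‖h x‖) :=
    ((hψ2.norm.integrable_mul hh.norm).const_mul M).add (hψd2.norm.integrable_mul hh.norm)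
  have l1 : Tendsto (fun n => ∫ x, χ n x • dh x) atTop (𝓝 (∫ x, ψ x • dh x)) := by
    refine tendsto_integral_of_dominated_convergence _ (fun n => ?_) i1 (fun n => ?_) ?_
    · exact (hχs n).continuous.aestronglyMeasurable.smul hdh.1
    · refine Eventually.of_forall fun x => ?_
      rw [norm_smul, norm_mul, Complex.norm_real, Real.norm_eq_abs]
      exact mul_le_mul_of_nonneg_right
        (mul_le_of_le_one_left (norm_nonneg _) (hb1 _)) (norm_nonneg _)
    · refine Eventually.of_forall fun x => ?_
      have := ((Complex.continuous_ofReal.tendsto 1).comp (hbt x)).mul_const (ψ x)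
      simpa using this.smul_const (dh x)
  have l2 : Tendsto (fun n => ∫ x, deriv (χ n) x • h x) atTop (𝓝 (∫ x, deriv ψ x • h x)) := by
    refine tendsto_integral_of_dominated_convergence _ (fun n => ?_) i2 (fun n => ?_) ?_
    · exact ((hχs n).continuous_deriv (by simp)).aestronglyMeasurable.smul hh.1
    · refine Eventually.of_forall fun x => ?_
      rw [norm_smul, hdχ, ← mul_assoc, ← add_mul]
      refine mul_le_mul_of_nonneg_right ((norm_add_le _ _).trans ?_) (norm_nonneg _)
      rw [norm_mul, norm_mul, Complex.norm_real, Complex.norm_real, Real.norm_eq_abs,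
        Real.norm_eq_abs, abs_mul]
      refine add_le_add ?_ (mul_le_of_le_one_left (norm_nonneg _) (hb1 _))
      refine mul_le_mul_of_nonneg_right ?_ (norm_nonneg _)
      calc |deriv b (c n * x)| * |c n| ≤ |deriv b (c n * x)| * 1 :=
            mul_le_mul_of_nonneg_left (hc1 n) (abs_nonneg _)
        _ ≤ M := by rw [mul_one]; exact hM _
    · refine Eventually.of_forall fun x => ?_
      have t1 : Tendsto (fun n => deriv b (c n * x) * c n) atTop (𝓝 0) := by
        refine squeeze_zero_norm (a := fun n => M * |c n|) (fun n => ?_) ?_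
        · rw [norm_mul]; exact mul_le_mul_of_nonneg_right (hM _) (abs_nonneg _)
        · simpa using hclim.abs.const_mul M
      have t2 := ((Complex.continuous_ofReal.tendsto 0).comp t1).mul_const (ψ x)
      have t3 := ((Complex.continuous_ofReal.tendsto 1).comp (hbt x)).mul_const (deriv ψ x)
      have t4 := (t2.add t3).smul_const (h x)
      simpa [hdχ] using t4
  exact tendsto_nhds_unique l2 (by simpa only [key] using l1.neg)

/-- The transform of a tempered distribution is defined by this duality, and it agrees with the
Plancherel transform on `L²`. -/
lemma integral_fourierInv_smul (f : Lp H 2 (volume : Measure ℝ)) (ψ : 𝓢(ℝ, ℂ)) :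
    ∫ x, (𝓕⁻ ψ) x • f x = ∫ x, ψ x • (𝓕⁻ f : Lp H 2 (volume : Measure ℝ)) x := by
  rw [← Lp.toTemperedDistribution_apply, ← Lp.toTemperedDistribution_apply,
    ← Lp.fourierInv_toTemperedDistribution_eq, TemperedDistribution.fourierInv_apply]

/-- The inverse Fourier transform turns a weak derivative into multiplication. -/
lemma fourierInv_weakDeriv {h dh : Lp H 2 (volume : Measure ℝ)}
    (hw : ∀ χ : ℝ → ℝ, ContDiff ℝ ∞ χ → HasCompactSupport χ →
      ∫ x, deriv χ x • h x = -∫ x, χ x • dh x) :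
    ∀ᵐ ξ : ℝ, (𝓕⁻ dh : Lp H 2 (volume : Measure ℝ)) ξ
      = -((2 * Real.pi * Complex.I * ξ) • (𝓕⁻ h : Lp H 2 (volume : Measure ℝ)) ξ) := by
  set A : Lp H 2 (volume : Measure ℝ) := 𝓕⁻ h with hA
  set B : Lp H 2 (volume : Measure ℝ) := 𝓕⁻ dh with hB
  have hAl := (Lp.memLp A).locallyIntegrable one_le_two
  have hBl := (Lp.memLp B).locallyIntegrable one_le_two
  have hcont : Continuous fun ξ : ℝ => (2 * Real.pi * Complex.I * ξ : ℂ) := by fun_prop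
  have hmul : LocallyIntegrable (fun ξ : ℝ => (2 * Real.pi * Complex.I * ξ : ℂ) • A ξ) := by
    have := (locallyIntegrableOn_univ.2 hAl).continuousOn_smul isOpen_univ.isLocallyClosed
      hcont.continuousOn
    exact locallyIntegrableOn_univ.1 this
  have : ∀ᵐ ξ : ℝ, B ξ + (2 * Real.pi * Complex.I * ξ : ℂ) • A ξ = 0 := by
    refine ae_eq_zero_of_integral_contDiff_smul_eq_zero (hBl.add hmul) fun g hg hgc => ?_
    have hg' : ContDiff ℝ ∞ fun x => (g x : ℂ) := Complex.ofRealCLM.contDiff.comp hg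
    have hgc' : HasCompactSupport fun x => (g x : ℂ) :=
      hgc.comp_left (g := fun r : ℝ => (r : ℂ)) rfl
    have hg2 : ContDiff ℝ ∞ fun x : ℝ => (2 * Real.pi * Complex.I * x : ℂ) * (g x : ℂ) :=
      (contDiff_const.mul Complex.ofRealCLM.contDiff).mul hg'
    have hgc2 : HasCompactSupport fun x : ℝ => (2 * Real.pi * Complex.I * x : ℂ) * (g x : ℂ) :=
      hgc'.mul_left
    set ψ : 𝓢(ℝ, ℂ) := hgc'.toSchwartzMap hg'
    set φ : 𝓢(ℝ, ℂ) := hgc2.toSchwartzMap hg2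
    have hψ : ∀ x, ψ x = g x := fun x => rfl
    have hφ : ∀ x, φ x = (2 * Real.pi * Complex.I * x : ℂ) * (g x : ℂ) := fun x => rfl
    -- `φ` is `2πix` times `ψ`, so that differentiating the inverse transform of `ψ` gives that of
    -- `φ`; duality then transports the weak derivative to the Fourier side.
    have hd : deriv (𝓕⁻ ψ : 𝓢(ℝ, ℂ)) = (𝓕⁻ φ : 𝓢(ℝ, ℂ)) := by
      have hφ' : φ = (2 * Real.pi * Complex.I) •
          SchwartzMap.smulLeftCLM ℂ (fun x : ℝ => inner ℝ x (1 : ℝ)) ψ := by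
        have ht : (fun x : ℝ => inner ℝ x (1 : ℝ)).HasTemperateGrowth := by fun_prop
        ext x
        rw [_root_.smul_apply, SchwartzMap.smulLeftCLM_apply_apply ht, hφ, hψ]
        simp [mul_assoc]
      rw [hφ', ← SchwartzMap.lineDerivOp_fourierInv_eq ψ (1 : ℝ)]
      rfl
    have e1 := integral_fourierInv_smul dh ψ
    have e2 := integral_fourierInv_smul h φ
    have e3 := integral_deriv_smul_of_weakDeriv (Lp.memLp h) (Lp.memLp dh) hw (𝓕⁻ ψ)
    rw [hd, e1, e2] at e3
    simp only [smul_add]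
    rw [integral_add]
    · simp only [hψ, hφ] at e3
      have : ∀ x, g x • ((2 * Real.pi * Complex.I * x : ℂ) • A x)
          = ((2 * Real.pi * Complex.I * x : ℂ) * (g x : ℂ)) • A x := by
        intro x
        rw [← Complex.coe_smul, smul_smul, mul_comm]
      simp only [this]
      rw [e3]
      simp [hB]
    · exact hBl.integrable_smul_left_of_hasCompactSupport hg.continuous hgc
    · exact hmul.integrable_smul_left_of_hasCompactSupport hg.continuous hgc
  filter_upwards [this] with ξ hξ
  exact eq_neg_of_add_eq_zero_left hξ

/-- Integration by parts against the inverse Fourier transform, with vector-valued test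
functions. -/
lemma integral_inner_deriv_fourierInv {f g : Lp H 2 (volume : Measure ℝ)}
    (hg : ∀ᵐ v : ℝ, g v = (2 * Real.pi * Complex.I * v : ℂ) • f v)
    {Ψ : ℝ → H} (hΨ : ContDiff ℝ ∞ Ψ) (hc : HasCompactSupport Ψ) :
    ∫ x, inner ℂ (deriv Ψ x) ((𝓕⁻ f : Lp H 2 (volume : Measure ℝ)) x)
      = -∫ x, inner ℂ (Ψ x) ((𝓕⁻ g : Lp H 2 (volume : Measure ℝ)) x) := by
  set Φ : 𝓢(ℝ, H) := hc.toSchwartzMap hΨ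
  set Φ' : 𝓢(ℝ, H) := hc.deriv.toSchwartzMap (hΨ.iterate_deriv 1)
  -- Plancherel for the inner product moves the transform onto the Schwartz function, where
  -- differentiation is classical.
  have key (Θ : 𝓢(ℝ, H)) (f : Lp H 2 (volume : Measure ℝ)) :
      ∫ x, inner ℂ (Θ x) ((𝓕⁻ f : Lp H 2 (volume : Measure ℝ)) x)
        = ∫ v, inner ℂ ((𝓕 Θ) v) (f v) := by
    have h1 := Lp.inner_fourier_eq (Θ.toLp 2) (𝓕⁻ f : Lp H 2 (volume : Measure ℝ))
    rw [FourierTransform.fourier_fourierInv_eq, SchwartzMap.toLp_fourier_eq, L2.inner_def,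
      L2.inner_def] at h1
    calc _ = _ := integral_congr_ae ?_
      _ = _ := h1.symm
      _ = _ := integral_congr_ae ?_
    · filter_upwards [Θ.coeFn_toLp 2 volume] with x hx
      rw [hx]
    · filter_upwards [(𝓕 Θ).coeFn_toLp 2 volume] with x hx
      rw [hx]
  have e1 := key Φ' f
  have e2 := key Φ g
  have hd : ∀ v : ℝ, (𝓕 Φ') v = (2 * Real.pi * Complex.I * v : ℂ) • (𝓕 Φ) v := by
    intro v
    rw [SchwartzMap.fourier_coe, SchwartzMap.fourier_coe]
    exact congrFun (Real.fourier_deriv Φ.integrable (Φ.differentiable) Φ'.integrable) v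
  calc _ = _ := e1
    _ = -∫ v, inner ℂ ((𝓕 Φ) v) (g v) := by
      rw [← integral_neg]
      refine integral_congr_ae ?_
      filter_upwards [hg] with v hv
      rw [hv, hd, inner_smul_left, inner_smul_right, ← neg_mul]
      simp [Complex.conj_ofNat]
    _ = _ := by rw [← e2]; rfl

/-- Translation of the inverse Fourier transform. -/
lemma fourierInv_translate {f g : Lp H 2 (volume : Measure ℝ)} (η : ℝ)
    (hg : ∀ᵐ v : ℝ, g v = Complex.exp (2 * Real.pi * Complex.I * η * v) • f v) :
    ∀ᵐ x, (𝓕⁻ g : Lp H 2 (volume : Measure ℝ)) x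
      = (𝓕⁻ f : Lp H 2 (volume : Measure ℝ)) (x + η) := by
  set A : Lp H 2 (volume : Measure ℝ) := 𝓕⁻ g with hA
  set B : Lp H 2 (volume : Measure ℝ) := 𝓕⁻ f with hB
  have hAl := (Lp.memLp A).locallyIntegrable one_le_two
  have hBη : MemLp (fun x => B (x + η)) 2 volume :=
    (Lp.memLp B).comp_measurePreserving (measurePreserving_add_right volume η)
  have hBl := hBη.locallyIntegrable one_le_two
  have : ∀ᵐ x, A x - B (x + η) = 0 := by
    refine ae_eq_zero_of_integral_contDiff_smul_eq_zero (hAl.sub hBl) fun χ hχ hχc => ?_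
    have hχ' : ContDiff ℝ ∞ fun x => (χ x : ℂ) := Complex.ofRealCLM.contDiff.comp hχ
    have hχc' : HasCompactSupport fun x => (χ x : ℂ) :=
      hχc.comp_left (g := fun r : ℝ => (r : ℂ)) rfl
    have hχη : ContDiff ℝ ∞ fun x => (χ (x - η) : ℂ) := hχ'.comp (contDiff_id.sub contDiff_const)
    have hχcη : HasCompactSupport fun x => (χ (x - η) : ℂ) :=
      hχc'.comp_homeomorph (Homeomorph.subRight η)
    set ψ : 𝓢(ℝ, ℂ) := hχc'.toSchwartzMap hχ'
    set φ : 𝓢(ℝ, ℂ) := hχcη.toSchwartzMap hχη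
    have hψ : ∀ x, ψ x = χ x := fun x => rfl
    have hφ : ∀ x, φ x = χ (x - η) := fun x => rfl
    have hmod : ∀ v : ℝ, (𝓕⁻ φ) v = Complex.exp (2 * Real.pi * Complex.I * η * v) * (𝓕⁻ ψ) v := by
      intro v
      rw [SchwartzMap.fourierInv_coe, SchwartzMap.fourierInv_coe, Real.fourierInv_eq',
        Real.fourierInv_eq', ← integral_const_mul]
      rw [← integral_add_right_eq_self _ η]
      refine integral_congr_ae (Eventually.of_forall fun x => ?_)
      simp only [hφ, hψ, add_sub_cancel_right, smul_eq_mul, ← mul_assoc, ← Complex.exp_add]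
      congr 2
      simp
      ring
    have e1 := integral_fourierInv_smul g ψ
    have e2 := integral_fourierInv_smul f φ
    have e3 : ∫ x, (𝓕⁻ ψ) x • g x = ∫ x, (𝓕⁻ φ) x • f x := by
      refine integral_congr_ae ?_
      filter_upwards [hg] with v hv
      rw [hv, hmod, smul_smul, mul_comm]
    rw [e1, e2, ← integral_add_right_eq_self (fun x => φ x • (𝓕⁻ f : Lp H 2 volume) x) η] at e3
    simp only [hφ, hψ, add_sub_cancel_right, Complex.coe_smul] at e3
    simp only [smul_sub]
    rw [integral_sub (hAl.integrable_smul_left_of_hasCompactSupport hχ.continuous hχc)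
      (hBl.integrable_smul_left_of_hasCompactSupport hχ.continuous hχc), sub_eq_zero, hA, e3]
  filter_upwards [this] with x hx
  exact sub_eq_zero.1 hx

/-- The kernel of the Gagliardo semi-norm on the Fourier side. -/
lemma lintegral_one_sub_exp_le : ∃ C : ENNReal, C ≠ ⊤ ∧ ∀ v : ℝ,
    ∫⁻ η : ℝ, ‖1 - Complex.exp (2 * Real.pi * Complex.I * η * v)‖ₑ ^ 2 * ‖η⁻¹‖ₑ ^ 2
      ≤ C * ‖v‖ₑ := by
  set k : ℝ → ENNReal := fun t =>
    ‖1 - Complex.exp (2 * Real.pi * Complex.I * t)‖ₑ ^ 2 * ‖t⁻¹‖ₑ ^ 2 with hk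
  have hkm : Measurable k := by fun_prop
  have hkC : ∫⁻ t, k t ≠ ⊤ := by
    -- The numerator `|1 - e^(2πit)|²` is at most `4` and at most `4π²t²`; adding the two bounds
    -- gives this majorant.
    have hint : Integrable fun t : ℝ => (4 * Real.pi ^ 2 + 4) * (1 + t ^ 2)⁻¹ :=
      integrable_inv_one_add_sq.const_mul _
    refine ne_top_of_le_ne_top hint.lintegral_lt_top.ne (lintegral_mono fun t => ?_)
    have e1 : k t = ENNReal.ofReal
        ((‖1 - Complex.exp (2 * Real.pi * Complex.I * t)‖ * |t⁻¹|) ^ 2) := by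
      rw [hk, ENNReal.ofReal_pow (by positivity), ENNReal.ofReal_mul (norm_nonneg _),
        ofReal_norm, ← Real.norm_eq_abs, ofReal_norm, mul_pow]
    rw [e1]
    refine ENNReal.ofReal_le_ofReal ?_
    rcases eq_or_ne t 0 with rfl | ht
    · simp; positivity
    have h2 : ‖1 - Complex.exp (2 * Real.pi * Complex.I * t)‖ ≤ 2 := by
      refine (norm_sub_le _ _).trans ?_
      have : (2 * Real.pi * Complex.I * t : ℂ) = ((2 * Real.pi * t : ℝ) : ℂ) * Complex.I := by
        push_cast; ring
      rw [this, Complex.norm_exp_ofReal_mul_I]; norm_num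
    have h3 : ‖1 - Complex.exp (2 * Real.pi * Complex.I * t)‖ ≤ 2 * Real.pi * |t| := by
      have := Real.norm_exp_I_mul_ofReal_sub_one_le (x := 2 * Real.pi * t)
      rw [norm_sub_rev]
      refine le_trans (le_of_eq ?_) (this.trans (le_of_eq ?_))
      · congr 3; push_cast; ring
      · rw [Real.norm_eq_abs, abs_mul, abs_of_pos Real.two_pi_pos]
    rw [mul_pow, sq_abs, inv_pow, ← div_eq_mul_inv, ← div_eq_mul_inv, div_le_div_iff₀
      (by positivity) (by positivity)]
    have h2' := pow_le_pow_left₀ (norm_nonneg _) h2 2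
    have h3' := pow_le_pow_left₀ (norm_nonneg _) h3 2
    rw [mul_pow, sq_abs] at h3'
    nlinarith [sq_nonneg t]
  refine ⟨∫⁻ t, k t, hkC, fun v => ?_⟩
  rcases eq_or_ne v 0 with rfl | hv
  · simp
  -- Scaling `t = vη`: the kernel contributes `|v|²` and the change of variables `|v|⁻¹`, leaving
  -- `|v|`.
  have e1 : ∀ η : ℝ, ‖1 - Complex.exp (2 * Real.pi * Complex.I * η * v)‖ₑ ^ 2 * ‖η⁻¹‖ₑ ^ 2
      = ‖v‖ₑ ^ 2 * k (v * η) := by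
    intro η
    have : ‖v‖ₑ * ‖(v * η)⁻¹‖ₑ = ‖η⁻¹‖ₑ := by
      rw [← enorm_mul]; congr 1; field_simp
    rw [hk, ← this, mul_pow]
    simp only
    have e : (2 * Real.pi * Complex.I * (v * η : ℝ) : ℂ) = 2 * Real.pi * Complex.I * η * v := by
      push_cast; ring
    rw [e]; ring
  simp_rw [e1]
  rw [lintegral_const_mul _ (by fun_prop)]
  have e2 : ∫⁻ η, k (v * η) = ENNReal.ofReal |v⁻¹| * ∫⁻ t, k t := by
    rw [← lintegral_map hkm (measurable_const_mul v), Real.map_volume_mul_left hv,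
      lintegral_smul_measure, smul_eq_mul]
  rw [e2, ← mul_assoc, ← Real.norm_eq_abs, ofReal_norm]
  have : ‖v‖ₑ ^ 2 * ‖v⁻¹‖ₑ = ‖v‖ₑ := by
    rw [sq, mul_assoc, ← enorm_mul, mul_inv_cancel₀ hv]; simp
  rw [this, mul_comm]

/-- The Gagliardo semi-norm of an inverse Fourier transform is controlled by a weight. -/
lemma memLp_gagliardo_fourierInv (f : Lp H 2 (volume : Measure ℝ))
    (hf : Integrable fun v : ℝ => |v| * ‖f v‖ ^ 2) :
    MemLp (fun z : ℝ × ℝ => ‖(𝓕⁻ f : Lp H 2 (volume : Measure ℝ)) z.1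
      - (𝓕⁻ f : Lp H 2 (volume : Measure ℝ)) z.2‖ / |z.1 - z.2|) 2
      ((volume : Measure ℝ).prod volume) := by
  set B : Lp H 2 (volume : Measure ℝ) := 𝓕⁻ f with hB
  have hBm : StronglyMeasurable B := Lp.stronglyMeasurable B
  have hfm : StronglyMeasurable f := Lp.stronglyMeasurable f
  have hB1 : StronglyMeasurable fun z : ℝ × ℝ => B z.1 := hBm.comp_measurable measurable_fst
  have hB2 : StronglyMeasurable fun z : ℝ × ℝ => B z.2 := hBm.comp_measurable measurable_snd
  have hQm : StronglyMeasurable fun z : ℝ × ℝ => ‖B z.1 - B z.2‖ / |z.1 - z.2| := by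
    have : Measurable fun z : ℝ × ℝ => |z.1 - z.2| := by fun_prop
    exact ((hB1.sub hB2).norm.measurable.div this).stronglyMeasurable
  refine ⟨hQm.aestronglyMeasurable, ?_⟩
  rw [eLpNorm_lt_top_iff_lintegral_rpow_enorm_lt_top two_ne_zero ENNReal.ofNat_ne_top]
  simp only [ENNReal.toReal_ofNat, ENNReal.rpow_ofNat]
  obtain ⟨C, hC, hCk⟩ := lintegral_one_sub_exp_le
  -- A shift by `η` is multiplication by a phase before transforming, so Plancherel computes the
  -- `L²` norm of each difference exactly.
  have hfix (η : ℝ) : ∫⁻ x, ‖B x - B (x + η)‖ₑ ^ 2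
      = ∫⁻ v : ℝ, ‖1 - Complex.exp (2 * Real.pi * Complex.I * η * v)‖ₑ ^ 2 * ‖f v‖ₑ ^ 2 := by
    have hm : MemLp (fun v : ℝ => Complex.exp (2 * Real.pi * Complex.I * η * v) • f v) 2 volume := by
      refine (Lp.memLp f).of_le ?_ (Eventually.of_forall fun v => ?_)
      · exact (by fun_prop : Continuous fun v : ℝ =>
          Complex.exp (2 * Real.pi * Complex.I * η * v)).aestronglyMeasurable.smul
          hfm.aestronglyMeasurable
      · have : (2 * Real.pi * Complex.I * η * v : ℂ)
            = ((2 * Real.pi * η * v : ℝ) : ℂ) * Complex.I := by push_cast; ring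
        rw [norm_smul, this, Complex.norm_exp_ofReal_mul_I, one_mul]
    set g := hm.toLp
    have hg := hm.coeFn_toLp
    have ht := fourierInv_translate η hg
    have hn : ‖(𝓕⁻ (f - g) : Lp H 2 (volume : Measure ℝ))‖ = ‖f - g‖ :=
      (Lp.fourierTransformₗᵢ ℝ H).symm.norm_map _
    have hsub : (𝓕⁻ (f - g) : Lp H 2 (volume : Measure ℝ)) = B - 𝓕⁻ g :=
      (Lp.fourierTransformₗᵢ ℝ H).symm.map_sub f g
    rw [hsub] at hn
    have hsq (q : Lp H 2 (volume : Measure ℝ)) : ∫⁻ x, ‖q x‖ₑ ^ 2 = ‖q‖ₑ ^ 2 := by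
      rw [Lp.enorm_def, eLpNorm_eq_lintegral_rpow_enorm_toReal two_ne_zero ENNReal.ofNat_ne_top]
      simp only [ENNReal.toReal_ofNat, ENNReal.rpow_ofNat]
      rw [← ENNReal.rpow_natCast, ← ENNReal.rpow_mul]
      simp
    calc ∫⁻ x, ‖B x - B (x + η)‖ₑ ^ 2 = ∫⁻ x, ‖(B - 𝓕⁻ g : Lp H 2 (volume : Measure ℝ)) x‖ₑ ^ 2 := by
          refine lintegral_congr_ae ?_
          filter_upwards [ht, Lp.coeFn_sub B (𝓕⁻ g)] with x hx hx'
          rw [hx', Pi.sub_apply, hx]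
      _ = ∫⁻ v, ‖(f - g : Lp H 2 (volume : Measure ℝ)) v‖ₑ ^ 2 := by
          rw [hsq, hsq, ← ofReal_norm, hn, ofReal_norm]
      _ = _ := by
          refine lintegral_congr_ae ?_
          filter_upwards [hg, Lp.coeFn_sub f g] with v hv hv'
          rw [hv', Pi.sub_apply, hv, ← mul_pow, ← enorm_smul, sub_smul, one_smul]
  have hBη : StronglyMeasurable fun z : ℝ × ℝ => B (z.1 + z.2) :=
    hBm.comp_measurable (by fun_prop)
  have hm1 : Measurable fun z : ℝ × ℝ => ‖B z.1 - B (z.1 + z.2)‖ₑ ^ 2 * ‖z.2⁻¹‖ₑ ^ 2 :=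
    ((hB1.sub hBη).enorm.pow_const 2).mul (by fun_prop)
  have hm2 : Measurable fun z : ℝ × ℝ => ‖1 - Complex.exp (2 * Real.pi * Complex.I * z.1 * z.2)‖ₑ ^ 2
      * ‖f z.2‖ₑ ^ 2 * ‖z.1⁻¹‖ₑ ^ 2 :=
    ((by fun_prop : Measurable fun z : ℝ × ℝ =>
      ‖1 - Complex.exp (2 * Real.pi * Complex.I * z.1 * z.2)‖ₑ ^ 2).mul
      ((hfm.comp_measurable measurable_snd).enorm.pow_const 2)).mul (by fun_prop)
  calc ∫⁻ z : ℝ × ℝ, ‖‖B z.1 - B z.2‖ / |z.1 - z.2|‖ₑ ^ 2 ∂(volume.prod volume)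
      = ∫⁻ x, ∫⁻ y, ‖‖B x - B y‖ / |x - y|‖ₑ ^ 2 :=
        lintegral_prod _ (hQm.enorm.pow_const 2).aemeasurable
    _ = ∫⁻ x, ∫⁻ η, ‖B x - B (x + η)‖ₑ ^ 2 * ‖η⁻¹‖ₑ ^ 2 := by
        refine lintegral_congr fun x => ?_
        rw [← lintegral_add_left_eq_self _ x]
        refine lintegral_congr fun η => ?_
        rw [div_eq_mul_inv, enorm_mul, enorm_norm, mul_pow, sub_add_cancel_left, abs_neg,
          ← abs_inv, Real.enorm_abs]
    _ = ∫⁻ η, ∫⁻ x, ‖B x - B (x + η)‖ₑ ^ 2 * ‖η⁻¹‖ₑ ^ 2 :=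
        lintegral_lintegral_swap hm1.aemeasurable
    _ = ∫⁻ η : ℝ, ∫⁻ v : ℝ, ‖1 - Complex.exp (2 * Real.pi * Complex.I * η * v)‖ₑ ^ 2 * ‖f v‖ₑ ^ 2
          * ‖η⁻¹‖ₑ ^ 2 := by
        refine lintegral_congr fun η => ?_
        rw [lintegral_mul_const, hfix, lintegral_mul_const]
        · exact (by fun_prop : Measurable fun v : ℝ =>
            ‖1 - Complex.exp (2 * Real.pi * Complex.I * η * v)‖ₑ ^ 2).mul (hfm.enorm.pow_const 2)
        · exact (hBm.sub (hBm.comp_measurable (by fun_prop : Measurable fun x : ℝ =>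
            x + η))).enorm.pow_const 2
    _ = ∫⁻ v : ℝ, ∫⁻ η : ℝ, ‖1 - Complex.exp (2 * Real.pi * Complex.I * η * v)‖ₑ ^ 2 * ‖f v‖ₑ ^ 2
          * ‖η⁻¹‖ₑ ^ 2 := lintegral_lintegral_swap hm2.aemeasurable
    _ ≤ ∫⁻ v, C * ‖|v| * ‖f v‖ ^ 2‖ₑ := by
        refine lintegral_mono fun v => ?_
        simp_rw [mul_right_comm _ (‖f v‖ₑ ^ 2)]
        rw [lintegral_mul_const _ (by fun_prop), enorm_mul, Real.enorm_abs, enorm_pow, enorm_norm,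
          ← mul_assoc]
        exact mul_le_mul_left (hCk v) _
    _ < ⊤ := by
        rw [lintegral_const_mul']
        · exact ENNReal.mul_lt_top hC.lt_top hf.2
        · exact hC

end Fourier

/-! ### Calculus of weak derivatives and of `H^(k+1/2)` on a set. -/

section Sobolev

open scoped SchwartzMap ContDiff

lemma setIntegral_eq_integral_of_tsupport_subset {E : Type*} [NormedAddCommGroup E]
    [NormedSpace ℝ E] {Ω : Set ℝ} {χ : ℝ → ℝ} (h : tsupport χ ⊆ Ω) (f : ℝ → E) :
    ∫ x in Ω, χ x • f x = ∫ x, χ x • f x := by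
  refine setIntegral_eq_integral_of_forall_compl_eq_zero fun x hx => ?_
  rw [image_eq_zero_of_notMem_tsupport fun hx' => hx (h hx'), zero_smul]

lemma tsupport_iteratedDeriv_subset (k : ℕ) (χ : ℝ → ℝ) :
    tsupport (iteratedDeriv k χ) ⊆ tsupport χ := by
  induction k with
  | zero => simp
  | succ k ih => rw [iteratedDeriv_succ]; exact (tsupport_deriv_subset (𝕜 := ℝ)).trans ih

lemma HasCompactSupport.iteratedDeriv {χ : ℝ → ℝ} (h : HasCompactSupport χ) (k : ℕ) :
    HasCompactSupport (iteratedDeriv k χ) :=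
  h.mono' ((subset_tsupport _).trans (tsupport_iteratedDeriv_subset k χ))

lemma ContDiff.iteratedDeriv_top {χ : ℝ → ℝ} (h : ContDiff ℝ ∞ χ) (k : ℕ) :
    ContDiff ℝ ∞ (iteratedDeriv k χ) := by
  rw [iteratedDeriv_eq_iterate]; exact h.iterate_deriv k

lemma MeasureTheory.LocallyIntegrableOn.integrableOn_smul_test {E : Type*} [NormedAddCommGroup E]
    [NormedSpace ℝ E] {Ω : Set ℝ} {f : ℝ → E} (hf : LocallyIntegrableOn f Ω) {χ : ℝ → ℝ}
    (h1 : Continuous χ) (h2 : HasCompactSupport χ) (h3 : tsupport χ ⊆ Ω) :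
    IntegrableOn (fun x => χ x • f x) Ω := by
  have h : IntegrableOn (fun x => χ x • f x) (tsupport χ) :=
    (hf.integrableOn_compact_subset h3 h2).continuousOn_smul h1.continuousOn h2
  refine IntegrableOn.integrable_of_forall_notMem_eq_zero h (fun x hx => ?_) |>.integrableOn
  rw [image_eq_zero_of_notMem_tsupport hx, zero_smul]

lemma HasWeakDerivOn.add {k : ℕ} {Ω : Set ℝ} {f f' g g' : ℝ → ℂ} (hf : HasWeakDerivOn k Ω f f')
    (hg : HasWeakDerivOn k Ω g g') : HasWeakDerivOn k Ω (f + g) (f' + g') := by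
  refine ⟨hf.1.add hg.1, hf.2.1.add hg.2.1, fun χ h1 h2 h3 => ?_⟩
  have e1 := hf.2.2 χ h1 h2 h3
  have e2 := hg.2.2 χ h1 h2 h3
  simp only [Pi.add_apply, smul_add]
  have h3' := (tsupport_iteratedDeriv_subset k χ).trans h3
  rw [integral_add (hf.1.integrableOn_smul_test (h1.iteratedDeriv_top k).continuous
      (h2.iteratedDeriv k) h3') (hg.1.integrableOn_smul_test
      (h1.iteratedDeriv_top k).continuous (h2.iteratedDeriv k) h3'),
    integral_add (hf.2.1.integrableOn_smul_test h1.continuous h2 h3)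
      (hg.2.1.integrableOn_smul_test h1.continuous h2 h3), e1, e2, smul_add]

lemma HasWeakDerivOn.neg {k : ℕ} {Ω : Set ℝ} {f f' : ℝ → ℂ} (hf : HasWeakDerivOn k Ω f f') :
    HasWeakDerivOn k Ω (-f) (-f') := by
  refine ⟨hf.1.neg, hf.2.1.neg, fun χ h1 h2 h3 => ?_⟩
  simp only [Pi.neg_apply, smul_neg, integral_neg]
  rw [hf.2.2 χ h1 h2 h3]

lemma HasWeakDerivOn.congr_left {k : ℕ} {Ω : Set ℝ} {f g f' : ℝ → ℂ}
    (hf : HasWeakDerivOn k Ω f f') (h : f =ᵐ[volume.restrict Ω] g) : HasWeakDerivOn k Ω g f' := by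
  refine ⟨fun x hx => ?_, hf.2.1, fun χ h1 h2 h3 => ?_⟩
  · obtain ⟨t, ht, hft⟩ := hf.1 x hx
    refine ⟨t ∩ Ω, inter_mem ht self_mem_nhdsWithin, ?_⟩
    exact (hft.mono_set inter_subset_left).congr_fun_ae
      (ae_restrict_of_ae_restrict_of_subset inter_subset_right h)
  · rw [← hf.2.2 χ h1 h2 h3]
    refine integral_congr_ae ?_
    filter_upwards [h] with x hx
    rw [hx]

/-- The `k`-th derivative of a test function is again a test function, so the two integrations by
parts can be chained. -/
lemma HasWeakDerivOn.comp_succ {k : ℕ} {Ω : Set ℝ} {f g g' : ℝ → ℂ} (hf : HasWeakDerivOn 1 Ω f g)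
    (hg : HasWeakDerivOn k Ω g g') : HasWeakDerivOn (k + 1) Ω f g' := by
  refine ⟨hf.1, hg.2.1, fun χ h1 h2 h3 => ?_⟩
  have e1 := hf.2.2 (iteratedDeriv k χ) (h1.iteratedDeriv_top k) (h2.iteratedDeriv k)
    ((tsupport_iteratedDeriv_subset k χ).trans h3)
  rw [iteratedDeriv_succ, ← iteratedDeriv_one, e1, hg.2.2 χ h1 h2 h3, smul_smul, ← pow_add, add_comm]

lemma MeasureTheory.MemLp.locallyIntegrableOn {Ω : Set ℝ} {f : ℝ → ℂ}
    (hf : MemLp f 2 (volume.restrict Ω)) : LocallyIntegrableOn f Ω := by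
  intro x _
  obtain ⟨t, ht, hft⟩ := hf.locallyIntegrable one_le_two x
  obtain ⟨u, hut, hu, hxu⟩ := mem_nhds_iff.1 ht
  refine ⟨u ∩ Ω, inter_mem (mem_nhdsWithin_of_mem_nhds (hu.mem_nhds hxu)) self_mem_nhdsWithin, ?_⟩
  have := hft.mono_set hut
  rwa [IntegrableOn, Measure.restrict_restrict hu.measurableSet] at this

lemma MeasureTheory.MemLp.hasWeakDerivOn_zero {Ω : Set ℝ} {f : ℝ → ℂ}
    (hf : MemLp f 2 (volume.restrict Ω)) : HasWeakDerivOn 0 Ω f f :=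
  ⟨hf.locallyIntegrableOn, hf.locallyIntegrableOn, fun χ _ _ _ => by simp⟩

lemma MemSobolevHalf.add {Ω : Set ℝ} {f g : ℝ → ℂ} (hf : MemSobolevHalf Ω f)
    (hg : MemSobolevHalf Ω g) : MemSobolevHalf Ω (f + g) := by
  refine ⟨hf.1.add hg.1, ?_⟩
  convert hf.2.add hg.2 using 1
  ext z
  simp only [Pi.add_apply]
  ring

lemma MemSobolevHalf.neg {Ω : Set ℝ} {f : ℝ → ℂ} (hf : MemSobolevHalf Ω f) :
    MemSobolevHalf Ω (-f) := by
  refine ⟨hf.1.neg, ?_⟩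
  convert hf.2.neg using 1
  ext z
  simp only [Pi.neg_apply]
  ring

lemma MemSobolevNatAddHalf.add {k : ℕ} {Ω : Set ℝ} {f g : ℝ → ℂ}
    (hf : MemSobolevNatAddHalf k Ω f) (hg : MemSobolevNatAddHalf k Ω g) :
    MemSobolevNatAddHalf k Ω (f + g) := by
  obtain ⟨⟨hf1, hf2⟩, f', hf3, hf4⟩ := hf
  obtain ⟨⟨hg1, hg2⟩, g', hg3, hg4⟩ := hg
  refine ⟨⟨hf1.add hg1, fun j hj => ?_⟩, f' + g', hf3.add hg3, hf4.add hg4⟩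
  obtain ⟨u, hu, hu'⟩ := hf2 j hj
  obtain ⟨v, hv, hv'⟩ := hg2 j hj
  exact ⟨u + v, hu.add hv, hu'.add hv'⟩

lemma MemSobolevNatAddHalf.neg {k : ℕ} {Ω : Set ℝ} {f : ℝ → ℂ}
    (hf : MemSobolevNatAddHalf k Ω f) : MemSobolevNatAddHalf k Ω (-f) := by
  obtain ⟨⟨hf1, hf2⟩, f', hf3, hf4⟩ := hf
  refine ⟨⟨hf1.neg, fun j hj => ?_⟩, -f', hf3.neg, hf4.neg⟩
  obtain ⟨u, hu, hu'⟩ := hf2 j hj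
  exact ⟨-u, hu.neg, hu'.neg⟩

lemma MemSobolevNatAddHalf.congr {k : ℕ} {Ω : Set ℝ} {f g : ℝ → ℂ}
    (hf : MemSobolevNatAddHalf k Ω f) (h : f =ᵐ[volume.restrict Ω] g) :
    MemSobolevNatAddHalf k Ω g := by
  obtain ⟨⟨hf1, hf2⟩, f', hf3, hf4⟩ := hf
  refine ⟨⟨hf1.ae_eq h, fun j hj => ?_⟩, f', hf3.congr_left h, hf4⟩
  obtain ⟨u, hu, hu'⟩ := hf2 j hj
  exact ⟨u, hu.congr_left h, hu'⟩

lemma MemSobolevHalf.memSobolevNatAddHalf {Ω : Set ℝ} {f : ℝ → ℂ} (hf : MemSobolevHalf Ω f) :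
    MemSobolevNatAddHalf 0 Ω f := by
  refine ⟨⟨hf.1, fun j hj => ⟨f, ?_, hf.1⟩⟩, f, hf.1.hasWeakDerivOn_zero, hf⟩
  rw [Nat.le_zero.1 hj]
  exact hf.1.hasWeakDerivOn_zero

/-- The inductive step by which membership in `H^(k+1/2)` climbs from one weak derivative. -/
lemma MemSobolevNatAddHalf.of_weakDeriv {k : ℕ} {Ω : Set ℝ} {f g : ℝ → ℂ}
    (hf : MemLp f 2 (volume.restrict Ω)) (hfg : HasWeakDerivOn 1 Ω f g)
    (hg : MemSobolevNatAddHalf k Ω g) : MemSobolevNatAddHalf (k + 1) Ω f := by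
  obtain ⟨⟨hg1, hg2⟩, g', hg3, hg4⟩ := hg
  refine ⟨⟨hf, fun j hj => ?_⟩, g', hfg.comp_succ hg3, hg4⟩
  rcases j with _ | j
  · exact ⟨f, hf.hasWeakDerivOn_zero, hf⟩
  · obtain ⟨u, hu, hu'⟩ := hg2 j (by omega)
    exact ⟨u, hfg.comp_succ hu, hu'⟩

/-! ### Smooth vector-valued curves paired with a Fourier transform. -/

section FourierCoefficient

set_option linter.unusedSectionVars false

variable {H : Type*} [NormedAddCommGroup H] [InnerProductSpace ℂ H] [CompleteSpace H]

/-- The Fourier transform `∫ e^{iwv} f(v) dv` in the angular variable `w`. -/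
def angularFourier (f : Lp H 2 (volume : Measure ℝ)) (w : ℝ) : H :=
  (𝓕⁻ f : Lp H 2 (volume : Measure ℝ)) (w / (2 * Real.pi))

lemma stronglyMeasurable_angularFourier (f : Lp H 2 (volume : Measure ℝ)) :
    StronglyMeasurable (angularFourier f) :=
  (Lp.stronglyMeasurable _).comp_measurable (by fun_prop)

lemma map_div_two_pi_volume : Measure.map (fun x : ℝ => x / (2 * Real.pi)) volume
    = ENNReal.ofReal (2 * Real.pi) • volume := by
  have := Real.map_volume_mul_left (a := (2 * Real.pi)⁻¹) (by positivity)
  rw [inv_inv, abs_of_pos Real.two_pi_pos] at this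
  rw [← this]
  congr 1
  ext x
  ring

lemma memLp_angularFourier (f : Lp H 2 (volume : Measure ℝ)) :
    MemLp (angularFourier f) 2 volume := by
  have h : MemLp (𝓕⁻ f : Lp H 2 (volume : Measure ℝ)) 2
      (Measure.map (fun x : ℝ => x / (2 * Real.pi)) volume) := by
    rw [map_div_two_pi_volume]
    exact (Lp.memLp _).smul_measure ENNReal.ofReal_ne_top
  exact h.comp_of_map (by fun_prop)

lemma memLp_gagliardo_angularFourier (f : Lp H 2 (volume : Measure ℝ))
    (hf : Integrable fun v : ℝ => |v| * ‖f v‖ ^ 2) :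
    MemLp (fun z : ℝ × ℝ => ‖angularFourier f z.1 - angularFourier f z.2‖ / |z.1 - z.2|) 2
      ((volume : Measure ℝ).prod volume) := by
  have hd : Measurable fun x : ℝ => x / (2 * Real.pi) := by fun_prop
  have h : MemLp (fun z : ℝ × ℝ => ‖(𝓕⁻ f : Lp H 2 (volume : Measure ℝ)) z.1
      - (𝓕⁻ f : Lp H 2 (volume : Measure ℝ)) z.2‖ / |z.1 - z.2|) 2
      (Measure.map (Prod.map (fun x : ℝ => x / (2 * Real.pi)) (fun x : ℝ => x / (2 * Real.pi)))
        ((volume : Measure ℝ).prod volume)) := by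
    rw [← Measure.map_prod_map _ _ hd hd, map_div_two_pi_volume, Measure.prod_smul_left,
      Measure.prod_smul_right]
    exact ((memLp_gagliardo_fourierInv f hf).smul_measure ENNReal.ofReal_ne_top).smul_measure
      ENNReal.ofReal_ne_top
  have h2 := (h.comp_of_map (by fun_prop)).const_mul (2 * Real.pi)⁻¹
  refine h2.ae_eq (Eventually.of_forall fun z => ?_)
  simp only [Function.comp, Prod.map, angularFourier]
  rw [← sub_div, abs_div, abs_of_pos Real.two_pi_pos]
  field_simp

/-- Rescaling the frequency by `2π` removes the factor `2π` from the multiplier, so that a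
derivative corresponds to `iv`. -/
lemma integral_inner_deriv_angularFourier {f g : Lp H 2 (volume : Measure ℝ)}
    (hg : ∀ᵐ v : ℝ, g v = (Complex.I * v : ℂ) • f v)
    {Ψ : ℝ → H} (hΨ : ContDiff ℝ ∞ Ψ) (hc : HasCompactSupport Ψ) :
    ∫ x, inner ℂ (deriv Ψ x) (angularFourier f x) = -∫ x, inner ℂ (Ψ x) (angularFourier g x) := by
  have h2 : (2 * Real.pi : ℂ) ≠ 0 := by
    simp
  have hp : (2 * Real.pi : ℝ) ≠ 0 := by positivity
  have hΨ' : ContDiff ℝ ∞ fun x => Ψ (2 * Real.pi * x) := hΨ.comp (contDiff_const.mul contDiff_id)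
  have hc' : HasCompactSupport fun x => Ψ (2 * Real.pi * x) :=
    hc.comp_homeomorph (Homeomorph.mulLeft₀ _ hp)
  have hcg : ∀ᵐ v : ℝ, ((2 * Real.pi : ℂ) • g : Lp H 2 (volume : Measure ℝ)) v
      = (2 * Real.pi * Complex.I * v : ℂ) • f v := by
    filter_upwards [hg, Lp.coeFn_smul (2 * Real.pi : ℂ) g] with v h1 h2
    rw [h2, Pi.smul_apply, h1, smul_smul, mul_assoc, mul_assoc, mul_assoc]
  have key := integral_inner_deriv_fourierInv hcg hΨ' hc'
  have hsm : (𝓕⁻ ((2 * Real.pi : ℂ) • g) : Lp H 2 (volume : Measure ℝ))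
      = (2 * Real.pi : ℂ) • (𝓕⁻ g : Lp H 2 (volume : Measure ℝ)) :=
    (Lp.fourierTransformₗᵢ ℝ H).symm.map_smul _ g
  have e1 : ∀ x, deriv (fun x => Ψ (2 * Real.pi * x)) x
      = (2 * Real.pi : ℂ) • deriv Ψ (2 * Real.pi * x) := by
    intro x
    rw [deriv_comp_mul_left, ← Complex.coe_smul]
    simp
  simp only [e1, inner_smul_left] at key
  rw [integral_const_mul] at key
  have e2 : ∫ x, inner ℂ (Ψ (2 * Real.pi * x))
      ((𝓕⁻ ((2 * Real.pi : ℂ) • g) : Lp H 2 (volume : Measure ℝ)) x)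
      = (2 * Real.pi : ℂ) * ∫ x, inner ℂ (Ψ (2 * Real.pi * x))
        ((𝓕⁻ g : Lp H 2 (volume : Measure ℝ)) x) := by
    rw [← integral_const_mul]
    refine integral_congr_ae ?_
    rw [hsm]
    filter_upwards [Lp.coeFn_smul (2 * Real.pi : ℂ) (𝓕⁻ g : Lp H 2 (volume : Measure ℝ))] with v h2
    rw [h2, Pi.smul_apply, inner_smul_right]
  have hconj : (starRingEnd ℂ) (2 * Real.pi : ℂ) = 2 * Real.pi := by
    simp [Complex.conj_ofNat]
  rw [e2, hconj, ← mul_neg] at key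
  have key' := mul_left_cancel₀ h2 key
  have sub (q : Lp H 2 (volume : Measure ℝ)) (Θ : ℝ → H) :
      ∫ x, inner ℂ (Θ (2 * Real.pi * x)) ((𝓕⁻ q : Lp H 2 (volume : Measure ℝ)) x)
        = |(2 * Real.pi)⁻¹| • ∫ x, inner ℂ (Θ x) (angularFourier q x) := by
    rw [← Measure.integral_comp_mul_left]
    refine integral_congr_ae (Eventually.of_forall fun x => ?_)
    simp only [angularFourier]
    rw [mul_div_cancel_left₀ _ hp]
  rw [sub f (deriv Ψ), sub g Ψ, ← smul_neg] at key'
  exact smul_right_injective ℂ (by positivity) key'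

lemma integrable_inner_angularFourier {Ψ : ℝ → H} (hΨ : Continuous Ψ) (hc : HasCompactSupport Ψ)
    (f : Lp H 2 (volume : Measure ℝ)) :
    Integrable fun x => inner ℂ (Ψ x) (angularFourier f x) := by
  have h1 : MemLp Ψ 2 volume := hΨ.memLp_of_hasCompactSupport hc
  refine (h1.norm.integrable_mul (memLp_angularFourier f).norm).mono'
    (hΨ.aestronglyMeasurable.inner (stronglyMeasurable_angularFourier f).aestronglyMeasurable)
    (Eventually.of_forall fun x => norm_inner_le_norm _ _)

lemma memLp_inner_angularFourier {G : ℝ → H} (hG : Continuous G) (hc : HasCompactSupport G)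
    (f : Lp H 2 (volume : Measure ℝ)) :
    MemLp (fun x => inner ℂ (G x) (angularFourier f x)) 2 volume := by
  obtain ⟨M, hM⟩ := hc.exists_bound_of_continuous hG
  refine ((memLp_angularFourier f).norm.const_mul M).of_le
    (hG.aestronglyMeasurable.inner (stronglyMeasurable_angularFourier f).aestronglyMeasurable)
    (Eventually.of_forall fun x => ?_)
  have hM0 : 0 ≤ M := (norm_nonneg _).trans (hM 0)
  rw [norm_mul, norm_norm, Real.norm_eq_abs, abs_of_nonneg hM0]
  exact (norm_inner_le_norm _ _).trans (mul_le_mul_of_nonneg_right (hM x) (norm_nonneg _))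

/-- In the difference quotient of the product, the increment of `G` is Lipschitz and leaves an `L²`
function of one variable, harmless on a set of finite measure. The increment of the transform is
controlled by its Gagliardo semi-norm and the sup of `G`. -/
lemma memSobolevHalf_inner_angularFourier {G : ℝ → H} (hG : ContDiff ℝ ∞ G)
    (hc : HasCompactSupport G) (f : Lp H 2 (volume : Measure ℝ))
    (hf : Integrable fun v : ℝ => |v| * ‖f v‖ ^ 2) {Ω : Set ℝ} (hΩ : volume Ω < ⊤) :
    MemSobolevHalf Ω fun x => inner ℂ (G x) (angularFourier f x) := by
  refine ⟨(memLp_inner_angularFourier hG.continuous hc f).restrict Ω, ?_⟩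
  obtain ⟨M, hM⟩ := hc.exists_bound_of_continuous hG.continuous
  obtain ⟨L, hL⟩ := hG.lipschitzWith_of_hasCompactSupport hc (by simp)
  have : IsFiniteMeasure (volume.restrict Ω) := ⟨by simpa using hΩ⟩
  have hFm := stronglyMeasurable_angularFourier f
  have hin : StronglyMeasurable fun x => inner ℂ (G x) (angularFourier f x) :=
    hG.continuous.stronglyMeasurable.inner hFm
  have b1 : MemLp (fun z : ℝ × ℝ => (L : ℝ) * ‖angularFourier f z.1‖) 2
      ((volume.restrict Ω).prod (volume.restrict Ω)) :=
    (((memLp_angularFourier f).restrict Ω).norm.comp_fst _).const_mul _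
  have b2 : MemLp (fun z : ℝ × ℝ => M * (‖angularFourier f z.1 - angularFourier f z.2‖
      / |z.1 - z.2|)) 2 ((volume.restrict Ω).prod (volume.restrict Ω)) := by
    rw [Measure.prod_restrict]
    exact ((memLp_gagliardo_angularFourier f hf).restrict _).const_mul _
  refine (b1.add b2).of_le ?_ (Eventually.of_forall fun z => ?_)
  · have h1 : StronglyMeasurable fun z : ℝ × ℝ => inner ℂ (G z.1) (angularFourier f z.1) :=
      hin.comp_measurable measurable_fst
    have h2 : StronglyMeasurable fun z : ℝ × ℝ => inner ℂ (G z.2) (angularFourier f z.2) :=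
      hin.comp_measurable measurable_snd
    have h3 : Measurable fun z : ℝ × ℝ => ((|z.1 - z.2| : ℝ) : ℂ) := by fun_prop
    exact ((h1.sub h2).measurable.div h3).aestronglyMeasurable
  · have hM0 : 0 ≤ M := (norm_nonneg _).trans (hM 0)
    rw [norm_div, Complex.norm_real, Real.norm_eq_abs, abs_abs]
    refine le_trans ?_ (le_abs_self _)
    rcases eq_or_ne z.1 z.2 with hz | hz
    · simp only [Pi.add_apply, hz, sub_self, norm_zero, abs_zero, div_zero, mul_zero, add_zero]
      positivity
    have hz' : 0 < |z.1 - z.2| := abs_pos.2 (sub_ne_zero.2 hz)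
    rw [div_le_iff₀ hz', Pi.add_apply, add_mul, mul_assoc M, div_mul_cancel₀ _ hz'.ne']
    have e : inner ℂ (G z.1) (angularFourier f z.1) - inner ℂ (G z.2) (angularFourier f z.2)
        = inner ℂ (G z.1 - G z.2) (angularFourier f z.1)
          + inner ℂ (G z.2) (angularFourier f z.1 - angularFourier f z.2) := by
      rw [inner_sub_left, inner_sub_right]; ring
    rw [e]
    refine (norm_add_le _ _).trans (add_le_add ?_ ?_)
    · refine (norm_inner_le_norm _ _).trans ?_
      have := hL.dist_le_mul z.1 z.2
      rw [dist_eq_norm, Real.dist_eq] at this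
      calc _ ≤ (L * |z.1 - z.2|) * ‖angularFourier f z.1‖ :=
            mul_le_mul_of_nonneg_right this (norm_nonneg _)
        _ = _ := by ring
    · exact (norm_inner_le_norm _ _).trans (mul_le_mul_of_nonneg_right (hM _) (norm_nonneg _))

/-- The product rule for a smooth function against an angular Fourier transform. -/
lemma hasWeakDerivOn_inner_angularFourier {G : ℝ → H} (hG : ContDiff ℝ ∞ G)
    (hc : HasCompactSupport G) {f g : Lp H 2 (volume : Measure ℝ)}
    (hg : ∀ᵐ v : ℝ, g v = (Complex.I * v : ℂ) • f v) (Ω : Set ℝ) :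
    HasWeakDerivOn 1 Ω (fun x => inner ℂ (G x) (angularFourier f x))
      ((fun x => inner ℂ (deriv G x) (angularFourier f x))
        + fun x => inner ℂ (G x) (angularFourier g x)) := by
  have hG' : ContDiff ℝ ∞ (deriv G) := hG.iterate_deriv 1
  have m0 := memLp_inner_angularFourier hG.continuous hc f
  have m1 := memLp_inner_angularFourier hG'.continuous hc.deriv f
  have m2 := memLp_inner_angularFourier hG.continuous hc g
  refine ⟨(m0.restrict Ω).locallyIntegrableOn, ((m1.add m2).restrict Ω).locallyIntegrableOn,
    fun χ h1 h2 h3 => ?_⟩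
  rw [iteratedDeriv_one, setIntegral_eq_integral_of_tsupport_subset h3,
    setIntegral_eq_integral_of_tsupport_subset ((tsupport_deriv_subset (𝕜 := ℝ)).trans h3)]
  have hΨ : ContDiff ℝ ∞ fun x => χ x • G x := h1.smul hG
  have hΨc : HasCompactSupport fun x => χ x • G x := h2.smul_right
  have key := integral_inner_deriv_angularFourier hg hΨ hΨc
  have h1' : ContDiff ℝ ∞ (deriv χ) := h1.iterate_deriv 1
  have ed : ∀ x, deriv (fun x => χ x • G x) x = deriv χ x • G x + χ x • deriv G x := by
    intro x
    have a1 := (h1.differentiable (by simp) x).hasDerivAt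
    have a2 := (hG.differentiable (by simp) x).hasDerivAt
    rw [(a1.fun_smul a2).deriv, add_comm]
  have er (c : ℝ) (u v : H) : inner ℂ (c • u) v = c • inner ℂ u v := by
    rw [← Complex.coe_smul, inner_smul_left, Complex.conj_ofReal, Complex.real_smul]
  have i1 : Integrable fun x => deriv χ x • inner ℂ (G x) (angularFourier f x) := by
    simp_rw [← er]
    exact integrable_inner_angularFourier (h1'.smul hG).continuous h2.deriv.smul_right f
  have i2 : Integrable fun x => χ x • inner ℂ (deriv G x) (angularFourier f x) := by
    simp_rw [← er]
    exact integrable_inner_angularFourier (h1.smul hG').continuous h2.smul_right f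
  have i3 : Integrable fun x => χ x • inner ℂ (G x) (angularFourier g x) := by
    simp_rw [← er]
    exact integrable_inner_angularFourier hΨ.continuous hΨc g
  simp only [ed, inner_add_left, er] at key
  rw [integral_add i1 i2] at key
  simp only [Pi.add_apply, smul_add]
  rw [integral_add i2 i3, eq_sub_of_add_eq key, pow_one, neg_one_smul]
  ring

/-- If `∫ (1 + |v|^{2k+1}) ‖f‖² dv < ∞`, then the Fourier transform of `f`, paired with a smooth
function, lies in `H^{k + 1/2}` on every set of finite measure. -/
theorem memSobolevNatAddHalf_inner_angularFourier (k : ℕ) {Ω : Set ℝ} (hΩ : volume Ω < ⊤)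
    (f : Lp H 2 (volume : Measure ℝ)) (hf : Integrable fun v : ℝ => |v| ^ (2 * k + 1) * ‖f v‖ ^ 2)
    {G : ℝ → H} (hG : ContDiff ℝ ∞ G) (hc : HasCompactSupport G) :
    MemSobolevNatAddHalf k Ω fun x => inner ℂ (G x) (angularFourier f x) := by
  have hsq (q : Lp H 2 (volume : Measure ℝ)) : Integrable fun v => ‖q v‖ ^ 2 :=
    (Lp.memLp q).integrable_norm_pow two_ne_zero
  -- Lower weights come for free, because `q` is in `L²` and `|v|^m ≤ 1 + |v|^n`.
  have low {m n : ℕ} (hmn : m ≤ n) (q : Lp H 2 (volume : Measure ℝ))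
      (hq : Integrable fun v : ℝ => |v| ^ n * ‖q v‖ ^ 2) :
      Integrable fun v : ℝ => |v| ^ m * ‖q v‖ ^ 2 := by
    refine ((hsq q).add hq).mono' ?_ (Eventually.of_forall fun v => ?_)
    · exact (by fun_prop : Continuous fun v : ℝ => |v| ^ m).aestronglyMeasurable.mul (hsq q).1
    · rw [Real.norm_of_nonneg (by positivity), Pi.add_apply]
      nth_rewrite 2 [← one_mul (‖q v‖ ^ 2)]
      rw [← add_mul]
      refine mul_le_mul_of_nonneg_right ?_ (by positivity)
      rcases le_total |v| 1 with h | h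
      · have := pow_le_one₀ (n := m) (abs_nonneg v) h
        have := pow_nonneg (abs_nonneg v) n
        linarith
      · have := pow_le_pow_right₀ h hmn
        linarith
  -- Both `f` and `G` vary: the product rule replaces either `G` by its derivative or `f` by `ivf`,
  -- and the latter uses up two powers of the weight.
  induction k generalizing f G with
  | zero =>
    exact (memSobolevHalf_inner_angularFourier hG hc f (by simpa using hf)
      hΩ).memSobolevNatAddHalf
  | succ k ih =>
    have hm : MemLp (fun v : ℝ => (Complex.I * v : ℂ) • f v) 2 volume := by
      have hms : AEStronglyMeasurable (fun v : ℝ => (Complex.I * v : ℂ) • f v) volume :=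
        (by fun_prop : Continuous fun v : ℝ => (Complex.I * v : ℂ)).aestronglyMeasurable.smul
          (Lp.aestronglyMeasurable f)
      rw [← memLp_norm_iff hms, memLp_two_iff_integrable_sq hms.norm]
      refine (low (show 2 ≤ 2 * (k + 1) + 1 by omega) f hf).congr (Eventually.of_forall fun v => ?_)
      simp [norm_smul, mul_pow]
    have hg := hm.coeFn_toLp
    set g := hm.toLp
    have hgk : Integrable fun v : ℝ => |v| ^ (2 * k + 1) * ‖g v‖ ^ 2 := by
      refine hf.congr ?_
      filter_upwards [hg] with v hv
      rw [hv, norm_smul]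
      simp only [norm_mul, Complex.norm_I, Complex.norm_real, Real.norm_eq_abs, one_mul]
      ring
    refine MemSobolevNatAddHalf.of_weakDeriv
      ((memLp_inner_angularFourier hG.continuous hc f).restrict Ω)
      (hasWeakDerivOn_inner_angularFourier hG hc hg Ω) (MemSobolevNatAddHalf.add ?_ ?_)
    · exact ih f (low (by omega) f hf) (hG.iterate_deriv 1) hc.deriv
    · exact ih g hgk hG hc

end FourierCoefficient

end Sobolev

/-! ### Bounded perturbations of a diagonal operator with spectral gaps. -/

section Perturbation

variable {E : Type*} [NormedAddCommGroup E] [InnerProductSpace ℝ E]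

/-- `f` is an eigenvector, with eigenvalue `μ`, of the sum of the diagonal operator `κ` in the
Hilbert basis `b` and of the bounded operator `A`, in the weak sense. -/
def IsWeakEigenpair (b : HilbertBasis ℕ ℝ E) (κ : ℕ → ℝ) (A : E →L[ℝ] E) (μ : ℝ) (f : E) : Prop :=
  f ≠ 0 ∧ ∀ k, κ k * inner ℝ (b k) f = inner ℝ (b k) (μ • f - A f)

lemma HilbertBasis.hasSum_sq (b : HilbertBasis ℕ ℝ E) (f : E) :
    HasSum (fun k => inner ℝ (b k) f ^ 2) (‖f‖ ^ 2) := by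
  rw [← real_inner_self_eq_norm_sq]
  refine (b.hasSum_inner_mul_inner f f).congr_fun fun k => ?_
  rw [real_inner_comm, sq]

/-- The operator which is diagonal in a Hilbert basis. -/
def HilbertBasis.diag (b : HilbertBasis ℕ ℝ E) (d : ℕ → ℝ) (C : ℝ) (hC : ∀ k, |d k| ≤ C) :
    E →L[ℝ] E :=
  (b.repr.symm.toContinuousLinearEquiv : lp (fun _ : ℕ => ℝ) 2 →L[ℝ] E) ∘L
    (lp.mapCLM 2 (fun k => d k • ContinuousLinearMap.id ℝ ℝ) ((abs_nonneg _).trans (hC 0))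
      (fun k => by
        rw [norm_smul, Real.norm_eq_abs]
        exact (mul_le_of_le_one_right (abs_nonneg _) ContinuousLinearMap.norm_id_le).trans (hC k)))
      ∘L (b.repr.toContinuousLinearEquiv : E →L[ℝ] lp (fun _ : ℕ => ℝ) 2)

lemma HilbertBasis.inner_diag (b : HilbertBasis ℕ ℝ E) (d : ℕ → ℝ) (C : ℝ) (hC : ∀ k, |d k| ≤ C)
    (f : E) (k : ℕ) : inner ℝ (b k) (b.diag d C hC f) = d k * inner ℝ (b k) f := by
  rw [← b.repr_apply_apply, ← b.repr_apply_apply]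
  simp [HilbertBasis.diag]

lemma HilbertBasis.ext_inner (b : HilbertBasis ℕ ℝ E) {f g : E}
    (h : ∀ k, inner ℝ (b k) f = inner ℝ (b k) g) : f = g := by
  apply b.repr.injective
  ext k
  rw [b.repr_apply_apply, b.repr_apply_apply, h]

variable {b : HilbertBasis ℕ ℝ E} {κ : ℕ → ℝ}

lemma one_le_abs_sub_of_gap (hκ : ∀ k, κ k + 1 ≤ κ (k + 1)) {j k : ℕ} (h : j ≠ k) :
    1 ≤ |κ j - κ k| := by
  have mono : Monotone κ := monotone_nat_of_le_succ fun k => by linarith [hκ k]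
  have key {i l : ℕ} (h : i < l) : κ i + 1 ≤ κ l := (hκ i).trans (mono h)
  rcases lt_or_gt_of_ne h with h | h
  · rw [abs_sub_comm, abs_of_nonneg] <;> linarith [key h]
  · rw [abs_of_nonneg] <;> linarith [key h]

lemma lt_of_gap (hκ : ∀ k, κ k + 1 ≤ κ (k + 1)) {j k : ℕ} (h : j < k) : κ j + 1 ≤ κ k :=
  (hκ j).trans ((monotone_nat_of_le_succ fun k => by linarith [hκ k] : Monotone κ) h)

lemma IsWeakEigenpair.coeff_eq {A : E →L[ℝ] E} {μ : ℝ} {f : E}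
    (h : ∀ k, κ k * inner ℝ (b k) f = inner ℝ (b k) (μ • f - A f)) (k : ℕ) :
    (κ k - μ) * inner ℝ (b k) f = -inner ℝ (b k) (A f) := by
  rw [sub_mul, h k, inner_sub_right, inner_smul_right]; ring

/-- Eigenvalues stay close to the unperturbed ones. -/
lemma IsWeakEigenpair.exists_near {A : E →L[ℝ] E} {μ : ℝ} {f : E}
    (h : IsWeakEigenpair b κ A μ f) (hA : ‖A‖ ≤ 1 / 16) : ∃ k, |κ k - μ| < 1 / 4 := by
  by_contra! hc
  -- If every `|κ k - μ|` were at least `1/4`, Parseval applied to `(κ k - μ) f_k = -(A f)_k` would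
  -- give `‖A f‖ ≥ ‖f‖ / 4`, against `‖A‖ ≤ 1/16`.
  have h1 := b.hasSum_sq (A f)
  have h2 := (b.hasSum_sq f).mul_left ((1 / 4) ^ 2)
  have h3 := hasSum_le (fun k => ?_) h2 h1
  · have h4 : ‖A f‖ ≤ 1 / 16 * ‖f‖ := (A.le_opNorm f).trans (by gcongr)
    have h5 : 0 < ‖f‖ := norm_pos_iff.2 h.1
    nlinarith [norm_nonneg (A f)]
  · have := IsWeakEigenpair.coeff_eq h.2 k
    rw [← neg_sq (inner ℝ (b k) (A f)), ← this, mul_pow, ← sq_abs (κ k - μ)]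
    gcongr
    exact hc k

/-- Eigenvectors concentrate on the unperturbed ones. -/
lemma IsWeakEigenpair.norm_sub_le (hκ : ∀ k, κ k + 1 ≤ κ (k + 1)) {A : E →L[ℝ] E} {μ : ℝ} {f : E}
    (h : ∀ k, κ k * inner ℝ (b k) f = inner ℝ (b k) (μ • f - A f)) (hA : ‖A‖ ≤ 1 / 16) {j : ℕ}
    (hj : |κ j - μ| < 1 / 4) : ‖f - inner ℝ (b j) f • b j‖ ≤ 1 / 8 * ‖f‖ := by
  have hjk (k : ℕ) : inner ℝ (b k) (b j) = if k = j then (1 : ℝ) else 0 :=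
    orthonormal_iff_ite.1 b.orthonormal k j
  have h1 := b.hasSum_sq (A f)
  -- Away from `j` the gap leaves `|κ k - μ| ≥ 1 - 1/4 ≥ 1/2`, so half of the remainder is bounded
  -- by `‖A f‖`.
  have h2 := (b.hasSum_sq (f - inner ℝ (b j) f • b j)).mul_left ((1 / 2) ^ 2)
  have h3 := hasSum_le (fun k => ?_) h2 h1
  · have h4 : ‖A f‖ ≤ 1 / 16 * ‖f‖ := (A.le_opNorm f).trans (by gcongr)
    rw [← mul_pow] at h3
    have := abs_le_of_sq_le_sq h3 (norm_nonneg _)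
    have h6 := (le_abs_self _).trans (this.trans h4)
    linarith
  · rw [inner_sub_right, inner_smul_right, hjk]
    split_ifs with hk
    · subst hk
      simp only [mul_one, sub_self, zero_pow two_ne_zero, mul_zero]
      positivity
    · rw [mul_zero, sub_zero, ← neg_sq (inner ℝ (b k) (A f)), ← IsWeakEigenpair.coeff_eq h k,
        mul_pow, ← sq_abs (κ k - μ)]
      have h7 := one_le_abs_sub_of_gap hκ hk
      have h8 : |κ k - κ j| ≤ |κ k - μ| + |κ j - μ| := by
        rw [abs_sub_comm (κ j) μ]; exact abs_sub_le _ _ _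
      gcongr
      linarith

/-- The unbounded diagonal part is never applied to a vector: expanding both pairings by Parseval
gives the same terms `κ k f_k f'_k`. Symmetry of `A` then leaves `(μ - μ') ⟨f, f'⟩ = 0`. -/
lemma IsWeakEigenpair.inner_eq_zero {A : E →L[ℝ] E}
    (hA : ∀ f g, inner ℝ (A f) g = inner ℝ f (A g)) {μ μ' : ℝ} {f f' : E}
    (h : IsWeakEigenpair b κ A μ f) (h' : IsWeakEigenpair b κ A μ' f') (hμ : μ ≠ μ') :
    inner ℝ f f' = 0 := by
  have h1 := b.hasSum_inner_mul_inner (μ • f - A f) f'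
  have h2 := b.hasSum_inner_mul_inner f (μ' • f' - A f')
  have e : inner ℝ (μ • f - A f) f' = inner ℝ f (μ' • f' - A f') := by
    refine h1.unique (h2.congr_fun fun k => ?_)
    rw [← h'.2 k, real_inner_comm, ← h.2 k, real_inner_comm]
    ring
  rw [inner_sub_left, inner_sub_right, hA, inner_smul_left, inner_smul_right] at e
  have : (μ - μ') * inner ℝ f f' = 0 := by
    simp only [conj_trivial] at e
    linarith
  exact (mul_eq_zero.1 this).resolve_left (sub_ne_zero.2 hμ)

/-- Near each unperturbed eigenvalue there is at most one eigenvalue, and it is simple. -/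
lemma IsWeakEigenpair.unique (hκ : ∀ k, κ k + 1 ≤ κ (k + 1)) {A : E →L[ℝ] E}
    (hA : ∀ f g, inner ℝ (A f) g = inner ℝ f (A g)) (hA' : ‖A‖ ≤ 1 / 16) {μ μ' : ℝ} {f f' : E}
    (h : IsWeakEigenpair b κ A μ f) (h' : IsWeakEigenpair b κ A μ' f') {j : ℕ}
    (hj : |κ j - μ| < 1 / 4) (hj' : |κ j - μ'| < 1 / 4) : μ = μ' ∧ ∃ t : ℝ, f' = t • f := by
  have n1 := IsWeakEigenpair.norm_sub_le hκ h.2 hA' hj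
  have n2 := IsWeakEigenpair.norm_sub_le hκ h'.2 hA' hj'
  have p1 : 0 < ‖f‖ := norm_pos_iff.2 h.1
  have p2 : 0 < ‖f'‖ := norm_pos_iff.2 h'.1
  set c := inner ℝ (b j) f with hc
  set c' := inner ℝ (b j) f' with hc'
  have hbj : ‖b j‖ = 1 := b.orthonormal.1 j
  have l1 : 7 / 8 * ‖f‖ ≤ |c| := by
    have := norm_sub_norm_le f (c • b j)
    rw [norm_smul, hbj, mul_one, Real.norm_eq_abs] at this
    linarith
  have l2 : 7 / 8 * ‖f'‖ ≤ |c'| := by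
    have := norm_sub_norm_le f' (c' • b j)
    rw [norm_smul, hbj, mul_one, Real.norm_eq_abs] at this
    linarith
  have hμ : μ = μ' := by
    by_contra hne
    have h0 := h.inner_eq_zero hA h' hne
    -- Two orthogonal vectors cannot both be concentrated on `b j`: the remainders pair to at most
    -- `1/64 ‖f‖ ‖f'‖`, while `|c c'|` is at least `49/64 ‖f‖ ‖f'‖`.
    have e : inner ℝ (f - c • b j) (f' - c' • b j) = - (c * c') := by
      rw [inner_sub_left, inner_sub_right, inner_sub_right, h0, inner_smul_left, inner_smul_left,
        inner_smul_right, inner_smul_right, real_inner_comm, ← hc, ← hc',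
        real_inner_self_eq_norm_sq, hbj]
      simp
      ring
    have h1 := abs_real_inner_le_norm (f - c • b j) (f' - c' • b j)
    rw [e, abs_neg, abs_mul] at h1
    have h2 : ‖f - c • b j‖ * ‖f' - c' • b j‖ ≤ (1 / 8 * ‖f‖) * (1 / 8 * ‖f'‖) := by gcongr
    have h3 : (7 / 8 * ‖f‖) * (7 / 8 * ‖f'‖) ≤ |c| * |c'| := by gcongr
    nlinarith [mul_pos p1 p2]
  refine ⟨hμ, c' / c, ?_⟩
  subst hμ
  have hc0 : c ≠ 0 := by
    intro h0
    rw [h0, abs_zero] at l1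
    linarith
  -- This combination solves the same equation and has no component along `b j`, so the
  -- concentration estimate bounds its norm by an eighth of itself.
  have hg : ∀ k, κ k * inner ℝ (b k) (f' - (c' / c) • f)
      = inner ℝ (b k) (μ • (f' - (c' / c) • f) - A (f' - (c' / c) • f)) := by
    intro k
    have a1 := h.2 k
    have a2 := h'.2 k
    simp only [map_sub, map_smul, inner_sub_right, inner_smul_right] at a1 a2 ⊢
    rw [mul_sub, a2, mul_left_comm, a1]
    ring
  have n3 := IsWeakEigenpair.norm_sub_le hκ hg hA' hj
  have : inner ℝ (b j) (f' - (c' / c) • f) = 0 := by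
    rw [inner_sub_right, inner_smul_right, ← hc, ← hc', div_mul_cancel₀ _ hc0, sub_self]
  rw [this, zero_smul, sub_zero] at n3
  have : ‖f' - (c' / c) • f‖ = 0 := by linarith [norm_nonneg (f' - (c' / c) • f)]
  exact sub_eq_zero.1 (norm_eq_zero.1 this)

/-- Analytic continuation of a simple eigenvalue. -/
lemma exists_analytic_branch [CompleteSpace E] (b : HilbertBasis ℕ ℝ E)
    (hκ : ∀ k, κ k + 1 ≤ κ (k + 1)) (hκ0 : κ 0 = 0) (V₁ V₂ : E →L[ℝ] E) (j : ℕ) :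
    ∃ (φ : ℝ → E) (Λ : ℝ → ℝ), AnalyticAt ℝ φ 0 ∧ AnalyticAt ℝ Λ 0 ∧ φ 0 = b j ∧ Λ 0 = κ j ∧
      ∀ᶠ x in 𝓝 (0 : ℝ), IsWeakEigenpair b κ (x • V₁ + x ^ 2 • V₂) (Λ x) (φ x) := by
  have hκn (k) : 0 ≤ κ k := by
    rw [← hκ0]
    exact (monotone_nat_of_le_succ fun k => by linarith [hκ k] : Monotone κ) (Nat.zero_le k)
  have hd1 : ∀ k, |(κ k + 1)⁻¹| ≤ 1 := fun k => by
    have := hκn k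
    rw [abs_of_nonneg (by positivity)]
    exact inv_le_one_of_one_le₀ (by linarith)
  -- With `T` the diagonal operator, `K` is `(T + 1)⁻¹`; applying it turns the eigenvalue equation
  -- into one between bounded operators.
  set K := b.diag (fun k => (κ k + 1)⁻¹) 1 hd1 with hK
  have hKk (f : E) (k : ℕ) : inner ℝ (b k) (K f) = (κ k + 1)⁻¹ * inner ℝ (b k) f :=
    b.inner_diag _ _ _ _ _
  -- The reduced inverse of `1 - (κ j + 1) K` off `b j`; the gap keeps these multipliers bounded.
  set m : ℕ → ℝ := fun k => if k = j then 0 else (κ k + 1) / (κ k - κ j) with hm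
  have hd2 : ∀ k, |m k| ≤ κ j + 2 := fun k => by
    rw [hm]
    dsimp only
    split_ifs with h
    · rw [abs_zero]; linarith [hκn j]
    · have h1 := one_le_abs_sub_of_gap hκ h
      rw [abs_div, div_le_iff₀ (by linarith), abs_of_nonneg (by linarith [hκn k])]
      have := le_abs_self (κ k - κ j)
      nlinarith [hκn j]
  set M := b.diag m (κ j + 2) hd2 with hM
  have hMk (f : E) (k : ℕ) : inner ℝ (b k) (M f) = m k * inner ℝ (b k) f :=
    b.inner_diag _ _ _ _ _
  have hjk (k : ℕ) : inner ℝ (b k) (b j) = if k = j then (1 : ℝ) else 0 :=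
    orthonormal_iff_ite.1 b.orthonormal k j
  -- The variables are the parameter, the vector and the eigenvalue. Carrying the parameter along
  -- makes the inverse function theorem serve as an implicit one, and the last component normalises
  -- `⟨b j, f⟩ = 1`.
  let Φ : ℝ × (E × ℝ) → ℝ × (E × ℝ) := fun z =>
    (z.1, (z.2.1 - K ((z.2.2 + 1) • z.2.1 - (z.1 • V₁ z.2.1 + z.1 ^ 2 • V₂ z.2.1)),
      innerSL ℝ (b j) z.2.1))
  let a : ℝ × (E × ℝ) := (0, (b j, κ j))
  have hΦ : ContDiff ℝ ⊤ Φ := by fun_prop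
  let pf : ℝ × (E × ℝ) →L[ℝ] E := ContinuousLinearMap.fst ℝ E ℝ ∘L ContinuousLinearMap.snd ℝ ℝ (E × ℝ)
  let pn : ℝ × (E × ℝ) →L[ℝ] ℝ := ContinuousLinearMap.snd ℝ E ℝ ∘L ContinuousLinearMap.snd ℝ ℝ (E × ℝ)
  let po : ℝ × (E × ℝ) →L[ℝ] ℝ := ContinuousLinearMap.fst ℝ ℝ (E × ℝ)
  let D : ℝ × (E × ℝ) →L[ℝ] ℝ × (E × ℝ) :=
    po.prod ((pf - K ∘L ((κ j + 1) • pf + pn.smulRight (b j) - po.smulRight (V₁ (b j)))).prod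
      ((innerSL ℝ (b j)) ∘L pf))
  have hD : HasFDerivAt Φ D a := by
    have hf : HasFDerivAt (fun z : ℝ × (E × ℝ) => z.2.1) pf a := pf.hasFDerivAt
    have hn : HasFDerivAt (fun z : ℝ × (E × ℝ) => z.2.2) pn a := pn.hasFDerivAt
    have ho : HasFDerivAt (fun z : ℝ × (E × ℝ) => z.1) po a := po.hasFDerivAt
    have h1 := (hn.add_const 1).smul hf
    have h2 := ho.smul (V₁.hasFDerivAt.comp a hf)
    have h3 := (ho.pow 2).smul (V₂.hasFDerivAt.comp a hf)
    have h4 := ho.prodMk ((hf.sub (K.hasFDerivAt.comp a (h1.sub (h2.add h3)))).prodMk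
      ((innerSL ℝ (b j)).hasFDerivAt.comp a hf))
    refine h4.congr_fderiv ?_
    refine ContinuousLinearMap.ext fun z => ?_
    simp [D, a, pf, pn, po]
  have hDapp (z : ℝ × (E × ℝ)) : D z = (z.1, (z.2.1 - K ((κ j + 1) • z.2.1 + z.2.2 • b j
      - z.1 • V₁ (b j)), inner ℝ (b j) z.2.1)) := by
    simp [D, pf, pn, po]
  have hcoef (u : E) (ν : ℝ) (k : ℕ) : inner ℝ (b k) (u - K ((κ j + 1) • u + ν • b j))
      = (κ k - κ j) / (κ k + 1) * inner ℝ (b k) u - if k = j then ν / (κ j + 1) else 0 := by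
    have hk1 : κ k + 1 ≠ 0 := by linarith [hκn k]
    rw [inner_sub_right, hKk, inner_add_right, inner_smul_right, inner_smul_right, hjk]
    split_ifs with h
    · subst h
      field_simp
      ring
    · field_simp
      ring
  have hj1 : κ j + 1 ≠ 0 := by linarith [hκn j]
  have hker : (D : ℝ × (E × ℝ) →ₗ[ℝ] ℝ × (E × ℝ)).ker = ⊥ := by
    rw [LinearMap.ker_eq_bot']
    rintro ⟨t, u, ν⟩ hz
    have hz' : D (t, (u, ν)) = 0 := hz
    rw [hDapp] at hz'
    simp only [Prod.mk_eq_zero] at hz'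
    obtain ⟨rfl, h1, h2⟩ := hz'
    rw [zero_smul, sub_zero] at h1
    have hc (k) := hcoef u ν k
    simp only [h1, inner_zero_right] at hc
    have hν : ν = 0 := by
      have := hc j
      simpa [hj1] using this
    have hu : u = 0 := by
      refine b.ext_inner fun k => ?_
      rw [inner_zero_right]
      rcases eq_or_ne k j with rfl | hk
      · exact h2
      · have h3 := hc k
        have h4 := one_le_abs_sub_of_gap hκ hk
        have h5 : κ k - κ j ≠ 0 := fun h => by rw [h, abs_zero] at h4; linarith
        have h6 : κ k + 1 ≠ 0 := by linarith [hκn k]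
        simpa [hk, h5, h6] using h3
    simp [hν, hu]
  have hran : (D : ℝ × (E × ℝ) →ₗ[ℝ] ℝ × (E × ℝ)).range = ⊤ := by
    rw [LinearMap.range_eq_top]
    rintro ⟨t, y, r⟩
    set y' := y - t • K (V₁ (b j)) with hy'
    -- The component along `b j` is prescribed by `r`. The other components are solved for by `M`,
    -- and the `j`-th equation, in which the vector drops out, determines the increment of the
    -- eigenvalue.
    refine ⟨(t, (r • b j + M y', -(κ j + 1) * inner ℝ (b j) y')), ?_⟩
    change D _ = _
    rw [hDapp]
    refine Prod.ext rfl (Prod.ext ?_ ?_)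
    · have e : r • b j + M y' - K ((κ j + 1) • (r • b j + M y')
          + (-(κ j + 1) * inner ℝ (b j) y') • b j) = y' := by
        refine b.ext_inner fun k => ?_
        rw [hcoef, inner_add_right, inner_smul_right, hjk, hMk]
        split_ifs with h
        · subst h
          field_simp
          ring
        · have h4 := one_le_abs_sub_of_gap hκ h
          have h5 : κ k - κ j ≠ 0 := fun h => by rw [h, abs_zero] at h4; linarith
          have h6 : κ k + 1 ≠ 0 := by linarith [hκn k]
          simp only [hm, if_neg h]
          field_simp
          ring
      change r • b j + M y' - K ((κ j + 1) • (r • b j + M y')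
          + (-(κ j + 1) * inner ℝ (b j) y') • b j - t • V₁ (b j)) = y
      rw [map_sub K, ← sub_add, e, map_smul, hy', sub_add_cancel]
    · change inner ℝ (b j) (r • b j + M y') = r
      rw [inner_add_right, inner_smul_right, hjk, hMk]
      simp [hm]
  set D' := ContinuousLinearEquiv.ofBijective D hker hran with hD'
  have hDD' : (D' : ℝ × (E × ℝ) →L[ℝ] ℝ × (E × ℝ)) = D := rfl
  rw [← hDD'] at hD
  have hΦa : ContDiffAt ℝ ⊤ Φ a := hΦ.contDiffAt
  have ha : Φ a = (0, (0, 1)) := by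
    refine Prod.ext rfl (Prod.ext ?_ ?_)
    · change b j - K ((κ j + 1) • b j - ((0 : ℝ) • V₁ (b j) + (0 : ℝ) ^ 2 • V₂ (b j))) = 0
      refine b.ext_inner fun k => ?_
      rw [inner_sub_right, hKk]
      simp only [zero_smul, ne_eq, OfNat.ofNat_ne_zero, not_false_eq_true, zero_pow, add_zero,
        sub_zero, inner_smul_right, hjk, inner_zero_right]
      split_ifs with h
      · subst h
        field_simp
        ring
      · ring
    · change innerSL ℝ (b j) (b j) = 1
      rw [innerSL_apply_apply, hjk, if_pos rfl]
  set L := hΦa.localInverse hD (by simp) with hL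
  have hLa : L (0, (0, 1)) = a := by
    rw [← ha]; exact hΦa.localInverse_apply_image hD (by simp)
  have hLan : AnalyticAt ℝ L (0, (0, 1)) := by
    rw [← ha]; exact (hΦa.to_localInverse hD (by simp)).analyticAt
  have hinv : ∀ᶠ y in 𝓝 ((0, (0, 1)) : ℝ × (E × ℝ)), Φ (L y) = y := by
    rw [← ha]
    exact (hΦa.hasStrictFDerivAt' hD (by simp)).eventually_right_inverse
  have hι : AnalyticAt ℝ (fun x : ℝ => ((x, (0, 1)) : ℝ × (E × ℝ))) 0 :=
    analyticAt_id.prod analyticAt_const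
  have hψ : AnalyticAt ℝ (fun x : ℝ => L (x, (0, 1))) 0 :=
    AnalyticAt.comp (g := L) (f := fun x : ℝ => ((x, (0, 1)) : ℝ × (E × ℝ))) hLan hι
  refine ⟨fun x => (L (x, (0, 1))).2.1, fun x => (L (x, (0, 1))).2.2, ?_, ?_, ?_, ?_, ?_⟩
  · exact (pf.analyticAt _).comp hψ
  · exact (pn.analyticAt _).comp hψ
  · simp only [hLa, a]
  · simp only [hLa, a]
  · filter_upwards [hι.continuousAt.eventually hinv] with x hx
    set z := L (x, (0, 1))
    have h1 : z.1 = x := congrArg Prod.fst hx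
    have h2 : z.2.1 - K ((z.2.2 + 1) • z.2.1 - (z.1 • V₁ z.2.1 + z.1 ^ 2 • V₂ z.2.1)) = 0 :=
      congrArg (fun q => q.2.1) hx
    have h3 : innerSL ℝ (b j) z.2.1 = 1 := congrArg (fun q => q.2.2) hx
    refine ⟨?_, fun k => ?_⟩
    · intro h0
      rw [h0, map_zero] at h3
      exact zero_ne_one h3
    · have h4 := congrArg (inner ℝ (b k)) h2
      rw [inner_sub_right, hKk, inner_zero_right, h1] at h4
      have h6 : κ k + 1 ≠ 0 := by linarith [hκn k]
      field_simp at h4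
      simp only [inner_sub_right, inner_smul_right, add_smul, one_smul, inner_add_right,
        FunLike.coe_add, FunLike.coe_smul, Pi.add_apply, Pi.smul_apply] at h4 ⊢
      linarith

/-- The number of eigenvalues below a given one determines it. -/
lemma eq_of_encard_lt_eq {S : Set ℝ} {x y : ℝ} (hx : x ∈ S) (hy : y ∈ S) {n : ℕ}
    (h1 : {z | z < x ∧ z ∈ S}.encard = n) (h2 : {z | z < y ∧ z ∈ S}.encard = n) : x = y := by
  have key {x y : ℝ} (hx : x ∈ S) (h1 : {z | z < x ∧ z ∈ S}.encard = n)
      (h2 : {z | z < y ∧ z ∈ S}.encard = n) : ¬ x < y := by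
    intro hlt
    have hsub : insert x {z | z < x ∧ z ∈ S} ⊆ {z | z < y ∧ z ∈ S} := by
      rintro z (rfl | hz)
      · exact ⟨hlt, hx⟩
      · exact ⟨hz.1.trans hlt, hz.2⟩
    have := encard_le_encard hsub
    rw [encard_insert_of_notMem (fun h => lt_irrefl _ h.1), h1, h2] at this
    have h3 : n + 1 ≤ n := by exact_mod_cast this
    omega
  exact le_antisymm (not_lt.1 (key hy h2 h1)) (not_lt.1 (key hx h1 h2))

/-- Analytic perturbation theory for the `n`-th eigenvalue of a diagonal operator with simple
eigenvalues. -/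
theorem exists_analytic_eigenpair [CompleteSpace E] (b : HilbertBasis ℕ ℝ E)
    (hκ : ∀ k, κ k + 1 ≤ κ (k + 1)) (hκ0 : κ 0 = 0) (V₁ V₂ : E →L[ℝ] E)
    (hV₁ : ∀ f g, inner ℝ (V₁ f) g = inner ℝ f (V₁ g))
    (hV₂ : ∀ f g, inner ℝ (V₂ f) g = inner ℝ f (V₂ g)) (n : ℕ) :
    ∃ (ε : ℝ) (φ : ℝ → E) (Λ : ℝ → ℝ), 0 < ε ∧ φ 0 = b n ∧
      ∀ x, |x| < ε → AnalyticAt ℝ φ x ∧ |κ n - Λ x| < 1 / 4 ∧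
        IsWeakEigenpair b κ (x • V₁ + x ^ 2 • V₂) (Λ x) (φ x) ∧
        {μ | μ < Λ x ∧ ∃ f, IsWeakEigenpair b κ (x • V₁ + x ^ 2 • V₂) μ f}.encard = n ∧
        ∀ f, IsWeakEigenpair b κ (x • V₁ + x ^ 2 • V₂) (Λ x) f → ∃ t : ℝ, f = t • φ x := by
  -- Counting needs the branches `0, …, n` simultaneously; finitely many neighbourhoods are
  -- intersected.
  choose φ Λ hφ hΛ hφ0 hΛ0 hev using exists_analytic_branch b hκ hκ0 V₁ V₂
  have hcont : Continuous fun x : ℝ => x • V₁ + x ^ 2 • V₂ := by fun_prop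
  have hA : ∀ᶠ x in 𝓝 (0 : ℝ), ‖x • V₁ + x ^ 2 • V₂‖ < 1 / 16 := by
    refine hcont.norm.continuousAt.eventually_lt continuousAt_const ?_
    simp
  have hΛn (j : ℕ) : ∀ᶠ x in 𝓝 (0 : ℝ), |κ j - Λ j x| < 1 / 4 := by
    have : ContinuousAt (fun x => |κ j - Λ j x|) 0 :=
      (continuousAt_const.sub (hΛ j).continuousAt).abs
    refine this.eventually_lt continuousAt_const ?_
    simp [hΛ0]
  have hall : ∀ᶠ x in 𝓝 (0 : ℝ), ∀ j ∈ Finset.range (n + 1),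
      |κ j - Λ j x| < 1 / 4 ∧ IsWeakEigenpair b κ (x • V₁ + x ^ 2 • V₂) (Λ j x) (φ j x) :=
    (Filter.eventually_all_finset _).2 fun j _ => (hΛn j).and (hev j)
  obtain ⟨ε, hε, hball⟩ := Metric.eventually_nhds_iff.1
    ((hφ n).eventually_analyticAt.and (hA.and hall))
  refine ⟨ε, φ n, Λ n, hε, hφ0 n, fun x hx => ?_⟩
  obtain ⟨h1, h2, h3⟩ := hball (y := x) (by rwa [Real.dist_eq, sub_zero])
  set A := x • V₁ + x ^ 2 • V₂ with hAdef
  have hAs : ∀ f g, inner ℝ (A f) g = inner ℝ f (A g) := by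
    intro f g
    simp only [hAdef, FunLike.coe_add, FunLike.coe_smul, Pi.add_apply, Pi.smul_apply,
      inner_add_left, inner_add_right, inner_smul_left, inner_smul_right, hV₁, hV₂, conj_trivial]
  have h3n := h3 n (by simp)
  refine ⟨h1, h3n.1, h3n.2, ?_, fun f hf => ?_⟩
  -- Each eigenvalue is near some `κ k`. Below `Λ n x` this forces `k ≤ n`, and then uniqueness near
  -- `κ k` identifies it with the `k`-th branch.
  · have himg : {μ | μ < Λ n x ∧ ∃ f, IsWeakEigenpair b κ A μ f}
        = (fun j => Λ j x) '' (Finset.range n : Set ℕ) := by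
      ext μ
      simp only [mem_ofPred_eq, Finset.coe_range, mem_image, mem_Iio]
      constructor
      · rintro ⟨hμ, f, hf⟩
        obtain ⟨k, hk⟩ := hf.exists_near h2.le
        have hkn : k ≤ n := by
          by_contra! hlt
          have a1 := lt_of_gap hκ hlt
          have a2 := abs_lt.1 hk
          have a3 := abs_lt.1 h3n.1
          linarith
        have h3k := h3 k (by simpa using Nat.lt_succ_of_le hkn)
        have hu := (hf.unique hκ hAs h2.le h3k.2 hk h3k.1).1
        refine ⟨k, lt_of_le_of_ne hkn ?_, hu.symm⟩
        rintro rfl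
        exact absurd hμ (by rw [hu]; exact lt_irrefl _)
      · rintro ⟨j, hj, rfl⟩
        have h3j := h3 j (by simp; omega)
        refine ⟨?_, _, h3j.2⟩
        have a1 := lt_of_gap hκ hj
        have a2 := abs_lt.1 h3j.1
        have a3 := abs_lt.1 h3n.1
        linarith
    rw [himg, InjOn.encard_image, Set.encard_coe_eq_coe_finsetCard, Finset.card_range]
    intro i hi j hj hij
    simp only [Finset.coe_range, mem_Iio] at hi hj
    have key {i j : ℕ} (hi : i < n) (hj : j < n) (hij : Λ i x = Λ j x) : ¬ i < j := by
      intro hlt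
      have a1 := lt_of_gap hκ hlt
      have a2 := abs_lt.1 (h3 i (by simp; omega)).1
      have a3 := abs_lt.1 (h3 j (by simp; omega)).1
      linarith
    exact le_antisymm (not_lt.1 (key hj hi hij.symm)) (not_lt.1 (key hi hj hij))
  · exact (h3n.2.unique hκ hAs h2.le hf h3n.1 h3n.1).2

end Perturbation

/-! ### Jacobi polynomials with natural exponents, as algebra. -/

section Jacobi

open Polynomial

/-- The eigenvalues of the Jacobi operator. -/
def jacobiEigenvalue (α β k : ℕ) : ℝ := k * (k + α + β + 1)

lemma jacobiEigenvalue_zero (α β : ℕ) : jacobiEigenvalue α β 0 = 0 := by simp [jacobiEigenvalue]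

lemma jacobiEigenvalue_gap (α β k : ℕ) :
    jacobiEigenvalue α β k + 1 ≤ jacobiEigenvalue α β (k + 1) := by
  simp only [jacobiEigenvalue]
  push_cast
  nlinarith [k.cast_nonneg (α := ℝ), α.cast_nonneg (α := ℝ), β.cast_nonneg (α := ℝ)]

/-- The coefficients, in powers of `1 - x`, of the Jacobi polynomial of degree `k`, normalised to
be `1` at `x = 1`. -/
def jacobiCoeff (α β k : ℕ) : ℕ → ℝ
  | 0 => 1
  | j + 1 => (jacobiEigenvalue α β j - jacobiEigenvalue α β k) / (2 * (j + 1) * (j + 1 + α))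
      * jacobiCoeff α β k j

lemma jacobiCoeff_succ (α β k j : ℕ) : 2 * (j + 1) * (j + 1 + α) * jacobiCoeff α β k (j + 1)
    = (jacobiEigenvalue α β j - jacobiEigenvalue α β k) * jacobiCoeff α β k j := by
  rw [jacobiCoeff]
  field_simp

lemma jacobiCoeff_of_lt {α β k j : ℕ} (h : k < j) : jacobiCoeff α β k j = 0 := by
  induction j, h using Nat.le_induction with
  | base => simp [jacobiCoeff]
  | succ j hj ih => simp [jacobiCoeff, ih]

lemma jacobiCoeff_ne_zero {α β k j : ℕ} (h : j ≤ k) : jacobiCoeff α β k j ≠ 0 := by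
  induction j with
  | zero => simp [jacobiCoeff]
  | succ j ih =>
    have h1 := one_le_abs_sub_of_gap (jacobiEigenvalue_gap α β) (show j ≠ k by omega)
    have h2 : jacobiEigenvalue α β j - jacobiEigenvalue α β k ≠ 0 :=
      fun h => by rw [h, abs_zero] at h1; linarith
    rw [jacobiCoeff]
    exact mul_ne_zero (div_ne_zero h2 (by positivity)) (ih (by omega))

/-- The Jacobi polynomial of degree `k` as a polynomial in `y = 1 - x`. -/
def jacobiAux (α β k : ℕ) : ℝ[X] := ∑ j ∈ Finset.range (k + 1), monomial j (jacobiCoeff α β k j)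

lemma coeff_jacobiAux (α β k j : ℕ) : (jacobiAux α β k).coeff j = jacobiCoeff α β k j := by
  simp only [jacobiAux, finsetSum_coeff, coeff_monomial]
  rw [Finset.sum_ite_eq']
  split_ifs with h
  · rfl
  · rw [jacobiCoeff_of_lt]
    simpa [Nat.lt_succ_iff] using h

/-- In powers of `y = 1 - x` the Jacobi equation is a two-term recursion, the one that defines
`jacobiCoeff`; it terminates after degree `k`. -/
lemma jacobiAux_ode (α β k : ℕ) :
    X * (2 - X) * derivative (derivative (jacobiAux α β k))
      + (C (2 * α + 2 : ℝ) - C (α + β + 2 : ℝ) * X) * derivative (jacobiAux α β k)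
      = -(C (jacobiEigenvalue α β k) * jacobiAux α β k) := by
  have e : X * (2 - X) * derivative (derivative (jacobiAux α β k))
      + (C (2 * α + 2 : ℝ) - C (α + β + 2 : ℝ) * X) * derivative (jacobiAux α β k)
      = C 2 * (X * derivative (derivative (jacobiAux α β k)))
        - X * (X * derivative (derivative (jacobiAux α β k)))
        + C (2 * α + 2 : ℝ) * derivative (jacobiAux α β k)
        - C (α + β + 2 : ℝ) * (X * derivative (jacobiAux α β k)) := by
    have : (C 2 : ℝ[X]) = 2 := map_ofNat C 2
    rw [this]; ring
  rw [e]
  ext j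
  have hs := jacobiCoeff_succ α β k j
  rcases j with _ | _ | j
  · simp only [coeff_sub, coeff_add, coeff_neg, coeff_C_mul, coeff_X_mul_zero, coeff_derivative,
      coeff_jacobiAux]
    simp only [jacobiEigenvalue] at hs ⊢
    push_cast at hs ⊢
    linarith
  · simp only [coeff_sub, coeff_add, coeff_neg, coeff_C_mul, coeff_X_mul_zero, coeff_X_mul,
      coeff_derivative, coeff_jacobiAux]
    simp only [jacobiEigenvalue] at hs ⊢
    push_cast at hs ⊢
    linarith
  · simp only [coeff_sub, coeff_add, coeff_neg, coeff_C_mul, coeff_X_mul,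
      coeff_derivative, coeff_jacobiAux]
    simp only [jacobiEigenvalue] at hs ⊢
    push_cast at hs ⊢
    linarith

/-- The Jacobi polynomial of degree `k`, normalised to be `1` at `x = 1`. -/
def jacobiP (α β k : ℕ) : ℝ[X] := (jacobiAux α β k).comp (1 - X)

/-- The Jacobi weight `(1 - x) ^ α * (1 + x) ^ β`. -/
def jacobiWeight (α β : ℕ) : ℝ[X] := (1 - X) ^ α * (1 + X) ^ β

/-- `Q` is mapped to `-G` by the Jacobi operator. -/
def IsJacobiPair (α β : ℕ) (Q G : ℝ[X]) : Prop :=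
  derivative ((1 - X ^ 2) * jacobiWeight α β * derivative Q) = -(jacobiWeight α β * G)

/-- Since `(1 - X²) ρ = (1 - X)^(α+1) (1 + X)^(β+1)`, differentiation lowers both exponents by one
and leaves a factor `ρ`. -/
lemma derivative_mul_jacobiWeight (α β : ℕ) :
    derivative ((1 - X ^ 2) * jacobiWeight α β)
      = jacobiWeight α β * ((C (β + 1 : ℝ)) * (1 - X) - C (α + 1 : ℝ) * (1 + X)) := by
  have e : (1 - X ^ 2) * jacobiWeight α β = (1 - X) ^ (α + 1) * (1 + X) ^ (β + 1) := by
    rw [jacobiWeight]; ring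
  rw [e, derivative_mul, derivative_pow, derivative_pow, jacobiWeight]
  simp only [derivative_sub, derivative_one, derivative_X, Nat.add_sub_cancel,
    Nat.cast_add, Nat.cast_one, map_add, map_natCast, map_one]
  ring

lemma isJacobiPair_jacobiP (α β k : ℕ) :
    IsJacobiPair α β (jacobiP α β k) (C (jacobiEigenvalue α β k) * jacobiP α β k) := by
  have hode := congrArg (fun q => q.comp (1 - X)) (jacobiAux_ode α β k)
  have hd : derivative (jacobiP α β k) = -(derivative (jacobiAux α β k)).comp (1 - X) := by
    rw [jacobiP, derivative_comp]; simp
  have hdd : derivative (derivative (jacobiP α β k))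
      = (derivative (derivative (jacobiAux α β k))).comp (1 - X) := by
    rw [hd, derivative_neg, derivative_comp]; simp
  simp only [add_comp, mul_comp, sub_comp, neg_comp, X_comp, C_comp, ofNat_comp] at hode
  rw [← hdd, ← neg_eq_iff_eq_neg.2 hd] at hode
  have hode' : (1 - X ^ 2) * derivative (derivative (jacobiP α β k))
      + (C (β + 1 : ℝ) * (1 - X) - C (α + 1 : ℝ) * (1 + X)) * derivative (jacobiP α β k)
      = -(C (jacobiEigenvalue α β k) * jacobiP α β k) := by
    rw [jacobiP] at *
    rw [← hode]
    simp only [map_add, map_mul, map_natCast, map_one, map_ofNat]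
    ring
  rw [IsJacobiPair, derivative_mul, derivative_mul_jacobiWeight]
  linear_combination jacobiWeight α β * hode'

lemma IsJacobiPair.add {α β : ℕ} {Q G Q' G' : ℝ[X]} (h : IsJacobiPair α β Q G)
    (h' : IsJacobiPair α β Q' G') : IsJacobiPair α β (Q + Q') (G + G') := by
  rw [IsJacobiPair] at *
  rw [derivative_add, mul_add, derivative_add, h, h']; ring

lemma IsJacobiPair.C_mul {α β : ℕ} {Q G : ℝ[X]} (h : IsJacobiPair α β Q G) (c : ℝ) :
    IsJacobiPair α β (C c * Q) (C c * G) := by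
  rw [IsJacobiPair] at *
  rw [derivative_C_mul, mul_left_comm, derivative_C_mul, h]; ring

lemma IsJacobiPair.sum {α β : ℕ} {ι : Type*} (s : Finset ι) {Q G : ι → ℝ[X]}
    (h : ∀ i ∈ s, IsJacobiPair α β (Q i) (G i)) :
    IsJacobiPair α β (∑ i ∈ s, Q i) (∑ i ∈ s, G i) := by
  classical
  induction s using Finset.induction_on with
  | empty => simp [IsJacobiPair]
  | insert i s hi ih =>
    rw [Finset.sum_insert hi, Finset.sum_insert hi]
    exact (h i (by simp)).add (ih fun j hj => h j (by simp [hj]))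

lemma jacobiP_zero (α β : ℕ) : jacobiP α β 0 = 1 := by
  simp [jacobiP, jacobiAux, jacobiCoeff]

lemma eval_one_jacobiP (α β k : ℕ) : (jacobiP α β k).eval 1 = 1 := by
  rw [jacobiP, eval_comp]
  simp only [eval_sub, eval_one, eval_X, sub_self]
  rw [← coeff_zero_eq_eval_zero, coeff_jacobiAux]
  rfl

/-- The Jacobi polynomials span all polynomials. -/
lemma span_jacobiP (α β : ℕ) : Submodule.span ℝ (range (jacobiP α β)) = ⊤ := by
  -- The passage from powers of `1 - X` to Jacobi polynomials is triangular with nonzero diagonal.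
  have key (k : ℕ) : (1 - X : ℝ[X]) ^ k ∈ Submodule.span ℝ (range (jacobiP α β)) := by
    induction k using Nat.strong_induction_on with
    | _ k ih =>
      have e : jacobiP α β k = ∑ j ∈ Finset.range k, jacobiCoeff α β k j • (1 - X : ℝ[X]) ^ j
          + jacobiCoeff α β k k • (1 - X : ℝ[X]) ^ k := by
        rw [← Finset.sum_range_succ, jacobiP, jacobiAux, Polynomial.sum_comp]
        refine Finset.sum_congr rfl fun j _ => ?_
        rw [monomial_comp, smul_eq_C_mul]
      have h0 := jacobiCoeff_ne_zero (α := α) (β := β) (le_refl k)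
      have e2 : (1 - X : ℝ[X]) ^ k = (jacobiCoeff α β k k)⁻¹ • (jacobiP α β k
          - ∑ j ∈ Finset.range k, jacobiCoeff α β k j • (1 - X : ℝ[X]) ^ j) := by
        rw [e, add_sub_cancel_left, smul_smul, inv_mul_cancel₀ h0, one_smul]
      rw [e2]
      refine Submodule.smul_mem _ _ (Submodule.sub_mem _ (Submodule.subset_span ⟨k, rfl⟩) ?_)
      exact Submodule.sum_mem _ fun j hj => Submodule.smul_mem _ _ (ih j (by simpa using hj))
  rw [eq_top_iff]
  rintro Q -
  have : Q = (Q.comp (1 - X)).comp (1 - X) := by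
    rw [comp_assoc]; simp
  rw [this]
  generalize Q.comp (1 - X) = T
  induction T using Polynomial.induction_on' with
  | add p q hp hq => rw [add_comp]; exact Submodule.add_mem _ hp hq
  | monomial n a =>
    rw [monomial_comp, ← smul_eq_C_mul]
    exact Submodule.smul_mem _ _ (key n)

end Jacobi

/-! ### The Jacobi Hilbert basis of `L²((-1, 1))`. -/

section JacobiBasis

open Polynomial

/-- Lebesgue measure on `(-1, 1)`. -/
abbrev volIoo : Measure ℝ := volume.restrict (Ioo (-1) 1)

/-- `L²((-1, 1); ℝ)`. -/
abbrev IooL2 : Type := Lp ℝ 2 volIoo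

/-- The square root of the Jacobi weight. -/
def jacobiSqrt (α β : ℕ) (x : ℝ) : ℝ := √((jacobiWeight α β).eval x)

lemma eval_jacobiWeight (α β : ℕ) (x : ℝ) :
    (jacobiWeight α β).eval x = (1 - x) ^ α * (1 + x) ^ β := by
  simp [jacobiWeight]

lemma jacobiWeight_pos {α β : ℕ} {x : ℝ} (hx : x ∈ Ioo (-1 : ℝ) 1) :
    0 < (jacobiWeight α β).eval x := by
  rw [eval_jacobiWeight]
  exact mul_pos (pow_pos (by linarith [hx.2]) _) (pow_pos (by linarith [hx.1]) _)

lemma jacobiSqrt_pos {α β : ℕ} {x : ℝ} (hx : x ∈ Ioo (-1 : ℝ) 1) : 0 < jacobiSqrt α β x :=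
  Real.sqrt_pos.2 (jacobiWeight_pos hx)

lemma jacobiSqrt_mul_self {α β : ℕ} {x : ℝ} (hx : x ∈ Ioo (-1 : ℝ) 1) :
    jacobiSqrt α β x * jacobiSqrt α β x = (jacobiWeight α β).eval x :=
  Real.mul_self_sqrt (jacobiWeight_pos hx).le

@[fun_prop]
lemma continuous_jacobiSqrt (α β : ℕ) : Continuous (jacobiSqrt α β) :=
  (jacobiWeight α β).continuous.sqrt

lemma Continuous.memLp_volIoo {f : ℝ → ℝ} (hf : Continuous f) : MemLp f 2 volIoo := by
  obtain ⟨C, hC⟩ := isCompact_Icc.exists_bound_of_continuousOn (hf.continuousOn (s := Icc (-1) 1))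
  refine memLp_of_bounded (a := -C) (b := C) ?_ hf.aestronglyMeasurable 2
  filter_upwards [ae_restrict_mem measurableSet_Ioo] with x hx
  exact abs_le.1 (hC x (Ioo_subset_Icc_self hx))

/-- The function `√ρ Q` in `L²((-1, 1))`, for a polynomial `Q`. -/
def jacobiJ (α β : ℕ) : ℝ[X] →ₗ[ℝ] IooL2 where
  toFun Q := ((continuous_jacobiSqrt α β).mul Q.continuous).memLp_volIoo.toLp
    (fun x => jacobiSqrt α β x * Q.eval x)
  map_add' Q Q' := by
    rw [← MemLp.toLp_add]
    congr 1
    ext x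
    simp [mul_add]
  map_smul' c Q := by
    rw [RingHom.id_apply, ← MemLp.toLp_const_smul]
    congr 1
    ext x
    simp only [eval_smul, Pi.smul_apply, smul_eq_mul]
    ring

lemma coeFn_jacobiJ (α β : ℕ) (Q : ℝ[X]) :
    jacobiJ α β Q =ᵐ[volIoo] fun x => jacobiSqrt α β x * Q.eval x :=
  MemLp.coeFn_toLp ((continuous_jacobiSqrt α β).mul Q.continuous).memLp_volIoo

lemma inner_jacobiJ (α β : ℕ) (Q : ℝ[X]) (f : IooL2) :
    inner ℝ (jacobiJ α β Q) f = ∫ x in Ioo (-1) 1, jacobiSqrt α β x * Q.eval x * f x := by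
  rw [L2.inner_def]
  refine integral_congr_ae ?_
  filter_upwards [coeFn_jacobiJ α β Q] with x hx
  rw [hx]
  simp [mul_comm]

lemma inner_jacobiJ_jacobiJ (α β : ℕ) (Q Q' : ℝ[X]) :
    inner ℝ (jacobiJ α β Q) (jacobiJ α β Q')
      = ∫ x in (-1 : ℝ)..1, (jacobiWeight α β * Q * Q').eval x := by
  rw [inner_jacobiJ, intervalIntegral.integral_of_le (by norm_num), integral_Ioc_eq_integral_Ioo]
  refine integral_congr_ae ?_
  filter_upwards [coeFn_jacobiJ α β Q', ae_restrict_mem measurableSet_Ioo] with x hx hx'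
  rw [hx, eval_mul, eval_mul, ← jacobiSqrt_mul_self hx']
  ring

/-- The Jacobi operator is symmetric. -/
lemma IsJacobiPair.inner_comm {α β : ℕ} {Q G Q' G' : ℝ[X]} (h : IsJacobiPair α β Q G)
    (h' : IsJacobiPair α β Q' G') :
    inner ℝ (jacobiJ α β G) (jacobiJ α β Q') = inner ℝ (jacobiJ α β Q) (jacobiJ α β G') := by
  rw [inner_jacobiJ_jacobiJ, inner_jacobiJ_jacobiJ, ← sub_eq_zero,
    ← intervalIntegral.integral_sub ((Polynomial.continuous _).intervalIntegrable _ _)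
      ((Polynomial.continuous _).intervalIntegrable _ _)]
  -- The weighted Wronskian: its derivative is the difference of the integrands, and the factor `1 -
  -- X²` kills it at both endpoints.
  set T : ℝ[X] := Q * ((1 - X ^ 2) * jacobiWeight α β * derivative Q')
    - (1 - X ^ 2) * jacobiWeight α β * derivative Q * Q' with hT
  have hd : derivative T = jacobiWeight α β * G * Q' - jacobiWeight α β * Q * G' := by
    rw [hT, derivative_sub, derivative_mul, derivative_mul (g := Q'), h, h']
    ring
  have := intervalIntegral.integral_eq_sub_of_hasDerivAt (a := -1) (b := 1)
    (fun x _ => T.hasDerivAt x) ((derivative T).continuous.intervalIntegrable _ _)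
  rw [hd] at this
  simp only [eval_sub] at this
  rw [this, hT]
  simp

lemma jacobiJ_injective (α β : ℕ) : Function.Injective (jacobiJ α β) := by
  rw [← LinearMap.ker_eq_bot, LinearMap.ker_eq_bot']
  intro Q hQ
  have h0 : (fun x => jacobiSqrt α β x * Q.eval x) =ᵐ[volIoo] fun _ => (0 : ℝ) := by
    have h1 := coeFn_jacobiJ α β Q
    rw [hQ] at h1
    exact h1.symm.trans (Lp.coeFn_zero _ _ _)
  have h1 : EqOn (fun x => jacobiSqrt α β x * Q.eval x) (fun _ => (0 : ℝ)) (Ioo (-1) 1) :=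
    Measure.eqOn_open_of_ae_eq h0 isOpen_Ioo
      ((continuous_jacobiSqrt α β).mul Q.continuous).continuousOn continuousOn_const
  refine Q.eq_zero_of_infinite_isRoot ((Ioo_infinite (by norm_num : (-1 : ℝ) < 1)).mono ?_)
  intro x hx
  exact (mul_eq_zero.1 (h1 hx)).resolve_left (jacobiSqrt_pos hx).ne'

lemma jacobiJ_jacobiP_ne_zero (α β k : ℕ) : jacobiJ α β (jacobiP α β k) ≠ 0 := by
  intro h
  have h1 : jacobiP α β k = 0 := jacobiJ_injective α β (h.trans (map_zero _).symm)
  have h2 := eval_one_jacobiP α β k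
  rw [h1] at h2
  simp at h2

lemma inner_jacobiP_of_ne (α β : ℕ) {j k : ℕ} (h : j ≠ k) :
    inner ℝ (jacobiJ α β (jacobiP α β j)) (jacobiJ α β (jacobiP α β k)) = 0 := by
  have h1 := (isJacobiPair_jacobiP α β j).inner_comm (isJacobiPair_jacobiP α β k)
  rw [← smul_eq_C_mul, ← smul_eq_C_mul, map_smul, map_smul, inner_smul_left, inner_smul_right] at h1
  have h2 := one_le_abs_sub_of_gap (jacobiEigenvalue_gap α β) h
  have h3 : jacobiEigenvalue α β j - jacobiEigenvalue α β k ≠ 0 :=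
    fun h => by rw [h, abs_zero] at h2; linarith
  simp only [conj_trivial] at h1
  have h4 : (jacobiEigenvalue α β j - jacobiEigenvalue α β k)
      * inner ℝ (jacobiJ α β (jacobiP α β j)) (jacobiJ α β (jacobiP α β k)) = 0 := by
    rw [sub_mul, h1, sub_self]
  exact (mul_eq_zero.1 h4).resolve_left h3

/-- The functions `√ρ Q`, for polynomials `Q`, are dense in `L²((-1, 1))`. -/
lemma eq_zero_of_inner_jacobiJ (α β : ℕ) {f : IooL2}
    (h : ∀ Q, inner ℝ (jacobiJ α β Q) f = 0) : f = 0 := by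
  set F : ℝ → ℝ := (Ioo (-1) 1).indicator fun x => jacobiSqrt α β x * f x with hF
  have hFi' : IntegrableOn (fun x => jacobiSqrt α β x * f x) (Ioo (-1) 1) :=
    (continuous_jacobiSqrt α β).memLp_volIoo.integrable_mul (Lp.memLp f)
  have hFi : Integrable F := hFi'.integrable_indicator measurableSet_Ioo
  have hFQ (Q : ℝ[X]) : ∫ x, Q.eval x * F x = 0 := by
    rw [← h Q, inner_jacobiJ, ← integral_indicator measurableSet_Ioo]
    refine integral_congr_ae (Eventually.of_forall fun x => ?_)
    by_cases hx : x ∈ Ioo (-1 : ℝ) 1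
    · simp only [hF, indicator_of_mem hx]; ring
    · simp only [hF, indicator_of_notMem hx, mul_zero]
  have hF0 : ∀ᵐ x, F x = 0 := by
    refine ae_eq_zero_of_integral_contDiff_smul_eq_zero hFi.locallyIntegrable fun g hg hgc => ?_
    have hgF : Integrable fun x => g x * F x := by
      obtain ⟨C, hC⟩ := hgc.exists_bound_of_continuous hg.continuous
      exact hFi.bdd_mul hg.continuous.aestronglyMeasurable (Eventually.of_forall hC)
    -- Weierstrass approximation on `[-1, 1]` suffices because `F` vanishes outside.
    have hbd : ∀ ε > 0, |∫ x, g x * F x| ≤ ε * ∫ x, |F x| := by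
      intro ε hε
      obtain ⟨Q, hQ⟩ := exists_polynomial_near_of_continuousOn (-1) 1 g hg.continuous.continuousOn
        ε hε
      have hb (x : ℝ) : |(g x - Q.eval x) * F x| ≤ ε * |F x| := by
        by_cases hx : x ∈ Ioo (-1 : ℝ) 1
        · rw [abs_mul, abs_sub_comm]
          exact mul_le_mul_of_nonneg_right (hQ x (Ioo_subset_Icc_self hx)).le (abs_nonneg _)
        · simp [hF, indicator_of_notMem hx]
      have hQF : Integrable fun x => Q.eval x * F x := by
        have hd : Integrable fun x => (g x - Q.eval x) * F x :=
          (hFi.abs.const_mul ε).mono' ((hg.continuous.sub Q.continuous).aestronglyMeasurable.mul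
            hFi.1) (Eventually.of_forall hb)
        have := hgF.sub hd
        refine this.congr (Eventually.of_forall fun x => ?_)
        simp only [Pi.sub_apply]
        ring
      have e : ∫ x, g x * F x = ∫ x, (g x - Q.eval x) * F x := by
        simp only [sub_mul]
        rw [integral_sub hgF hQF, hFQ, sub_zero]
      rw [e, ← integral_const_mul]
      exact norm_integral_le_of_norm_le (f := fun x => (g x - Q.eval x) * F x)
        (hFi.abs.const_mul ε) (Eventually.of_forall hb)
    have : |∫ x, g x * F x| ≤ 0 := by
      refine le_of_forall_pos_le_add fun ε hε => ?_
      have hI : 0 ≤ ∫ x, |F x| := integral_nonneg fun x => abs_nonneg _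
      refine (hbd (ε / ((∫ x, |F x|) + 1)) (by positivity)).trans ?_
      rw [zero_add, div_mul_eq_mul_div, div_le_iff₀ (by positivity)]
      nlinarith
    simpa using this
  rw [Lp.eq_zero_iff_ae_eq_zero]
  filter_upwards [ae_restrict_of_ae hF0, ae_restrict_mem measurableSet_Ioo] with x h1 h2
  rw [hF, indicator_of_mem h2] at h1
  exact (mul_eq_zero.1 h1).resolve_left (jacobiSqrt_pos h2).ne'

lemma orthonormal_jacobi (α β : ℕ) : Orthonormal ℝ fun k : ℕ =>
    ‖jacobiJ α β (jacobiP α β k)‖⁻¹ • jacobiJ α β (jacobiP α β k) := by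
  refine ⟨fun k => norm_smul_inv_norm (jacobiJ_jacobiP_ne_zero α β k), fun j k h => ?_⟩
  dsimp only
  rw [inner_smul_left, inner_smul_right, inner_jacobiP_of_ne α β h, mul_zero, mul_zero]

lemma orthogonal_span_jacobi (α β : ℕ) : (Submodule.span ℝ (range fun k : ℕ =>
    ‖jacobiJ α β (jacobiP α β k)‖⁻¹ • jacobiJ α β (jacobiP α β k)))ᗮ = ⊥ := by
  rw [Submodule.eq_bot_iff]
  intro f hf
  rw [Submodule.mem_orthogonal] at hf
  refine eq_zero_of_inner_jacobiJ α β fun Q => ?_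
  have h1 (k : ℕ) : inner ℝ (jacobiJ α β (jacobiP α β k)) f = 0 := by
    have := hf _ (Submodule.subset_span ⟨k, rfl⟩)
    rw [inner_smul_left] at this
    refine (mul_eq_zero.1 this).resolve_left ?_
    simpa using jacobiJ_jacobiP_ne_zero α β k
  have hQ : Q ∈ Submodule.span ℝ (range (jacobiP α β)) := by
    rw [span_jacobiP]; trivial
  induction hQ using Submodule.span_induction with
  | mem _ h => obtain ⟨k, rfl⟩ := h; exact h1 k
  | zero => simp
  | add x y _ _ hx hy => rw [map_add, inner_add_left, hx, hy, add_zero]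
  | smul c x _ hx => rw [map_smul, inner_smul_left, hx, mul_zero]

/-- The orthonormal basis of `L²((-1, 1))` given by the normalised Jacobi functions. -/
def jacobiBasis (α β : ℕ) : HilbertBasis ℕ ℝ IooL2 :=
  HilbertBasis.mkOfOrthogonalEqBot (orthonormal_jacobi α β) (orthogonal_span_jacobi α β)

lemma jacobiBasis_apply (α β k : ℕ) : jacobiBasis α β k
    = ‖jacobiJ α β (jacobiP α β k)‖⁻¹ • jacobiJ α β (jacobiP α β k) := by
  rw [jacobiBasis, HilbertBasis.coe_mkOfOrthogonalEqBot]

end JacobiBasis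

/-! ### Bounded solutions of the Jacobi system near the endpoints. -/

section JacobiSystem

open Polynomial

/-- The first order system `(1 - x²) ρ u' = v`, `v' = -√ρ g`. -/
def IsJacobiSystem (α β : ℕ) (u v g : ℝ → ℝ) : Prop :=
  ∀ x ∈ Ioo (-1 : ℝ) 1,
    HasDerivAt u (v x / ((1 - x ^ 2) * (jacobiWeight α β).eval x)) x ∧
      HasDerivAt v (-(jacobiSqrt α β x * g x)) x

lemma eval_neg_jacobiWeight (α β : ℕ) (x : ℝ) :
    (jacobiWeight α β).eval (-x) = (jacobiWeight β α).eval x := by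
  rw [eval_jacobiWeight, eval_jacobiWeight]; ring

lemma jacobiSqrt_neg (α β : ℕ) (x : ℝ) : jacobiSqrt α β (-x) = jacobiSqrt β α x := by
  rw [jacobiSqrt, eval_neg_jacobiWeight, jacobiSqrt]

lemma neg_mem_Ioo {x : ℝ} (hx : x ∈ Ioo (-1 : ℝ) 1) : -x ∈ Ioo (-1 : ℝ) 1 :=
  ⟨by linarith [hx.2], by linarith [hx.1]⟩

lemma IsJacobiSystem.reflect {α β : ℕ} {u v g : ℝ → ℝ} (h : IsJacobiSystem α β u v g) :
    IsJacobiSystem β α (fun x => u (-x)) (fun x => -v (-x)) (fun x => g (-x)) := by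
  intro x hx
  obtain ⟨h1, h2⟩ := h (-x) (neg_mem_Ioo hx)
  have hn : HasDerivAt (fun x : ℝ => -x) (-1) x := hasDerivAt_neg x
  refine ⟨(h1.comp x hn).congr_deriv ?_, ((h2.comp x hn).neg).congr_deriv ?_⟩
  · rw [eval_neg_jacobiWeight]; ring
  · rw [jacobiSqrt_neg]; ring

lemma IsJacobiSystem.neg {α β : ℕ} {u v g : ℝ → ℝ} (h : IsJacobiSystem α β u v g) :
    IsJacobiSystem α β (fun x => -u x) (fun x => -v x) (fun x => -g x) := by
  intro x hx
  obtain ⟨h1, h2⟩ := h x hx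
  exact ⟨h1.neg.congr_deriv (by ring), h2.neg.congr_deriv (by ring)⟩

/-- Near `1` only the factor `(1 - x)^α` of the weight degenerates and it decreases; the other is at
most `2^β`. -/
lemma jacobiSqrt_le {α β : ℕ} {x t : ℝ} (hxt : x ≤ t) (hx : x ∈ Ioo (-1 : ℝ) 1) (ht : t < 1) :
    jacobiSqrt α β t ≤ √(2 ^ β * (1 - x) ^ α) := by
  refine Real.sqrt_le_sqrt ?_
  rw [eval_jacobiWeight, mul_comm]
  have h1 : 0 ≤ 1 + t := by linarith [hx.1]
  have h2 : 0 ≤ 1 - t := by linarith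
  gcongr
  linarith

lemma one_sub_sq_mul_jacobiWeight_ge {α β : ℕ} {t : ℝ} (h0 : 0 ≤ t) (h1 : t < 1) :
    (1 - t) ^ (α + 1) ≤ (1 - t ^ 2) * (jacobiWeight α β).eval t := by
  rw [eval_jacobiWeight]
  have e : (1 - t ^ 2) * ((1 - t) ^ α * (1 + t) ^ β) = (1 - t) ^ (α + 1) * (1 + t) ^ (β + 1) := by
    ring
  rw [e]
  exact le_mul_of_one_le_right (pow_nonneg (by linarith) _) (one_le_pow₀ (by linarith))

/-- The flux `v` is controlled by the source near the endpoint where it vanishes. -/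
lemma IsJacobiSystem.abs_flux_le {α β : ℕ} {u v g : ℝ → ℝ} (h : IsJacobiSystem α β u v g)
    (hv : Tendsto v (𝓝[<] 1) (𝓝 0)) {x N : ℝ} (hx : x ∈ Ioo (-1 : ℝ) 1)
    (hN : ∀ t ∈ Ioo x 1, |g t| ≤ N) : |v x| ≤ √(2 ^ β * (1 - x) ^ α) * N * (1 - x) := by
  have key : ∀ y ∈ Ioo x 1, |v y - v x| ≤ √(2 ^ β * (1 - x) ^ α) * N * (1 - x) := by
    intro y hy
    have hsub : ∀ t ∈ Icc x y, t ∈ Ioo (-1 : ℝ) 1 := fun t ht =>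
      ⟨hx.1.trans_le ht.1, ht.2.trans_lt hy.2⟩
    obtain ⟨t, ht, hte⟩ := exists_hasDerivAt_eq_slope v _ hy.1
      (fun t ht => (h t (hsub t ht)).2.continuousAt.continuousWithinAt)
      (fun t ht => (h t (hsub t ⟨ht.1.le, ht.2.le⟩)).2)
    have hyx : 0 < y - x := sub_pos.2 hy.1
    have e : v y - v x = -(jacobiSqrt α β t * g t) * (y - x) := by
      rw [hte, div_mul_cancel₀ _ hyx.ne']
    have ht1 : t ∈ Ioo (-1 : ℝ) 1 := hsub t ⟨ht.1.le, ht.2.le⟩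
    rw [e, abs_mul, abs_neg, abs_mul, abs_of_pos (jacobiSqrt_pos ht1), abs_of_pos hyx]
    have h1 := jacobiSqrt_le (α := α) (β := β) ht.1.le hx ht1.2
    have h2 := hN t ⟨ht.1, ht1.2⟩
    have h3 : 0 ≤ N := (abs_nonneg _).trans h2
    have h4 : y - x ≤ 1 - x := by linarith [hy.2]
    have h5 := (jacobiSqrt_pos (α := α) (β := β) ht1).le
    gcongr
  have hlim : Tendsto (fun y => |v y - v x|) (𝓝[<] 1) (𝓝 |0 - v x|) :=
    (hv.sub_const _).abs
  rw [zero_sub, abs_neg] at hlim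
  refine le_of_tendsto hlim ?_
  filter_upwards [Ioo_mem_nhdsLT hx.2] with y hy using key y hy

/-- The oscillation of a regular solution near the endpoint `1`. -/
lemma IsJacobiSystem.osc_le {α β : ℕ} {u v g : ℝ → ℝ} (h : IsJacobiSystem α β u v g)
    (hv : Tendsto v (𝓝[<] 1) (𝓝 0)) {y x N : ℝ} (hy : 0 ≤ y) (hyx : y < x) (hx : x < 1)
    (hN : ∀ t ∈ Ioo y 1, |g t| ≤ N) :
    jacobiSqrt α β x * |u x - u y| ≤ 2 ^ β * N * (x - y) := by
  have hsub : ∀ t ∈ Icc y x, t ∈ Ioo (-1 : ℝ) 1 := fun t ht =>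
    ⟨by linarith [ht.1], ht.2.trans_lt hx⟩
  obtain ⟨t, ht, hte⟩ := exists_hasDerivAt_eq_slope u _ hyx
    (fun t ht => (h t (hsub t ht)).1.continuousAt.continuousWithinAt)
    (fun t ht => (h t (hsub t ⟨ht.1.le, ht.2.le⟩)).1)
  have hxy : 0 < x - y := sub_pos.2 hyx
  have ht1 : t ∈ Ioo (-1 : ℝ) 1 := hsub t ⟨ht.1.le, ht.2.le⟩
  have ht0 : 0 ≤ t := hy.trans ht.1.le
  have e : u x - u y = v t / ((1 - t ^ 2) * (jacobiWeight α β).eval t) * (x - y) := by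
    rw [hte, div_mul_cancel₀ _ hxy.ne']
  have hvt := h.abs_flux_le hv ht1 (fun s hs => hN s ⟨ht.1.trans hs.1, hs.2⟩)
  have hN0 : 0 ≤ N := (abs_nonneg _).trans (hN t ⟨ht.1, ht1.2⟩)
  have hw := one_sub_sq_mul_jacobiWeight_ge (α := α) (β := β) ht0 ht1.2
  have h1t : 0 < 1 - t := by linarith [ht1.2]
  have hwx : jacobiSqrt α β x ≤ √(2 ^ β * (1 - t) ^ α) := by
    exact jacobiSqrt_le ht.2.le ht1 hx
  have hp : 0 < (1 - t) ^ (α + 1) := pow_pos h1t _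
  rw [e, abs_mul, abs_div, abs_of_pos (hp.trans_le hw), abs_of_pos hxy, ← mul_assoc]
  refine mul_le_mul_of_nonneg_right ?_ hxy.le
  rw [← mul_div_assoc, div_le_iff₀ (hp.trans_le hw)]
  have hs : √(2 ^ β * (1 - t) ^ α) * √(2 ^ β * (1 - t) ^ α) = 2 ^ β * (1 - t) ^ α :=
    Real.mul_self_sqrt (by positivity)
  -- The outer weight and the flux bound each contribute `√(2^β (1 - t)^α)`; together with `1 - t`
  -- they cancel the degenerate denominator.
  calc jacobiSqrt α β x * |v t|
      ≤ √(2 ^ β * (1 - t) ^ α) * (√(2 ^ β * (1 - t) ^ α) * N * (1 - t)) := by gcongr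
    _ = 2 ^ β * N * (1 - t) ^ (α + 1) := by
        rw [← mul_assoc, ← mul_assoc, hs]; ring
    _ ≤ _ := by gcongr

/-- A regular solution with a zero close to `1` vanishes beyond it. -/
lemma IsJacobiSystem.eq_zero_of_zero {α β : ℕ} {u v r : ℝ → ℝ}
    (h : IsJacobiSystem α β u v fun x => r x * (jacobiSqrt α β x * u x))
    (hv : Tendsto v (𝓝[<] 1) (𝓝 0)) {C R : ℝ}
    (hC : ∀ x ∈ Ioo (-1 : ℝ) 1, |jacobiSqrt α β x * u x| ≤ C)
    (hR : ∀ x ∈ Ioo (-1 : ℝ) 1, |r x| ≤ R) {y : ℝ} (hy : 0 ≤ y)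
    (hyR : 2 ^ β * R * (1 - y) ≤ 1 / 2) (huy : u y = 0) : ∀ x ∈ Ioo y 1, u x = 0 := by
  have hsub : ∀ t ∈ Ioo y 1, t ∈ Ioo (-1 : ℝ) 1 := fun t ht => ⟨by linarith [ht.1], ht.2⟩
  have hR0 : 0 ≤ R := (abs_nonneg _).trans (hR 0 (by norm_num))
  -- A bound on `√ρ u` over `(y, 1)` bounds the source, and the oscillation estimate from the zero
  -- at `y` returns half of it, by the choice of `y`.
  have key (n : ℕ) : ∀ x ∈ Ioo y 1, |jacobiSqrt α β x * u x| ≤ (1 / 2) ^ n * C := by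
    induction n with
    | zero => intro x hx; simpa using hC x (hsub x hx)
    | succ n ih =>
      intro x hx
      have hC0 : 0 ≤ (1 / 2) ^ n * C := (abs_nonneg _).trans (ih x hx)
      have h1 := h.osc_le hv hy hx.1 hx.2 (N := R * ((1 / 2) ^ n * C)) (fun t ht => by
        rw [abs_mul]
        exact mul_le_mul (hR t (hsub t ht)) (ih t ht) (abs_nonneg _) hR0)
      rw [huy, sub_zero] at h1
      rw [abs_mul, abs_of_pos (jacobiSqrt_pos (hsub x hx))]
      refine h1.trans ?_
      calc 2 ^ β * (R * ((1 / 2) ^ n * C)) * (x - y)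
          ≤ 2 ^ β * (R * ((1 / 2) ^ n * C)) * (1 - y) := by
            gcongr
            exact hx.2.le
        _ = (2 ^ β * R * (1 - y)) * ((1 / 2) ^ n * C) := by ring
        _ ≤ 1 / 2 * ((1 / 2) ^ n * C) := by gcongr
        _ = _ := by ring
  intro x hx
  have hlim : Tendsto (fun n : ℕ => (1 / 2 : ℝ) ^ n * C) atTop (𝓝 0) := by
    have := (tendsto_pow_atTop_nhds_zero_of_lt_one (r := (1 / 2 : ℝ)) (by norm_num)
      (by norm_num)).mul_const C
    simpa using this
  have h0 : |jacobiSqrt α β x * u x| ≤ 0 := ge_of_tendsto' hlim fun n => key n x hx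
  exact (mul_eq_zero.1 (abs_nonpos_iff.1 h0)).resolve_left (jacobiSqrt_pos (hsub x hx)).ne'

/-- The flux of a bounded solution cannot have a positive limit at `1`. -/
lemma IsJacobiSystem.flux_limit_nonpos {α β : ℕ} {u v g : ℝ → ℝ} (h : IsJacobiSystem α β u v g)
    {ℓ C : ℝ} (hv : Tendsto v (𝓝[<] 1) (𝓝 ℓ))
    (hC : ∀ x ∈ Ioo (-1 : ℝ) 1, |jacobiSqrt α β x * u x| ≤ C) : ℓ ≤ 0 := by
  by_contra! hℓ
  have hev : ∀ᶠ x in 𝓝[<] (1 : ℝ), ℓ / 2 < v x := hv.eventually_const_lt (by linarith)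
  obtain ⟨a, ha, haev⟩ := (mem_nhdsLT_iff_exists_Ioo_subset).1
    (hev.and (Ioo_mem_nhdsLT (show (0 : ℝ) < 1 by norm_num)))
  replace ha : a < 1 := ha
  have hC0 : 0 ≤ C := (abs_nonneg _).trans (hC 0 (by norm_num))
  set c : ℝ := ℓ / 2 / 2 ^ (β + 1) with hc
  have hcpos : 0 < c := by positivity
  -- Where `v > ℓ/2`, the derivative of `u` is bounded below by the singular function `c (1 -
  -- x)^(-α-1)`, too large for `√ρ u` to stay bounded.
  have hder : ∀ x ∈ Ioo a 1, c / (1 - x) ^ (α + 1)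
      ≤ v x / ((1 - x ^ 2) * (jacobiWeight α β).eval x) := by
    intro x hx
    obtain ⟨h1, h2⟩ : ℓ / 2 < v x ∧ x ∈ Ioo 0 1 := haev hx
    have hx0 : 0 < x := h2.1
    have hx1 : 0 < 1 - x := by linarith [hx.2]
    have e : (1 - x ^ 2) * (jacobiWeight α β).eval x
        = (1 - x) ^ (α + 1) * (1 + x) ^ (β + 1) := by
      rw [eval_jacobiWeight]; ring
    have h3 : (1 + x) ^ (β + 1) ≤ 2 ^ (β + 1) := by gcongr; linarith [hx.2]
    rw [e, hc, div_div, mul_comm]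
    exact div_le_div₀ (by linarith) h1.le (by positivity)
      (by gcongr)
  have hwu : ∀ x ∈ Ioo a 1, √((1 - x) ^ α) * |u x| ≤ C := by
    intro x hx
    obtain ⟨-, h2⟩ := haev hx
    have hx0 : 0 < x := h2.1
    have hx1 : 0 < 1 - x := by linarith [hx.2]
    have hxI : x ∈ Ioo (-1 : ℝ) 1 := ⟨by linarith, hx.2⟩
    have := hC x hxI
    rw [abs_mul, abs_of_pos (jacobiSqrt_pos hxI)] at this
    refine (mul_le_mul_of_nonneg_right (Real.sqrt_le_sqrt ?_) (abs_nonneg _)).trans this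
    rw [eval_jacobiWeight]
    exact le_mul_of_one_le_right (by positivity) (one_le_pow₀ (by linarith))
  have hmem : ∀ x ∈ Ioo a 1, x ∈ Ioo (-1 : ℝ) 1 := fun x hx =>
    ⟨by linarith [(haev hx).2.1], hx.2⟩
  rcases Nat.eq_zero_or_pos α with rfl | hα
  -- For `α = 0` the growth is only logarithmic, but the factor `(1 - x)^α` no longer damps it, so
  -- `u` itself must be bounded.
  · have hmono : MonotoneOn (fun x => u x + c * Real.log (1 - x)) (Ioo a 1) := by
      have hd : ∀ x ∈ Ioo a 1, HasDerivAt (fun x => u x + c * Real.log (1 - x))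
          (v x / ((1 - x ^ 2) * (jacobiWeight 0 β).eval x) + c * (-1 / (1 - x))) x := by
        intro x hx
        have hx1 : (1 - x) ≠ 0 := by linarith [hx.2]
        exact (h x (hmem x hx)).1.add ((((hasDerivAt_id x).const_sub 1).log hx1).const_mul c)
      refine monotoneOn_of_hasDerivWithinAt_nonneg (convex_Ioo a 1)
        (fun x hx => (hd x hx).continuousAt.continuousWithinAt)
        (fun x hx => (hd x (interior_subset hx)).hasDerivWithinAt) fun x hx => ?_
      have := hder x (interior_subset hx)
      rw [zero_add, pow_one] at this
      have e : c * (-1 / (1 - x)) = -(c / (1 - x)) := by ring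
      rw [e]
      linarith
    obtain ⟨b, hab, hb1⟩ := exists_between ha
    have hlog : Tendsto (fun x : ℝ => c * Real.log (1 - x)) (𝓝[<] 1) atBot := by
      refine Tendsto.const_mul_atBot hcpos (Real.tendsto_log_nhdsGT_zero.comp ?_)
      refine tendsto_nhdsWithin_of_tendsto_nhds_of_eventually_within _ ?_ ?_
      · have : Tendsto (fun x : ℝ => 1 - x) (𝓝 1) (𝓝 (1 - 1)) := by
          exact (continuous_const.sub continuous_id).tendsto 1
        rw [sub_self] at this
        exact this.mono_left nhdsWithin_le_nhds
      · filter_upwards [self_mem_nhdsWithin] with x hx using sub_pos.2 (mem_Iio.1 hx)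
    have hlt := hlog.eventually_lt_atBot (u b + c * Real.log (1 - b) - C)
    obtain ⟨x, hx, hx2⟩ := (hlt.and (Ioo_mem_nhdsLT hb1)).exists
    have h1 := hmono ⟨hab, hb1⟩ ⟨hab.trans hx2.1, hx2.2⟩ hx2.1.le
    have h2 := hwu x ⟨hab.trans hx2.1, hx2.2⟩
    rw [pow_zero, Real.sqrt_one, one_mul] at h2
    have h3 := le_abs_self (u x)
    dsimp only at h1
    linarith
  -- For `α > 0`, between `x` and the midpoint of `x` and `1` the function `u` gains at least
  -- `(c/2)(1 - x)^(-α)`, whereas `|u|` is of order at most `(1 - x)^(-α/2)`.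
  · have key : ∀ x ∈ Ioo a 1, c / 2 ≤ C * (1 + √(2 ^ α)) * √((1 - x) ^ α) := by
      intro x hx
      have hx1 : 0 < 1 - x := by linarith [hx.2]
      set y := (1 + x) / 2 with hy
      have hxy : x < y := by linarith
      have hyI : y ∈ Ioo a 1 := ⟨hx.1.trans hxy, by linarith [hx.2]⟩
      have hsub : ∀ t ∈ Icc x y, t ∈ Ioo a 1 := fun t ht =>
        ⟨hx.1.trans_le ht.1, ht.2.trans_lt hyI.2⟩
      obtain ⟨t, ht, hte⟩ := exists_hasDerivAt_eq_slope u _ hxy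
        (fun t ht => (h t (hmem t (hsub t ht))).1.continuousAt.continuousWithinAt)
        (fun t ht => (h t (hmem t (hsub t ⟨ht.1.le, ht.2.le⟩))).1)
      have htI := hsub t ⟨ht.1.le, ht.2.le⟩
      have ht1 : 0 < 1 - t := by linarith [htI.2]
      have h1 := hder t htI
      rw [hte] at h1
      have h2 : c / (1 - x) ^ (α + 1) ≤ c / (1 - t) ^ (α + 1) := by
        gcongr
        exact ht.1.le
      have h3 : c / (1 - x) ^ (α + 1) * ((1 - x) / 2) ≤ u y - u x := by
        have h4 := h2.trans h1
        rw [le_div_iff₀ (sub_pos.2 hxy)] at h4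
        have e : y - x = (1 - x) / 2 := by rw [hy]; ring
        rwa [e] at h4
      have hs : √((1 - x) ^ α) * √((1 - x) ^ α) = (1 - x) ^ α := Real.mul_self_sqrt (by positivity)
      have hsy : √((1 - x) ^ α) = √(2 ^ α) * √((1 - y) ^ α) := by
        rw [← Real.sqrt_mul (by positivity), ← mul_pow]
        congr 2
        rw [hy]; ring
      have h5 : c / 2 = (1 - x) ^ α * (c / (1 - x) ^ (α + 1) * ((1 - x) / 2)) := by
        field_simp
        ring
      have h6 : u y - u x ≤ |u y| + |u x| := by
        linarith [le_abs_self (u y), neg_abs_le (u x)]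
      have h7 := hwu x hx
      have h8 := hwu y hyI
      calc c / 2 ≤ (1 - x) ^ α * (|u y| + |u x|) := by
            rw [h5]
            gcongr
            exact h3.trans h6
        _ = √((1 - x) ^ α) * (√(2 ^ α) * (√((1 - y) ^ α) * |u y|) + √((1 - x) ^ α) * |u x|) := by
            rw [← mul_assoc (√(2 ^ α)), ← hsy]
            linear_combination -(|u y| + |u x|) * hs
        _ ≤ √((1 - x) ^ α) * (√(2 ^ α) * C + C) := by gcongr
        _ = _ := by ring
    have hlim : Tendsto (fun x : ℝ => C * (1 + √(2 ^ α)) * √((1 - x) ^ α)) (𝓝[<] 1) (𝓝 0) := by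
      have hcont : Continuous fun x : ℝ => C * (1 + √(2 ^ α)) * √((1 - x) ^ α) := by fun_prop
      have := (hcont.tendsto 1).mono_left (nhdsWithin_le_nhds (s := Iio (1 : ℝ)))
      simpa [hα.ne'] using this
    have : c / 2 ≤ 0 := by
      refine ge_of_tendsto hlim ?_
      filter_upwards [Ioo_mem_nhdsLT ha] with x hx using key x hx
    linarith

/-- A bounded source makes the flux Lipschitz, so it extends continuously to the endpoint. -/
lemma IsJacobiSystem.exists_flux_limit {α β : ℕ} {u v g : ℝ → ℝ} (h : IsJacobiSystem α β u v g)
    {N : ℝ} (hN : ∀ x ∈ Ioo (-1 : ℝ) 1, |g x| ≤ N) : ∃ ℓ, Tendsto v (𝓝[<] 1) (𝓝 ℓ) := by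
  obtain ⟨M, hM⟩ := isCompact_Icc.exists_bound_of_continuousOn
    ((continuous_jacobiSqrt α β).continuousOn (s := Icc (-1) 1))
  have hM0 : 0 ≤ M := (norm_nonneg _).trans (hM 0 (by norm_num))
  have hN0 : 0 ≤ N := (abs_nonneg _).trans (hN 0 (by norm_num))
  have hL : LipschitzOnWith (M * N).toNNReal v (Ioo (-1) 1) := by
    refine (convex_Ioo (-1 : ℝ) 1).lipschitzOnWith_of_nnnorm_hasDerivWithin_le
      (fun x hx => (h x hx).2.hasDerivWithinAt) fun x hx => ?_
    rw [← NNReal.coe_le_coe, coe_nnnorm, Real.coe_toNNReal _ (by positivity), norm_neg, norm_mul]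
    exact mul_le_mul (hM x (Ioo_subset_Icc_self hx)) (hN x hx) (norm_nonneg _) hM0
  obtain ⟨V, hV, hvV⟩ := hL.extend_real
  refine ⟨V 1, (hV.continuous.tendsto 1).mono_left nhdsWithin_le_nhds |>.congr' ?_⟩
  filter_upwards [Ioo_mem_nhdsLT (show (-1 : ℝ) < 1 by norm_num)] with x hx using (hvV hx).symm

/-- Boundedness acts as the boundary condition: the one-sided statement applied to `u` and to `-u`
leaves only the limit `0`. -/
lemma IsJacobiSystem.flux_tendsto_zero {α β : ℕ} {u v g : ℝ → ℝ} (h : IsJacobiSystem α β u v g)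
    {N C : ℝ} (hN : ∀ x ∈ Ioo (-1 : ℝ) 1, |g x| ≤ N)
    (hC : ∀ x ∈ Ioo (-1 : ℝ) 1, |jacobiSqrt α β x * u x| ≤ C) : Tendsto v (𝓝[<] 1) (𝓝 0) := by
  obtain ⟨ℓ, hℓ⟩ := h.exists_flux_limit hN
  have h1 := h.flux_limit_nonpos hℓ hC
  have h2 := h.neg.flux_limit_nonpos hℓ.neg (C := C) (fun x hx => by
    rw [mul_neg, abs_neg]; exact hC x hx)
  have : ℓ = 0 := by linarith
  rwa [this] at hℓ

lemma IsJacobiSystem.flux_tendsto_zero' {α β : ℕ} {u v g : ℝ → ℝ} (h : IsJacobiSystem α β u v g)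
    {N C : ℝ} (hN : ∀ x ∈ Ioo (-1 : ℝ) 1, |g x| ≤ N)
    (hC : ∀ x ∈ Ioo (-1 : ℝ) 1, |jacobiSqrt α β x * u x| ≤ C) : Tendsto v (𝓝[>] (-1)) (𝓝 0) := by
  have h1 := h.reflect.flux_tendsto_zero (N := N) (C := C) (fun x hx => hN _ (neg_mem_Ioo hx))
    (fun x hx => by rw [← jacobiSqrt_neg]; exact hC _ (neg_mem_Ioo hx))
  have h2 : Tendsto (fun x : ℝ => -x) (𝓝[>] (-1)) (𝓝[<] 1) := by
    refine tendsto_nhdsWithin_of_tendsto_nhds_of_eventually_within _ ?_ ?_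
    · have := (continuous_neg.tendsto (-1 : ℝ)).mono_left
        (nhdsWithin_le_nhds (s := Ioi (-1 : ℝ)))
      simpa using this
    · filter_upwards [self_mem_nhdsWithin] with x hx
      simp only [mem_Ioi, mem_Iio] at hx ⊢
      linarith
  have h3 := (h1.comp h2).neg
  simpa [Function.comp_def] using h3

/-- Green's formula against the Jacobi polynomials. -/
lemma IsJacobiSystem.green {α β : ℕ} {u v g : ℝ → ℝ} (h : IsJacobiSystem α β u v g)
    {N C : ℝ} (hN : ∀ x ∈ Ioo (-1 : ℝ) 1, |g x| ≤ N)
    (hgm : AEStronglyMeasurable g volIoo)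
    (hC : ∀ x ∈ Ioo (-1 : ℝ) 1, |jacobiSqrt α β x * u x| ≤ C) (k : ℕ) :
    jacobiEigenvalue α β k
        * ∫ x in Ioo (-1 : ℝ) 1, jacobiSqrt α β x * (jacobiP α β k).eval x * (jacobiSqrt α β x * u x)
      = ∫ x in Ioo (-1 : ℝ) 1, jacobiSqrt α β x * (jacobiP α β k).eval x * g x := by
  set P := jacobiP α β k with hP
  set κ := jacobiEigenvalue α β k with hκ
  set w := jacobiSqrt α β with hw
  set T : ℝ[X] := (1 - X ^ 2) * jacobiWeight α β * derivative P with hT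
  have hTd : derivative T = -(jacobiWeight α β * (Polynomial.C κ * P)) :=
    isJacobiPair_jacobiP α β k
  have hum : AEStronglyMeasurable (fun x => w x * u x) volIoo := by
    refine ContinuousOn.aestronglyMeasurable (fun x hx => ?_) measurableSet_Ioo
    exact ((continuous_jacobiSqrt α β).continuousAt.mul
      (h x hx).1.continuousAt).continuousWithinAt
  have bdd (q : ℝ → ℝ) (B : ℝ) (hq : AEStronglyMeasurable q volIoo)
      (hB : ∀ x ∈ Ioo (-1 : ℝ) 1, |q x| ≤ B) : MemLp q 2 volIoo := by
    refine memLp_of_bounded (a := -B) (b := B) ?_ hq 2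
    filter_upwards [ae_restrict_mem measurableSet_Ioo] with x hx using abs_le.1 (hB x hx)
  have hPw : MemLp (fun x => w x * P.eval x) 2 volIoo :=
    ((continuous_jacobiSqrt α β).mul P.continuous).memLp_volIoo
  have i1 : Integrable (fun x => w x * P.eval x * (w x * u x)) volIoo :=
    hPw.integrable_mul (bdd _ C hum hC)
  have i2 : Integrable (fun x => w x * P.eval x * g x) volIoo :=
    hPw.integrable_mul (bdd _ N hgm hN)
  -- The terms `v P'` and `u' T` cancel, since `T` is the flux of `P`.
  have hder : ∀ x ∈ Ioo (-1 : ℝ) 1, HasDerivAt (fun x => v x * P.eval x - u x * T.eval x)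
      (κ * (w x * P.eval x * (w x * u x)) - w x * P.eval x * g x) x := by
    intro x hx
    obtain ⟨h1, h2⟩ := h x hx
    refine ((h2.mul (P.hasDerivAt x)).sub (h1.mul (T.hasDerivAt x))).congr_deriv ?_
    have hp : (1 - x ^ 2) ≠ 0 := by nlinarith [hx.1, hx.2]
    have hw0 : w x ≠ 0 := (jacobiSqrt_pos hx).ne'
    have hww : (jacobiWeight α β).eval x = w x * w x := (jacobiSqrt_mul_self hx).symm
    rw [hTd, hT]
    simp only [eval_neg, eval_mul, eval_C, eval_sub, eval_one, eval_pow, eval_X, hww]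
    field_simp
    ring
  have hTx : ∀ x ∈ Ioo (-1 : ℝ) 1, u x * T.eval x
      = (1 - x ^ 2) * (w x * (derivative P).eval x) * (w x * u x) := by
    intro x hx
    rw [hT]
    simp only [eval_mul, eval_sub, eval_one, eval_pow, eval_X]
    rw [← jacobiSqrt_mul_self hx]
    ring
  -- No boundary term survives at either endpoint: `v` tends to `0`, and `u T` is the bounded `√ρ u`
  -- times a function containing `1 - x²`.
  have lim (a : ℝ) (ha : 1 - a ^ 2 = 0) (F : Filter ℝ) (hF : F ≤ 𝓝 a)
      (hFI : ∀ᶠ x in F, x ∈ Ioo (-1 : ℝ) 1) (hv : Tendsto v F (𝓝 0)) :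
      Tendsto (fun x => v x * P.eval x - u x * T.eval x) F (𝓝 0) := by
    have t1 : Tendsto (fun x => v x * P.eval x) F (𝓝 0) := by
      simpa using hv.mul ((P.continuous.tendsto a).mono_left hF)
    have c2 : Continuous fun x => (1 - x ^ 2) * (w x * (derivative P).eval x) :=
      (by fun_prop : Continuous fun x : ℝ => 1 - x ^ 2).mul
        ((continuous_jacobiSqrt α β).mul (derivative P).continuous)
    have t2 : Tendsto (fun x => (1 - x ^ 2) * (w x * (derivative P).eval x)) F (𝓝 0) := by
      have := (c2.tendsto a).mono_left hF
      rwa [ha, zero_mul] at this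
    have t3 : Tendsto (fun x => u x * T.eval x) F (𝓝 0) := by
      have t4 : Tendsto (fun x => (1 - x ^ 2) * (w x * (derivative P).eval x) * (w x * u x)) F
          (𝓝 0) := by
        refine squeeze_zero_norm' (a := fun x =>
          |(1 - x ^ 2) * (w x * (derivative P).eval x)| * C) ?_ ?_
        · filter_upwards [hFI] with x hx
          rw [norm_mul]
          exact mul_le_mul_of_nonneg_left (hC x hx) (abs_nonneg _)
        · simpa using t2.abs.mul_const C
      refine t4.congr' ?_
      filter_upwards [hFI] with x hx using (hTx x hx).symm
    simpa using t1.sub t3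
  have hFTC := intervalIntegral.integral_eq_sub_of_hasDerivAt_of_tendsto (a := -1) (b := 1)
    (by norm_num) hder
    (by
      rw [intervalIntegrable_iff_integrableOn_Ioo_of_le (by norm_num)]
      exact (i1.const_mul κ).sub i2)
    (lim (-1) (by norm_num) _ nhdsWithin_le_nhds
      (Ioo_mem_nhdsGT (by norm_num)) (h.flux_tendsto_zero' hN hC))
    (lim 1 (by norm_num) _ nhdsWithin_le_nhds
      (Ioo_mem_nhdsLT (by norm_num)) (h.flux_tendsto_zero hN hC))
  rw [intervalIntegral.integral_of_le (by norm_num), integral_Ioc_eq_integral_Ioo, sub_zero,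
    integral_sub (i1.const_mul κ) i2, integral_const_mul, sub_eq_zero] at hFTC
  exact hFTC

end JacobiSystem

/-! ### From weak solutions to bounded classical ones. -/

section JacobiRegularity

open Polynomial

variable {α β : ℕ}

/-- The flux `∫ t in x..1, √ρ g` of a solution with source `g`. -/
def jacobiFlux (α β : ℕ) (g : IooL2) (x : ℝ) : ℝ := ∫ t in x..1, jacobiSqrt α β t * g t

/-- The solution with source `g` that vanishes at `0`. -/
def jacobiPot (α β : ℕ) (g : IooL2) (x : ℝ) : ℝ :=
  ∫ t in (0 : ℝ)..x, jacobiFlux α β g t / ((1 - t ^ 2) * (jacobiWeight α β).eval t)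

lemma integrableOn_jacobiSqrt_mul (g : IooL2) :
    IntegrableOn (fun t => jacobiSqrt α β t * g t) (Ioo (-1) 1) :=
  (continuous_jacobiSqrt α β).memLp_volIoo.integrable_mul (Lp.memLp g)

lemma intervalIntegrable_jacobiSqrt_mul (g : IooL2) {a b : ℝ} (ha : a ∈ Icc (-1 : ℝ) 1)
    (hb : b ∈ Icc (-1 : ℝ) 1) :
    IntervalIntegrable (fun t => jacobiSqrt α β t * g t) volume a b := by
  have h : IntegrableOn (fun t => jacobiSqrt α β t * g t) (Icc (-1) 1) := by
    rw [integrableOn_Icc_iff_integrableOn_Ioo]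
    exact integrableOn_jacobiSqrt_mul g
  exact (h.mono_set (uIcc_subset_Icc ha hb)).intervalIntegrable

lemma jacobiFlux_sub (g g' : IooL2) {x : ℝ} (hx : x ∈ Ioo (-1 : ℝ) 1) :
    jacobiFlux α β (g - g') x = jacobiFlux α β g x - jacobiFlux α β g' x := by
  have hx' := Ioo_subset_Icc_self hx
  rw [jacobiFlux, jacobiFlux, jacobiFlux, ← intervalIntegral.integral_sub
    (intervalIntegrable_jacobiSqrt_mul g hx' (by norm_num))
    (intervalIntegrable_jacobiSqrt_mul g' hx' (by norm_num)),
    intervalIntegral.integral_of_le hx.2.le, intervalIntegral.integral_of_le hx.2.le,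
    integral_Ioc_eq_integral_Ioo, integral_Ioc_eq_integral_Ioo]
  refine integral_congr_ae ?_
  filter_upwards [ae_restrict_of_ae_restrict_of_subset (Ioo_subset_Ioo_left hx.1.le)
    (Lp.coeFn_sub g g')] with t ht
  rw [ht, Pi.sub_apply, mul_sub]

lemma continuousOn_jacobiFlux (g : IooL2) : ContinuousOn (jacobiFlux α β g) (Ioo (-1) 1) := by
  have h : IntegrableOn (fun t => jacobiSqrt α β t * g t) (uIcc (-1) 1) := by
    rw [uIcc_of_le (by norm_num), integrableOn_Icc_iff_integrableOn_Ioo]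
    exact integrableOn_jacobiSqrt_mul g
  have := intervalIntegral.continuousOn_primitive_interval_left h
  rw [uIcc_of_le (by norm_num)] at this
  exact this.mono Ioo_subset_Icc_self

lemma jacobiDenom_pos {x : ℝ} (hx : x ∈ Ioo (-1 : ℝ) 1) :
    0 < (1 - x ^ 2) * (jacobiWeight α β).eval x :=
  mul_pos (by nlinarith [hx.1, hx.2]) (jacobiWeight_pos hx)

lemma continuousOn_jacobiPot_deriv (g : IooL2) : ContinuousOn
    (fun t => jacobiFlux α β g t / ((1 - t ^ 2) * (jacobiWeight α β).eval t)) (Ioo (-1) 1) := by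
  refine (continuousOn_jacobiFlux g).div ?_ fun x hx => (jacobiDenom_pos hx).ne'
  exact ((by fun_prop : Continuous fun t : ℝ => 1 - t ^ 2).mul
    (jacobiWeight α β).continuous).continuousOn

lemma zero_uIcc_subset_Ioo {x : ℝ} (hx : x ∈ Ioo (-1 : ℝ) 1) : uIcc 0 x ⊆ Ioo (-1) 1 :=
  OrdConnected.uIcc_subset ordConnected_Ioo (by norm_num) hx

lemma hasDerivAt_jacobiPot (g : IooL2) {x : ℝ} (hx : x ∈ Ioo (-1 : ℝ) 1) :
    HasDerivAt (jacobiPot α β g)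
      (jacobiFlux α β g x / ((1 - x ^ 2) * (jacobiWeight α β).eval x)) x := by
  have hc := continuousOn_jacobiPot_deriv (α := α) (β := β) g
  exact intervalIntegral.integral_hasDerivAt_right
    ((hc.mono (zero_uIcc_subset_Ioo hx)).intervalIntegrable)
    (hc.stronglyMeasurableAtFilter isOpen_Ioo x hx)
    (hc.continuousAt (isOpen_Ioo.mem_nhds hx))

lemma jacobiPot_sub (g g' : IooL2) {x : ℝ} (hx : x ∈ Ioo (-1 : ℝ) 1) :
    jacobiPot α β (g - g') x = jacobiPot α β g x - jacobiPot α β g' x := by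
  have hs := zero_uIcc_subset_Ioo hx
  rw [jacobiPot, jacobiPot, jacobiPot, ← intervalIntegral.integral_sub
    (((continuousOn_jacobiPot_deriv g).mono hs).intervalIntegrable)
    (((continuousOn_jacobiPot_deriv g').mono hs).intervalIntegrable)]
  refine intervalIntegral.integral_congr fun t ht => ?_
  rw [jacobiFlux_sub g g' (hs ht), sub_div]

/-- Cauchy–Schwarz of `g` against `√ρ` cut off to `A`. -/
lemma abs_setIntegral_jacobiSqrt_mul_le (g : IooL2) {A : Set ℝ} (hA : MeasurableSet A)
    (hA' : A ⊆ Ioo (-1) 1) {B : ℝ} (hB0 : 0 ≤ B) (hB : ∀ t ∈ A, (jacobiWeight α β).eval t ≤ B)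
    {L : ℝ} (hL : 0 ≤ L) (hAL : volume A ≤ ENNReal.ofReal L) :
    |∫ t in A, jacobiSqrt α β t * g t| ≤ √(B * L) * ‖g‖ := by
  have hm : MemLp (A.indicator (jacobiSqrt α β)) 2 volIoo :=
    (continuous_jacobiSqrt α β).memLp_volIoo.indicator hA
  set k := hm.toLp _ with hk
  have hkc : k =ᵐ[volIoo] A.indicator (jacobiSqrt α β) := hm.coeFn_toLp
  have e1 : ∫ t in A, jacobiSqrt α β t * g t = inner ℝ k g := by
    rw [L2.inner_def, ← inter_eq_left.2 hA', ← Measure.restrict_restrict hA,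
      ← integral_indicator hA]
    refine integral_congr_ae ?_
    filter_upwards [hkc] with t ht
    rw [ht]
    by_cases h : t ∈ A <;> simp [h, mul_comm]
  have e2 : ‖k‖ ^ 2 ≤ B * L := by
    have e3 : ‖k‖ ^ 2 = ∫ t in A, (jacobiWeight α β).eval t := by
      rw [← real_inner_self_eq_norm_sq, L2.inner_def, ← inter_eq_left.2 hA',
        ← Measure.restrict_restrict hA, ← integral_indicator hA]
      refine integral_congr_ae ?_
      filter_upwards [hkc, ae_restrict_mem measurableSet_Ioo] with t ht htI
      rw [ht]
      by_cases h : t ∈ A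
      · simp only [h, indicator_of_mem]
        rw [← jacobiSqrt_mul_self htI]
        rfl
      · simp [h]
    have hfin : volume A < ⊤ := hAL.trans_lt ENNReal.ofReal_lt_top
    rw [e3]
    calc ∫ t in A, (jacobiWeight α β).eval t ≤ B * volume.real A := by
          refine (Real.le_norm_self _).trans
            (norm_setIntegral_le_of_norm_le_const hfin fun t ht => ?_)
          rw [Real.norm_of_nonneg (jacobiWeight_pos (hA' ht)).le]
          exact hB t ht
      _ ≤ B * L := by
          gcongr
          exact ENNReal.toReal_le_of_le_ofReal hL hAL
  rw [e1]
  refine (abs_real_inner_le_norm k g).trans ?_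
  gcongr
  exact Real.le_sqrt_of_sq_le e2

lemma abs_jacobiFlux_le (g : IooL2) {x : ℝ} (hx : x ∈ Ioo (-1 : ℝ) 1) :
    |jacobiFlux α β g x| ≤ ‖g‖ * √(2 ^ β * (1 - x) ^ (α + 1)) := by
  rw [jacobiFlux, intervalIntegral.integral_of_le hx.2.le, integral_Ioc_eq_integral_Ioo]
  have := abs_setIntegral_jacobiSqrt_mul_le (α := α) (β := β) g (measurableSet_Ioo (a := x) (b := 1))
    (Ioo_subset_Ioo_left hx.1.le) (B := 2 ^ β * (1 - x) ^ α)
    (mul_nonneg (by positivity) (pow_nonneg (by linarith [hx.2]) _)) (fun t ht => by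
      rw [eval_jacobiWeight, mul_comm]
      have h1 : 0 ≤ 1 + t := by linarith [hx.1, ht.1]
      have h2 : 0 ≤ 1 - t := by linarith [ht.2]
      gcongr
      · linarith [ht.2]
      · exact ht.1.le) (L := 1 - x) (by linarith [hx.2]) (by rw [Real.volume_Ioo])
  rwa [mul_assoc, ← pow_succ, mul_comm] at this

/-- The flux is defined by integration from `1`. Orthogonality of the source to the ground state
`√ρ` is what makes it vanish at `-1` too. -/
lemma abs_jacobiFlux_le' (g : IooL2) (hg : inner ℝ (jacobiJ α β 1) g = 0) {x : ℝ}
    (hx : x ∈ Ioo (-1 : ℝ) 1) :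
    |jacobiFlux α β g x| ≤ ‖g‖ * √(2 ^ α * (1 + x) ^ (β + 1)) := by
  have hx' := Ioo_subset_Icc_self hx
  have e : jacobiFlux α β g x = -∫ t in Ioo (-1) x, jacobiSqrt α β t * g t := by
    have h1 := intervalIntegral.integral_add_adjacent_intervals
      (intervalIntegrable_jacobiSqrt_mul (α := α) (β := β) g
        (show (-1 : ℝ) ∈ Icc (-1) 1 by norm_num) hx')
      (intervalIntegrable_jacobiSqrt_mul g hx' (show (1 : ℝ) ∈ Icc (-1) 1 by norm_num))
    have h2 : ∫ t in (-1 : ℝ)..1, jacobiSqrt α β t * g t = 0 := by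
      rw [intervalIntegral.integral_of_le (by norm_num), integral_Ioc_eq_integral_Ioo, ← hg,
        inner_jacobiJ]
      simp
    rw [h2, intervalIntegral.integral_of_le hx.1.le, integral_Ioc_eq_integral_Ioo] at h1
    rw [jacobiFlux]
    linarith
  rw [e, abs_neg]
  have := abs_setIntegral_jacobiSqrt_mul_le (α := α) (β := β) g
    (measurableSet_Ioo (a := -1) (b := x))
    (Ioo_subset_Ioo_right hx.2.le) (B := 2 ^ α * (1 + x) ^ β)
    (mul_nonneg (by positivity) (pow_nonneg (by linarith [hx.1]) _)) (fun t ht => by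
      rw [eval_jacobiWeight]
      have h1 : 0 ≤ 1 + t := by linarith [ht.1]
      have h2 : 0 ≤ 1 - t := by linarith [hx.2, ht.2]
      gcongr
      · linarith [ht.1]
      · exact ht.2.le) (L := 1 + x) (by linarith [hx.1])
      (by rw [Real.volume_Ioo]; apply le_of_eq; congr 1; ring)
  rwa [mul_assoc, ← pow_succ, mul_comm] at this

/-- After multiplication by `√ρ(x)`, the derivative of `u` at `t ≤ x` is at most `2^β N (1 -
t)^(-1/2)`, which is integrable up to `1` with integral at most `2`. -/
lemma jacobiSqrt_mul_abs_le_of_flux {u v : ℝ → ℝ} {N : ℝ}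
    (hu : ∀ x ∈ Ioo (-1 : ℝ) 1,
      HasDerivAt u (v x / ((1 - x ^ 2) * (jacobiWeight α β).eval x)) x)
    (hu0 : u 0 = 0) (hv : ∀ x ∈ Ioo (-1 : ℝ) 1, |v x| ≤ N * √(2 ^ β * (1 - x) ^ (α + 1)))
    {x : ℝ} (hx : x ∈ Ico (0 : ℝ) 1) : jacobiSqrt α β x * |u x| ≤ 2 ^ β * N * 2 := by
  have hsub : ∀ t ∈ Icc 0 x, t ∈ Ioo (-1 : ℝ) 1 := fun t ht =>
    ⟨by linarith [ht.1], ht.2.trans_lt hx.2⟩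
  have hxI : x ∈ Ioo (-1 : ℝ) 1 := hsub x ⟨hx.1, le_rfl⟩
  have hN : 0 ≤ N := by
    have := (abs_nonneg _).trans (hv 0 (by norm_num))
    exact nonneg_of_mul_nonneg_left this (by positivity)
  have hw := jacobiSqrt_pos (α := α) (β := β) hxI
  have key := image_norm_le_of_norm_deriv_right_le_deriv_boundary' (a := 0) (b := x)
    (f := fun t => jacobiSqrt α β x * u t)
    (f' := fun t => jacobiSqrt α β x * (v t / ((1 - t ^ 2) * (jacobiWeight α β).eval t)))
    -- The primitive of `2^β N (1 - t)^(-1/2)` that vanishes at `0`.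
    (B := fun t => 2 ^ β * N * (2 - 2 * √(1 - t)))
    (B' := fun t => 2 ^ β * N * (-(2 * (-1 / (2 * √(1 - t))))))
    (fun t ht => ((hu t (hsub t ht)).const_mul _).continuousAt.continuousWithinAt)
    (fun t ht => ((hu t (hsub t ⟨ht.1, ht.2.le⟩)).const_mul _).hasDerivWithinAt)
    (by simp [hu0]) (by fun_prop)
    (fun t ht => by
      have h1 : (1 - t) ≠ 0 := by linarith [ht.2, hx.2]
      exact ((((((hasDerivAt_id t).const_sub 1).sqrt h1).const_mul 2).const_sub 2).const_mul
        (2 ^ β * N)).hasDerivWithinAt)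
    (fun t ht => by
      have htI := hsub t ⟨ht.1, ht.2.le⟩
      have h1 : 0 < 1 - t := by linarith [htI.2]
      have h2 := one_sub_sq_mul_jacobiWeight_ge (α := α) (β := β) ht.1 htI.2
      have h3 := jacobiSqrt_le (α := α) (β := β) ht.2.le htI hxI.2
      have h4 := hv t htI
      have hs : 0 < √(1 - t) := Real.sqrt_pos.2 h1
      have hss : √(1 - t) * √(1 - t) = 1 - t := Real.mul_self_sqrt h1.le
      rw [norm_mul, norm_div, Real.norm_of_nonneg hw.le, Real.norm_eq_abs,
        Real.norm_of_nonneg (jacobiDenom_pos htI).le, ← mul_div_assoc,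
        div_le_iff₀ (jacobiDenom_pos htI)]
      have e : √(2 ^ β * (1 - t) ^ α) * (N * √(2 ^ β * (1 - t) ^ (α + 1)))
          = 2 ^ β * N * (-(2 * (-1 / (2 * √(1 - t))))) * (1 - t) ^ (α + 1) := by
        have e1 : √(2 ^ β * (1 - t) ^ (α + 1)) = √(2 ^ β * (1 - t) ^ α) * √(1 - t) := by
          rw [← Real.sqrt_mul (by positivity)]
          congr 1
          ring
        have e2 : √(2 ^ β * (1 - t) ^ α) * √(2 ^ β * (1 - t) ^ α) = 2 ^ β * (1 - t) ^ α :=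
          Real.mul_self_sqrt (by positivity)
        have e3 : (1 - t) / √(1 - t) = √(1 - t) := by
          rw [div_eq_iff hs.ne', hss]
        calc _ = N * (√(2 ^ β * (1 - t) ^ α) * √(2 ^ β * (1 - t) ^ α)) * √(1 - t) := by
              rw [e1]; ring
          _ = N * (2 ^ β * (1 - t) ^ α) * ((1 - t) / √(1 - t)) := by rw [e2, e3]
          _ = _ := by
              field_simp
              ring
      calc jacobiSqrt α β x * |v t|
          ≤ √(2 ^ β * (1 - t) ^ α) * (N * √(2 ^ β * (1 - t) ^ (α + 1))) := by gcongr
        _ = _ := e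
        _ ≤ _ := by
          gcongr
          have : -(2 * (-1 / (2 * √(1 - t)))) = 1 / √(1 - t) := by field_simp
          rw [this]
          positivity)
    (show x ∈ Icc 0 x from ⟨hx.1, le_rfl⟩)
  rw [norm_mul, Real.norm_of_nonneg hw.le, Real.norm_eq_abs] at key
  refine key.trans ?_
  gcongr
  linarith [Real.sqrt_nonneg (1 - x)]

/-- Each half of the interval uses the flux bound at its own endpoint, the left one after the
reflection that exchanges `α` and `β`. The bound is uniform in `x` and linear in `‖g‖`, so `L²`
convergence of sources gives uniform convergence of `√ρ` times the solutions. -/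
lemma jacobiPot_bound (g : IooL2) (hg : inner ℝ (jacobiJ α β 1) g = 0) {x : ℝ}
    (hx : x ∈ Ioo (-1 : ℝ) 1) :
    |jacobiSqrt α β x * jacobiPot α β g x| ≤ (2 ^ α + 2 ^ β) * 2 * ‖g‖ := by
  have hu0 : jacobiPot α β g 0 = 0 := intervalIntegral.integral_same
  rw [abs_mul, abs_of_pos (jacobiSqrt_pos hx)]
  have p1 : (0 : ℝ) ≤ 2 ^ α * ‖g‖ := by positivity
  have p2 : (0 : ℝ) ≤ 2 ^ β * ‖g‖ := by positivity
  rcases le_total 0 x with h | h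
  · have := jacobiSqrt_mul_abs_le_of_flux (fun x hx => hasDerivAt_jacobiPot (α := α) (β := β) g hx)
      hu0 (fun x hx => abs_jacobiFlux_le g hx) (x := x) ⟨h, hx.2⟩
    linarith
  · have := jacobiSqrt_mul_abs_le_of_flux (α := β) (β := α) (N := ‖g‖)
      (u := fun x => jacobiPot α β g (-x)) (v := fun x => -jacobiFlux α β g (-x))
      (fun x hx => by
        have h1 := (hasDerivAt_jacobiPot (α := α) (β := β) g (neg_mem_Ioo hx)).comp x
          (hasDerivAt_neg x)
        refine h1.congr_deriv ?_
        rw [eval_neg_jacobiWeight]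
        ring)
      (by simpa using hu0)
      (fun x hx => by
        rw [abs_neg]
        have := abs_jacobiFlux_le' g hg (neg_mem_Ioo hx)
        rwa [← sub_eq_add_neg] at this)
      (x := -x) ⟨by linarith, by linarith [hx.1]⟩
    rw [jacobiSqrt_neg, neg_neg] at this
    linarith

lemma memLp_jacobiPot (g : IooL2) (hg : inner ℝ (jacobiJ α β 1) g = 0) :
    MemLp (fun x => jacobiSqrt α β x * jacobiPot α β g x) 2 volIoo := by
  refine memLp_of_bounded (a := -((2 ^ α + 2 ^ β) * 2 * ‖g‖)) (b := (2 ^ α + 2 ^ β) * 2 * ‖g‖)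
    ?_ ?_ 2
  · filter_upwards [ae_restrict_mem measurableSet_Ioo] with x hx
      using abs_le.1 (jacobiPot_bound g hg hx)
  · refine ContinuousOn.aestronglyMeasurable (fun x hx => ?_) measurableSet_Ioo
    exact ((continuous_jacobiSqrt α β).continuousAt.mul
      (hasDerivAt_jacobiPot g hx).continuousAt).continuousWithinAt

lemma jacobiFlux_of_isJacobiPair {Q G : ℝ[X]} (h : IsJacobiPair α β Q G) {x : ℝ}
    (hx : x ∈ Ioo (-1 : ℝ) 1) : jacobiFlux α β (jacobiJ α β G) x
      = (1 - x ^ 2) * (jacobiWeight α β).eval x * (derivative Q).eval x := by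
  have e : jacobiFlux α β (jacobiJ α β G) x = ∫ t in x..1, (jacobiWeight α β * G).eval t := by
    rw [jacobiFlux, intervalIntegral.integral_of_le hx.2.le, intervalIntegral.integral_of_le hx.2.le,
      integral_Ioc_eq_integral_Ioo, integral_Ioc_eq_integral_Ioo]
    refine integral_congr_ae ?_
    filter_upwards [ae_restrict_of_ae_restrict_of_subset (Ioo_subset_Ioo_left hx.1.le)
      (coeFn_jacobiJ α β G), ae_restrict_mem measurableSet_Ioo] with t ht htI
    rw [ht, eval_mul, ← jacobiSqrt_mul_self ⟨hx.1.trans htI.1, htI.2⟩, mul_assoc]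
  set T : ℝ[X] := (1 - X ^ 2) * jacobiWeight α β * derivative Q with hT
  have hd : derivative T = -(jacobiWeight α β * G) := h
  have := intervalIntegral.integral_eq_sub_of_hasDerivAt (a := x) (b := 1)
    (fun x _ => T.hasDerivAt x) ((derivative T).continuous.intervalIntegrable _ _)
  simp only [hd, eval_neg, intervalIntegral.integral_neg] at this
  rw [e, ← neg_neg (∫ t in x..1, _), this, hT]
  simp

lemma jacobiPot_of_isJacobiPair {Q G : ℝ[X]} (h : IsJacobiPair α β Q G) {x : ℝ}
    (hx : x ∈ Ioo (-1 : ℝ) 1) : jacobiPot α β (jacobiJ α β G) x = Q.eval x - Q.eval 0 := by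
  rw [← intervalIntegral.integral_eq_sub_of_hasDerivAt (a := 0) (b := x)
    (fun x _ => Q.hasDerivAt x) ((derivative Q).continuous.intervalIntegrable _ _), jacobiPot]
  refine intervalIntegral.integral_congr fun t ht => ?_
  have htI := zero_uIcc_subset_Ioo hx ht
  rw [jacobiFlux_of_isJacobiPair h htI, mul_div_cancel_left₀ _ (jacobiDenom_pos htI).ne']

/-- A weak solution is the classical solution with the same source. -/
theorem exists_eq_jacobiPot {f g : IooL2}
    (h : ∀ k, jacobiEigenvalue α β k * inner ℝ (jacobiBasis α β k) f
      = inner ℝ (jacobiBasis α β k) g) :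
    inner ℝ (jacobiJ α β 1) g = 0 ∧
      ∃ c : ℝ, f =ᵐ[volIoo] fun x => jacobiSqrt α β x * (c + jacobiPot α β g x) := by
  have hg : inner ℝ (jacobiJ α β 1) g = 0 := by
    have h0 := h 0
    rw [jacobiEigenvalue_zero, zero_mul, jacobiBasis_apply, inner_smul_left, jacobiP_zero] at h0
    refine (mul_eq_zero.1 h0.symm).resolve_left ?_
    have := jacobiJ_jacobiP_ne_zero α β 0
    rw [jacobiP_zero] at this
    simpa using this
  refine ⟨hg, ?_⟩
  set b := jacobiBasis α β with hb
  set n : ℕ → ℝ := fun k => ‖jacobiJ α β (jacobiP α β k)‖⁻¹ with hn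
  set Q : ℕ → ℝ[X] := fun N => ∑ k ∈ Finset.range N, C (inner ℝ (b k) f * n k) * jacobiP α β k
  set G : ℕ → ℝ[X] := fun N => ∑ k ∈ Finset.range N, C (inner ℝ (b k) g * n k) * jacobiP α β k
  -- The weak equation says that the coefficients of `g` are `κ k` times those of `f`, so the
  -- partial sums solve the equation exactly, as polynomials.
  have hQG (N : ℕ) : IsJacobiPair α β (Q N) (G N) := by
    refine IsJacobiPair.sum _ fun k _ => ?_
    have := (isJacobiPair_jacobiP α β k).C_mul (inner ℝ (b k) f * n k)
    rw [← mul_assoc, ← Polynomial.C_mul] at this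
    rw [← h k]
    convert this using 3
    ring
  have hJ (f : IooL2) (N : ℕ) :
      jacobiJ α β (∑ k ∈ Finset.range N, C (inner ℝ (b k) f * n k) * jacobiP α β k)
        = ∑ k ∈ Finset.range N, inner ℝ (b k) f • b k := by
    rw [map_sum]
    refine Finset.sum_congr rfl fun k _ => ?_
    rw [← smul_eq_C_mul, map_smul, mul_smul, hb, jacobiBasis_apply]
  have hconv (f : IooL2) : Tendsto (fun N => jacobiJ α β
      (∑ k ∈ Finset.range N, C (inner ℝ (b k) f * n k) * jacobiP α β k)) atTop (𝓝 f) := by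
    simp_rw [hJ]
    have := (b.hasSum_repr f).tendsto_sum_nat
    simpa only [b.repr_apply_apply] using this
  have hfN : Tendsto (fun N => jacobiJ α β (Q N)) atTop (𝓝 f) := hconv f
  have hgN : Tendsto (fun N => jacobiJ α β (G N)) atTop (𝓝 g) := hconv g
  have hG1 (N : ℕ) : inner ℝ (jacobiJ α β 1) (jacobiJ α β (G N)) = 0 := by
    have h1 : IsJacobiPair α β 1 0 := by simp [IsJacobiPair]
    rw [← h1.inner_comm (hQG N), map_zero, inner_zero_left]
  set F := (memLp_jacobiPot g hg).toLp _ with hF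
  have hFc : F =ᵐ[volIoo] fun x => jacobiSqrt α β x * jacobiPot α β g x :=
    (memLp_jacobiPot g hg).coeFn_toLp
  have hbound (N : ℕ) : ‖jacobiJ α β (Q N) - (Q N).eval 0 • jacobiJ α β 1 - F‖
      ≤ (volIoo.real univ) ^ (2 : ENNReal).toReal⁻¹ *
        ((2 ^ α + 2 ^ β) * 2 * ‖jacobiJ α β (G N) - g‖) := by
    refine Lp.norm_le_of_ae_bound (by positivity) ?_
    have hG2 : inner ℝ (jacobiJ α β 1) (jacobiJ α β (G N) - g) = 0 := by
      rw [inner_sub_right, hG1, hg, sub_zero]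
    filter_upwards [Lp.coeFn_sub (jacobiJ α β (Q N) - (Q N).eval 0 • jacobiJ α β 1) F,
      Lp.coeFn_sub (jacobiJ α β (Q N)) ((Q N).eval 0 • jacobiJ α β 1),
      Lp.coeFn_smul ((Q N).eval 0) (jacobiJ α β 1), coeFn_jacobiJ α β (Q N), coeFn_jacobiJ α β 1,
      hFc, ae_restrict_mem measurableSet_Ioo] with x h1 h2 h3 h4 h5 h6 hx
    rw [h1, Pi.sub_apply, h2, Pi.sub_apply, h3, Pi.smul_apply, h4, h5, h6]
    refine le_trans (le_of_eq ?_) (jacobiPot_bound _ hG2 hx)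
    rw [jacobiPot_sub _ _ hx, jacobiPot_of_isJacobiPair (hQG N) hx, Real.norm_eq_abs]
    congr 1
    simp only [smul_eq_mul, eval_one]
    ring
  -- `jacobiPot` recovers `Q N` up to its value at `0`. These values need not obviously converge,
  -- but the multiples of `√ρ` do, and their limit stays on the closed line spanned by `√ρ`.
  have hlim : Tendsto (fun N => (Q N).eval 0 • jacobiJ α β 1) atTop (𝓝 (f - F)) := by
    have h1 : Tendsto (fun N => ‖jacobiJ α β (G N) - g‖) atTop (𝓝 0) :=
      tendsto_iff_norm_sub_tendsto_zero.1 hgN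
    have h2 : Tendsto (fun N => jacobiJ α β (Q N) - (Q N).eval 0 • jacobiJ α β 1 - F) atTop
        (𝓝 0) := by
      refine squeeze_zero_norm hbound ?_
      simpa using (h1.const_mul ((2 ^ α + 2 ^ β) * 2)).const_mul
        ((volIoo.real univ) ^ (2 : ENNReal).toReal⁻¹)
    have h3 := (hfN.sub h2).sub_const F
    rw [sub_zero] at h3
    refine h3.congr fun N => ?_
    abel
  have hmem : f - F ∈ Submodule.span ℝ {jacobiJ α β 1} := by
    refine (Submodule.closed_of_finiteDimensional (Submodule.span ℝ {jacobiJ α β 1})).mem_of_tendsto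
      hlim (Eventually.of_forall fun N => ?_)
    exact Submodule.smul_mem _ _ (Submodule.mem_span_singleton_self _)
  obtain ⟨c, hc⟩ := Submodule.mem_span_singleton.1 hmem
  refine ⟨c, ?_⟩
  have hfc : f = c • jacobiJ α β 1 + F := by rw [hc]; abel
  filter_upwards [hFc, coeFn_jacobiJ α β 1, Lp.coeFn_smul c (jacobiJ α β 1),
    Lp.coeFn_add (c • jacobiJ α β 1) F] with x h1 h2 h3 h4
  rw [hfc, h4, Pi.add_apply, h3, Pi.smul_apply, h1, h2]
  simp only [smul_eq_mul, eval_one]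
  ring

/-- Regularity of weak solutions of the equation with source `r f`. -/
theorem exists_isJacobiSystem {f g : IooL2}
    (h : ∀ k, jacobiEigenvalue α β k * inner ℝ (jacobiBasis α β k) f
      = inner ℝ (jacobiBasis α β k) g)
    {r : ℝ → ℝ} (hr : Continuous r) (hg : g =ᵐ[volIoo] fun x => r x * f x) :
    ∃ u v : ℝ → ℝ, IsJacobiSystem α β u v (fun x => r x * (jacobiSqrt α β x * u x)) ∧
      (∃ C, ∀ x ∈ Ioo (-1 : ℝ) 1, |jacobiSqrt α β x * u x| ≤ C) ∧
      f =ᵐ[volIoo] fun x => jacobiSqrt α β x * u x := by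
  obtain ⟨hg1, c, hc⟩ := exists_eq_jacobiPot h
  refine ⟨fun x => c + jacobiPot α β g x, jacobiFlux α β g, fun x hx => ⟨?_, ?_⟩, ?_, hc⟩
  · exact (hasDerivAt_jacobiPot g hx).const_add c
  -- The source is known only almost everywhere; `q` is a continuous representative of `√ρ g`, so
  -- the flux is differentiable at every point.
  · set q : ℝ → ℝ := fun t => jacobiSqrt α β t *
      (r t * (jacobiSqrt α β t * (c + jacobiPot α β g t))) with hq
    have hqc : ContinuousOn q (Ioo (-1) 1) := fun t ht =>
      ((continuous_jacobiSqrt α β).continuousAt.mul (hr.continuousAt.mul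
        ((continuous_jacobiSqrt α β).continuousAt.mul
          (continuousAt_const.add (hasDerivAt_jacobiPot g ht).continuousAt)))).continuousWithinAt
    have hqe : (fun t => jacobiSqrt α β t * g t) =ᵐ[volIoo] q := by
      filter_upwards [hg, hc] with t h1 h2
      rw [h1, h2]
    have e : ∀ y ∈ Ioo (-1 : ℝ) 1, jacobiFlux α β g y
        = jacobiFlux α β g 0 - ∫ t in (0 : ℝ)..y, q t := by
      intro y hy
      have h0 : (0 : ℝ) ∈ Icc (-1 : ℝ) 1 := by norm_num
      have h1 : (1 : ℝ) ∈ Icc (-1 : ℝ) 1 := by norm_num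
      have hy' := Ioo_subset_Icc_self hy
      have := intervalIntegral.integral_add_adjacent_intervals
        (intervalIntegrable_jacobiSqrt_mul (α := α) (β := β) g h0 hy')
        (intervalIntegrable_jacobiSqrt_mul g hy' h1)
      rw [jacobiFlux, jacobiFlux, ← this]
      have e2 : ∫ t in (0 : ℝ)..y, jacobiSqrt α β t * g t = ∫ t in (0 : ℝ)..y, q t := by
        refine intervalIntegral.integral_congr_ae_restrict ?_
        exact ae_restrict_of_ae_restrict_of_subset
          (uIoc_subset_uIcc.trans (zero_uIcc_subset_Ioo hy)) hqe
      rw [e2]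
      ring
    have hd : HasDerivAt (fun y => jacobiFlux α β g 0 - ∫ t in (0 : ℝ)..y, q t) (-q x) x :=
      (intervalIntegral.integral_hasDerivAt_right
        ((hqc.mono (zero_uIcc_subset_Ioo hx)).intervalIntegrable)
        (hqc.stronglyMeasurableAtFilter isOpen_Ioo x hx)
        (hqc.continuousAt (isOpen_Ioo.mem_nhds hx))).const_sub _
    refine hd.congr_of_eventuallyEq ?_
    filter_upwards [isOpen_Ioo.mem_nhds hx] with y hy using e y hy
  · obtain ⟨M, hM⟩ := isCompact_Icc.exists_bound_of_continuousOn
      ((continuous_jacobiSqrt α β).continuousOn (s := Icc (-1) 1))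
    refine ⟨M * |c| + (2 ^ α + 2 ^ β) * 2 * ‖g‖, fun x hx => ?_⟩
    rw [mul_add]
    refine (abs_add_le _ _).trans (add_le_add ?_ (jacobiPot_bound g hg1 hx))
    rw [abs_mul]
    gcongr
    exact hM x (Ioo_subset_Icc_self hx)

end JacobiRegularity

/-! ### The spheroidal equation as a Jacobi system. -/

section SpheroidalSystem

open Polynomial

variable {α β : ℕ}

/-- A solution which vanishes near `1` vanishes identically. -/
lemma IsJacobiSystem.eq_zero_of_eqOn_zero {u v r : ℝ → ℝ} (hr : Continuous r)
    (h : IsJacobiSystem α β u v fun x => r x * (jacobiSqrt α β x * u x)) {y : ℝ}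
    (hy : y ∈ Ioo (-1 : ℝ) 1) (h0 : ∀ x ∈ Ioo y 1, u x = 0) : ∀ x ∈ Ioo (-1 : ℝ) 1, u x = 0 := by
  intro x hx
  obtain ⟨z, hyz, hz1⟩ := exists_between hy.2
  rcases lt_or_ge z x with hzx | hxz
  · exact h0 x ⟨hyz.trans hzx, hx.2⟩
  have hzI : z ∈ Ioo (-1 : ℝ) 1 := ⟨hy.1.trans hyz, hz1⟩
  have hsub : Icc x z ⊆ Ioo (-1 : ℝ) 1 := fun t ht => ⟨hx.1.trans_le ht.1, ht.2.trans_lt hz1⟩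
  have huz : u z = 0 := h0 z ⟨hyz, hz1⟩
  -- Vanishing of `u` near `z` forces zero Cauchy data for the linear system at `z`; uniqueness on
  -- `[x, z]`, away from the singular endpoints, does the rest.
  have hvz : v z = 0 := by
    have h1 : HasDerivAt u 0 z := by
      refine (hasDerivAt_const z (0 : ℝ)).congr_of_eventuallyEq ?_
      filter_upwards [isOpen_Ioo.mem_nhds (⟨hyz, hz1⟩ : z ∈ Ioo y 1)] with t ht using h0 t ht
    have h2 := (h z hzI).1.unique h1
    exact (div_eq_zero_iff.1 h2).resolve_right (jacobiDenom_pos hzI).ne'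
  set A : ℝ → ℝ := fun t => ((1 - t ^ 2) * (jacobiWeight α β).eval t)⁻¹ with hA
  set B : ℝ → ℝ := fun t => -(jacobiSqrt α β t * (r t * jacobiSqrt α β t)) with hB
  have hAc : ContinuousOn A (Icc x z) := by
    refine ContinuousOn.inv₀ ?_ fun t ht => (jacobiDenom_pos (hsub ht)).ne'
    exact ((by fun_prop : Continuous fun t : ℝ => 1 - t ^ 2).mul
      (jacobiWeight α β).continuous).continuousOn
  have hBc : ContinuousOn B (Icc x z) := by
    have : Continuous B := by fun_prop
    exact this.continuousOn
  obtain ⟨K₁, hK₁⟩ := isCompact_Icc.exists_bound_of_continuousOn hAc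
  obtain ⟨K₂, hK₂⟩ := isCompact_Icc.exists_bound_of_continuousOn hBc
  have huc : ContinuousOn (fun t => (u t, v t)) (Icc x z) := fun t ht =>
    ((h t (hsub ht)).1.continuousAt.prodMk (h t (hsub ht)).2.continuousAt).continuousWithinAt
  have key := ODE_solution_unique_of_mem_Icc_left (a := x) (b := z) (K := (max K₁ K₂).toNNReal)
    (v := fun t (p : ℝ × ℝ) => (A t * p.2, B t * p.1)) (s := fun _ => univ)
    (f := fun t => (u t, v t)) (g := fun _ => (0, 0))
    (fun t ht => by
      refine LipschitzOnWith.of_dist_le_mul fun p _ q _ => ?_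
      have e1 := hK₁ t (Ioc_subset_Icc_self ht)
      have e2 := hK₂ t (Ioc_subset_Icc_self ht)
      have e0 : 0 ≤ max K₁ K₂ := (norm_nonneg _).trans (e1.trans (le_max_left _ _))
      rw [Real.coe_toNNReal _ e0, Prod.dist_eq]
      simp only [Real.dist_eq, ← mul_sub, abs_mul]
      have d1 : |p.1 - q.1| ≤ dist p q := le_max_left (dist p.1 q.1) (dist p.2 q.2)
      have d2 : |p.2 - q.2| ≤ dist p q := le_max_right (dist p.1 q.1) (dist p.2 q.2)
      exact max_le
        (mul_le_mul (e1.trans (le_max_left _ _)) d2 (abs_nonneg _) e0)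
        (mul_le_mul (e2.trans (le_max_right _ _)) d1 (abs_nonneg _) e0))
    huc
    (fun t ht => by
      obtain ⟨h1, h2⟩ := h t (hsub (Ioc_subset_Icc_self ht))
      refine ((h1.prodMk h2).congr_deriv ?_).hasDerivWithinAt
      simp only [hA, hB, Prod.mk.injEq]
      exact ⟨by ring, by ring⟩)
    (fun _ _ => mem_univ _) continuousOn_const
    (fun t ht => by
      refine ((hasDerivAt_const t ((0 : ℝ), (0 : ℝ))).congr_deriv ?_).hasDerivWithinAt
      simp only [mul_zero]
      rfl)
    (fun _ _ => mem_univ _) (by simp [huz, hvz])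
  exact congrArg Prod.fst (key (⟨le_rfl, hxz⟩ : x ∈ Icc x z))

/-- The eigenvalue of the spherical operator that corresponds to the lowest Jacobi eigenvalue. -/
def spheroidalShift (α β : ℕ) : ℝ := (α + β : ℝ) ^ 2 / 4 + (α + β : ℝ) / 2 - 6

/-- The potential of the spheroidal operator relative to the Jacobi operator. -/
def spheroidalPot (a ω x : ℝ) : ℝ := a ^ 2 * ω ^ 2 * (1 - x ^ 2) + 4 * a * ω * x

/-- The logarithmic derivative of the Jacobi weight, times `1 - x²`. -/
def jacobiLog (α β : ℕ) (x : ℝ) : ℝ := (β - α) - (α + β) * x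

lemma hasDerivAt_jacobiLog (x : ℝ) : HasDerivAt (jacobiLog α β) (-(α + β)) x := by
  have := ((hasDerivAt_id x).const_mul (α + β : ℝ)).const_sub (β - α : ℝ)
  exact this.congr_deriv (by ring)

lemma eval_derivative_jacobiWeight {x : ℝ} (hx : x ∈ Ioo (-1 : ℝ) 1) :
    (derivative (jacobiWeight α β)).eval x
      = (jacobiWeight α β).eval x * jacobiLog α β x / (1 - x ^ 2) := by
  have hp : (1 - x ^ 2) ≠ 0 := by nlinarith [hx.1, hx.2]
  rw [eq_div_iff hp]
  have h := congrArg (eval x) (derivative_mul_jacobiWeight α β)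
  rw [derivative_mul] at h
  simp only [eval_add, eval_mul, eval_sub, eval_one, eval_pow, eval_X, eval_C, derivative_sub,
    derivative_one, derivative_pow, derivative_X, eval_zero, Nat.cast_ofNat] at h
  rw [jacobiLog]
  norm_num at h
  linear_combination h

lemma hasDerivAt_jacobiSqrt {x : ℝ} (hx : x ∈ Ioo (-1 : ℝ) 1) :
    HasDerivAt (jacobiSqrt α β) (jacobiSqrt α β x * jacobiLog α β x / (2 * (1 - x ^ 2))) x := by
  have h := ((jacobiWeight α β).hasDerivAt x).sqrt (jacobiWeight_pos hx).ne'
  refine h.congr_deriv ?_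
  have hp : (1 - x ^ 2) ≠ 0 := by nlinarith [hx.1, hx.2]
  have hw := (jacobiSqrt_pos (α := α) (β := β) hx).ne'
  have e : √((jacobiWeight α β).eval x) = jacobiSqrt α β x := rfl
  rw [eval_derivative_jacobiWeight hx, e, ← jacobiSqrt_mul_self hx]
  field_simp

lemma contDiff_eval_polynomial {n : WithTop ℕ∞} (Q : ℝ[X]) : ContDiff ℝ n fun x => Q.eval x := by
  simpa only [Polynomial.coe_aeval_eq_eval] using Q.contDiff_aeval (𝕜 := ℝ) n

lemma contDiffOn_jacobiSqrt {n : WithTop ℕ∞} : ContDiffOn ℝ n (jacobiSqrt α β) (Ioo (-1) 1) :=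
  ContDiffOn.sqrt (contDiff_eval_polynomial _).contDiffOn fun _ hx => (jacobiWeight_pos hx).ne'

/-- Both sides are quadratic in `x` with leading coefficient `4`, and they agree at `x = 1` and `x =
-1` exactly because of the two hypotheses. This dictates the exponents of the weight and produces
the constant `spheroidalShift`. -/
lemma spheroidal_identity {m : ℤ} (hα : (α : ℝ) ^ 2 = (m + 2) ^ 2)
    (hβ : (β : ℝ) ^ 2 = (m - 2) ^ 2) (x : ℝ) :
    (m + 2 * x) ^ 2 = jacobiLog α β x ^ 2 / 4 + ((α + β : ℝ) ^ 2 / 4 - 4) * (1 - x ^ 2) := by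
  rw [jacobiLog]
  linear_combination (-(1 + x) / 2) * hα + (-(1 - x) / 2) * hβ

/-- An eigenfunction of the spheroidal operator solves a Jacobi system. -/
lemma IsSpheroidalEigenfunction.isJacobiSystem {a ω Λ : ℝ} {m : ℤ} {S : ℝ → ℝ}
    (hα : (α : ℝ) ^ 2 = (m + 2) ^ 2) (hβ : (β : ℝ) ^ 2 = (m - 2) ^ 2)
    (h : IsSpheroidalEigenfunction 2 a m ω Λ S) :
    IsJacobiSystem α β (fun x => S x / jacobiSqrt α β x)
      (fun x => jacobiSqrt α β x * ((1 - x ^ 2) * deriv S x - jacobiLog α β x * S x / 2))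
      (fun x => (Λ - spheroidalShift α β - spheroidalPot a ω x)
        * (jacobiSqrt α β x * (S x / jacobiSqrt α β x))) := by
  obtain ⟨hS, -, -, hode⟩ := h
  intro x hx
  have hxn := isOpen_Ioo.mem_nhds hx
  have hp : (1 - x ^ 2) ≠ 0 := by nlinarith [hx.1, hx.2]
  have hw := (jacobiSqrt_pos (α := α) (β := β) hx).ne'
  have h1 : HasDerivAt S (deriv S x) x :=
    ((hS.differentiableOn (by norm_num)).differentiableAt hxn).hasDerivAt
  have hd : DifferentiableAt ℝ (deriv S) x := by
    have : ContDiffOn ℝ (1 + 1) S (Ioo (-1) 1) := by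
      rw [one_add_one_eq_two]; exact hS
    exact (((contDiffOn_succ_iff_deriv_of_isOpen isOpen_Ioo).1 this).2.2.differentiableOn
      (by norm_num)).differentiableAt hxn
  have h2 : HasDerivAt (fun y => (1 - y ^ 2) * deriv S y)
      (deriv (fun y => (1 - y ^ 2) * deriv S y) x) x :=
    ((by fun_prop : DifferentiableAt ℝ (fun y : ℝ => 1 - y ^ 2) x).mul hd).hasDerivAt
  have hwd := hasDerivAt_jacobiSqrt (α := α) (β := β) hx
  have hode' := hode x hx
  push_cast at hode'
  have hid := spheroidal_identity hα hβ x
  refine ⟨(h1.div hwd hw).congr_deriv ?_, (hwd.mul (h2.sub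
    (((hasDerivAt_jacobiLog x).mul h1).div_const 2))).congr_deriv ?_⟩
  · rw [← jacobiSqrt_mul_self hx]
    field_simp
  · have e : deriv (fun y => (1 - y ^ 2) * deriv S y) x
        = (jacobiLog α β x ^ 2 / (4 * (1 - x ^ 2)) + ((α + β : ℝ) ^ 2 / 4 - 4)
          - 2 + spheroidalPot a ω x - Λ) * S x := by
      rw [hid] at hode'
      rw [spheroidalPot]
      field_simp at hode' ⊢
      linear_combination hode'
    simp only [Pi.sub_apply, Pi.mul_apply]
    rw [mul_div_cancel₀ _ hw, spheroidalShift, e]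
    field_simp
    ring

/-- Bootstrap: `u` is continuous, so `v` is `C¹`, so `u' = v / ((1 - x²) ρ)` is `C¹`. -/
lemma IsJacobiSystem.contDiffOn {u v r : ℝ → ℝ} (hr : Continuous r)
    (h : IsJacobiSystem α β u v fun x => r x * (jacobiSqrt α β x * u x)) :
    ContDiffOn ℝ 2 u (Ioo (-1) 1) := by
  have hu : DifferentiableOn ℝ u (Ioo (-1) 1) := fun x hx =>
    (h x hx).1.differentiableAt.differentiableWithinAt
  have hv : DifferentiableOn ℝ v (Ioo (-1) 1) := fun x hx =>
    (h x hx).2.differentiableAt.differentiableWithinAt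
  have hv1 : ContDiffOn ℝ (0 + 1) v (Ioo (-1) 1) := by
    refine (contDiffOn_succ_iff_deriv_of_isOpen isOpen_Ioo).2 ⟨hv, by simp, ?_⟩
    rw [contDiffOn_zero]
    refine ContinuousOn.congr ?_ fun x hx => (h x hx).2.deriv
    have := hu.continuousOn
    have hw := (continuous_jacobiSqrt α β).continuousOn (s := Ioo (-1) 1)
    exact (hw.mul (hr.continuousOn.mul (hw.mul this))).neg
  have hu2 : ContDiffOn ℝ (1 + 1) u (Ioo (-1) 1) := by
    refine (contDiffOn_succ_iff_deriv_of_isOpen isOpen_Ioo).2 ⟨hu, by simp, ?_⟩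
    rw [zero_add] at hv1
    refine (hv1.div (f := v) (g := fun x => (1 - x ^ 2) * (jacobiWeight α β).eval x) ?_
      fun x hx => (jacobiDenom_pos hx).ne').congr fun x hx => (h x hx).1.deriv
    exact ((contDiff_const.sub (contDiff_id.pow 2)).mul (contDiff_eval_polynomial _)).contDiffOn
  rwa [one_add_one_eq_two] at hu2

/-- A bounded solution of the Jacobi system is an eigenfunction of the spheroidal operator. -/
lemma IsJacobiSystem.isSpheroidalEigenfunction {a ω Λ : ℝ} {m : ℤ} {u v : ℝ → ℝ}
    (hα : (α : ℝ) ^ 2 = (m + 2) ^ 2) (hβ : (β : ℝ) ^ 2 = (m - 2) ^ 2)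
    (h : IsJacobiSystem α β u v fun x => (Λ - spheroidalShift α β - spheroidalPot a ω x)
        * (jacobiSqrt α β x * u x))
    (hC : ∃ C, ∀ x ∈ Ioo (-1 : ℝ) 1, |jacobiSqrt α β x * u x| ≤ C)
    (h0 : ∃ x ∈ Ioo (-1 : ℝ) 1, u x ≠ 0) :
    IsSpheroidalEigenfunction 2 a m ω Λ fun x => jacobiSqrt α β x * u x := by
  have hr : Continuous fun x => Λ - spheroidalShift α β - spheroidalPot a ω x := by
    unfold spheroidalPot; fun_prop
  refine ⟨contDiffOn_jacobiSqrt.mul (h.contDiffOn hr), hC, ?_, fun x hx => ?_⟩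
  · obtain ⟨x, hx, hux⟩ := h0
    exact ⟨x, hx, mul_ne_zero (jacobiSqrt_pos hx).ne' hux⟩
  set w := jacobiSqrt α β with hw
  have hd : ∀ y ∈ Ioo (-1 : ℝ) 1, HasDerivAt (fun x => w x * u x)
      ((v y / w y + jacobiLog α β y * (w y * u y) / 2) / (1 - y ^ 2)) y := by
    intro y hy
    have hp : (1 - y ^ 2) ≠ 0 := by nlinarith [hy.1, hy.2]
    have hw0 : w y ≠ 0 := (jacobiSqrt_pos hy).ne'
    have hww : (jacobiWeight α β).eval y = w y * w y := (jacobiSqrt_mul_self hy).symm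
    refine ((hasDerivAt_jacobiSqrt hy).mul (h y hy).1).congr_deriv ?_
    rw [hww, ← hw]
    field_simp
    ring
  have he : (fun y => (1 - y ^ 2) * deriv (fun x => w x * u x) y) =ᶠ[𝓝 x]
      fun y => v y / w y + jacobiLog α β y * (w y * u y) / 2 := by
    filter_upwards [isOpen_Ioo.mem_nhds hx] with y hy
    have hp : (1 - y ^ 2) ≠ 0 := by nlinarith [hy.1, hy.2]
    rw [(hd y hy).deriv, mul_div_cancel₀ _ hp]
  have hp : (1 - x ^ 2) ≠ 0 := by nlinarith [hx.1, hx.2]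
  have hw0 : w x ≠ 0 := (jacobiSqrt_pos hx).ne'
  have hD := ((h x hx).2.div (hasDerivAt_jacobiSqrt hx) hw0).add
    (((hasDerivAt_jacobiLog (α := α) (β := β) x).mul (hd x hx)).div_const 2)
  have e := (hD.congr_of_eventuallyEq he).deriv
  rw [e]
  have hid := spheroidal_identity hα hβ x
  push_cast
  rw [hid, spheroidalShift, spheroidalPot, ← hw]
  field_simp
  ring

end SpheroidalSystem

/-! ### The frequency as a bounded perturbation; weak versus classical eigenfunctions. -/

section SpheroidalBranch

variable {α β : ℕ}

lemma memLp_id_mul (f : IooL2) : MemLp (fun x => x * f x) 2 volIoo := by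
  refine (Lp.memLp f).mono (continuous_id.aestronglyMeasurable.mul (Lp.memLp f).1) ?_
  filter_upwards [ae_restrict_mem measurableSet_Ioo] with x hx
  rw [norm_mul]
  exact mul_le_of_le_one_left (norm_nonneg _) (abs_le.2 ⟨hx.1.le, hx.2.le⟩)

/-- Multiplication by the variable on `L²((-1, 1))`. -/
def mulX : IooL2 →L[ℝ] IooL2 :=
  LinearMap.mkContinuous
    { toFun := fun f => (memLp_id_mul f).toLp _
      map_add' := fun f g => by
        rw [← MemLp.toLp_add]
        refine MemLp.toLp_congr _ _ ?_
        filter_upwards [Lp.coeFn_add f g] with x hx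
        rw [hx, Pi.add_apply, Pi.add_apply, mul_add]
      map_smul' := fun c f => by
        rw [RingHom.id_apply, ← MemLp.toLp_const_smul]
        refine MemLp.toLp_congr _ _ ?_
        filter_upwards [Lp.coeFn_smul c f] with x hx
        rw [hx, Pi.smul_apply, Pi.smul_apply, smul_eq_mul, smul_eq_mul, mul_left_comm] }
    1 fun f => by
      rw [one_mul]
      refine Lp.norm_le_norm_of_ae_le ?_
      filter_upwards [(memLp_id_mul f).coeFn_toLp, ae_restrict_mem measurableSet_Ioo] with x h hx
      refine (congrArg norm h).le.trans ?_
      rw [norm_mul]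
      exact mul_le_of_le_one_left (norm_nonneg _) (abs_le.2 ⟨hx.1.le, hx.2.le⟩)

lemma coeFn_mulX (f : IooL2) : mulX f =ᵐ[volIoo] fun x => x * f x := (memLp_id_mul f).coeFn_toLp

lemma inner_mulX (f g : IooL2) : inner ℝ (mulX f) g = inner ℝ f (mulX g) := by
  rw [L2.inner_def, L2.inner_def]
  refine integral_congr_ae ?_
  filter_upwards [coeFn_mulX f, coeFn_mulX g] with x h1 h2
  rw [h1, h2]
  simp only [RCLike.inner_apply, conj_trivial]
  ring

/-- The first order perturbation of the spherical operator. -/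
def spheroidalV₁ (a : ℝ) : IooL2 →L[ℝ] IooL2 := (4 * a) • mulX

/-- The second order perturbation of the spherical operator. -/
def spheroidalV₂ (a : ℝ) : IooL2 →L[ℝ] IooL2 := a ^ 2 • (1 - mulX * mulX)

/-- The perturbation of the spherical operator at frequency `ω`. -/
abbrev spheroidalV (a ω : ℝ) : IooL2 →L[ℝ] IooL2 := ω • spheroidalV₁ a + ω ^ 2 • spheroidalV₂ a

lemma inner_spheroidalV₁ (a : ℝ) (f g : IooL2) :
    inner ℝ (spheroidalV₁ a f) g = inner ℝ f (spheroidalV₁ a g) := by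
  simp [spheroidalV₁, inner_smul_left, inner_smul_right, inner_mulX]

lemma inner_spheroidalV₂ (a : ℝ) (f g : IooL2) :
    inner ℝ (spheroidalV₂ a f) g = inner ℝ f (spheroidalV₂ a g) := by
  simp [spheroidalV₂, inner_smul_left, inner_smul_right, inner_mulX, inner_sub_left,
    inner_sub_right]

lemma coeFn_smul_sub_spheroidalV (a ω μ : ℝ) (f : IooL2) :
    (μ • f - spheroidalV a ω f : IooL2)
      =ᵐ[volIoo] fun x => (μ - spheroidalPot a ω x) * f x := by
  have e : spheroidalV a ω f = (4 * a * ω) • mulX f + (a ^ 2 * ω ^ 2) • (f - mulX (mulX f)) := by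
    simp only [spheroidalV, spheroidalV₁, spheroidalV₂, add_apply, smul_apply, sub_apply,
      one_apply_eq_self, mul_apply_eq_comp, smul_smul]
    congr 2 <;> ring
  rw [e]
  filter_upwards [Lp.coeFn_sub (μ • f)
      ((4 * a * ω) • mulX f + (a ^ 2 * ω ^ 2) • (f - mulX (mulX f))),
    Lp.coeFn_smul μ f, Lp.coeFn_add ((4 * a * ω) • mulX f) ((a ^ 2 * ω ^ 2) • (f - mulX (mulX f))),
    Lp.coeFn_smul (4 * a * ω) (mulX f), Lp.coeFn_smul (a ^ 2 * ω ^ 2) (f - mulX (mulX f)),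
    Lp.coeFn_sub f (mulX (mulX f)), coeFn_mulX f, coeFn_mulX (mulX f)] with x h1 h2 h3 h4 h5 h6 h7 h8
  rw [h1, Pi.sub_apply, h2, h3, Pi.add_apply, Pi.smul_apply, h4, Pi.smul_apply, h5, Pi.smul_apply,
    h6, Pi.sub_apply, h8, h7, spheroidalPot]
  simp only [smul_eq_mul]
  ring

lemma continuous_spheroidalPot (a ω : ℝ) : Continuous (spheroidalPot a ω) := by
  unfold spheroidalPot; fun_prop

/-- `f` is a weak eigenfunction of the spheroidal operator, with eigenvalue shifted so that the
lowest spherical eigenvalue is `0`. -/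
abbrev IsSpheroidalWeak (α β : ℕ) (a ω μ : ℝ) (f : IooL2) : Prop :=
  IsWeakEigenpair (jacobiBasis α β) (jacobiEigenvalue α β) (spheroidalV a ω) μ f

lemma IsSpheroidalWeak.smul {a ω μ : ℝ} {f : IooL2} (h : IsSpheroidalWeak α β a ω μ f) {c : ℝ}
    (hc : c ≠ 0) : IsSpheroidalWeak α β a ω μ (c • f) := by
  refine ⟨smul_ne_zero hc h.1, fun k => ?_⟩
  rw [map_smul, smul_comm μ c f, ← smul_sub, inner_smul_right, inner_smul_right, ← h.2 k]
  ring

/-- Weak eigenfunctions are classical. -/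
lemma IsSpheroidalWeak.exists_isJacobiSystem {a ω μ : ℝ} {f : IooL2}
    (h : IsSpheroidalWeak α β a ω μ f) :
    ∃ u v : ℝ → ℝ,
      IsJacobiSystem α β u v (fun x => (μ - spheroidalPot a ω x) * (jacobiSqrt α β x * u x)) ∧
      (∃ C, ∀ x ∈ Ioo (-1 : ℝ) 1, |jacobiSqrt α β x * u x| ≤ C) ∧
      (∃ x ∈ Ioo (-1 : ℝ) 1, u x ≠ 0) ∧ f =ᵐ[volIoo] fun x => jacobiSqrt α β x * u x := by
  obtain ⟨u, v, h1, h2, h3⟩ := _root_.exists_isJacobiSystem h.2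
    (continuous_const.sub (continuous_spheroidalPot a ω)) (coeFn_smul_sub_spheroidalV a ω μ f)
  refine ⟨u, v, h1, h2, ?_, h3⟩
  by_contra! hu
  refine h.1 ((Lp.eq_zero_iff_ae_eq_zero).2 ?_)
  filter_upwards [h3, ae_restrict_mem measurableSet_Ioo] with x hx hxI
  rw [hx, hu x hxI, mul_zero, Pi.zero_apply]

/-- Classical eigenfunctions are weak eigenfunctions. -/
lemma IsSpheroidalEigenfunction.exists_isSpheroidalWeak {a ω Λ : ℝ} {m : ℤ} {S : ℝ → ℝ}
    (hα : (α : ℝ) ^ 2 = (m + 2) ^ 2) (hβ : (β : ℝ) ^ 2 = (m - 2) ^ 2)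
    (h : IsSpheroidalEigenfunction 2 a m ω Λ S) :
    ∃ f, IsSpheroidalWeak α β a ω (Λ - spheroidalShift α β) f ∧ f =ᵐ[volIoo] S := by
  have hsys := h.isJacobiSystem hα hβ
  obtain ⟨hS, ⟨C, hC⟩, ⟨x₀, hx₀, hSx₀⟩, -⟩ := h
  have hSm : AEStronglyMeasurable S volIoo :=
    hS.continuousOn.aestronglyMeasurable measurableSet_Ioo
  have hSL : MemLp S 2 volIoo := by
    refine memLp_of_bounded (a := -C) (b := C) ?_ hSm 2
    filter_upwards [ae_restrict_mem measurableSet_Ioo] with x hx using abs_le.1 (hC x hx)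
  have hfS : hSL.toLp S =ᵐ[volIoo] S := hSL.coeFn_toLp
  refine ⟨hSL.toLp S, ⟨fun h0 => hSx₀ ?_, fun k => ?_⟩, hfS⟩
  · rw [h0] at hfS
    exact (Measure.eqOn_open_of_ae_eq ((Lp.coeFn_zero _ _ _).symm.trans hfS) isOpen_Ioo
      continuousOn_const hS.continuousOn hx₀).symm
  · set w := jacobiSqrt α β with hw
    have hwS : ∀ x ∈ Ioo (-1 : ℝ) 1, w x * (S x / w x) = S x := fun x hx =>
      mul_div_cancel₀ _ (jacobiSqrt_pos hx).ne'
    set μ := Λ - spheroidalShift α β with hμ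
    obtain ⟨R, hR⟩ := isCompact_Icc.exists_bound_of_continuousOn
      ((continuous_const.sub (continuous_spheroidalPot a ω)).continuousOn (s := Icc (-1) 1)
        (f := fun x => μ - spheroidalPot a ω x))
    have hR0 : 0 ≤ R := (norm_nonneg _).trans (hR 0 (by norm_num))
    have hg := hsys.green (N := R * C) (C := C)
      (fun x hx => by
        rw [hwS x hx, abs_mul]
        exact mul_le_mul (hR x (Ioo_subset_Icc_self hx)) (hC x hx) (abs_nonneg _) hR0)
      (by
        have hcont : Continuous fun x => μ - spheroidalPot a ω x :=
          continuous_const.sub (continuous_spheroidalPot a ω)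
        refine (hcont.aestronglyMeasurable.mul hSm).congr ?_
        filter_upwards [ae_restrict_mem measurableSet_Ioo] with x hx
        rw [hwS x hx, Pi.mul_apply])
      (fun x hx => by rw [hwS x hx]; exact hC x hx) k
    rw [jacobiBasis_apply, inner_smul_left, inner_smul_left, inner_jacobiJ, inner_jacobiJ,
      mul_left_comm]
    congr 1
    refine Eq.trans ?_ (hg.trans ?_)
    · congr 1
      refine integral_congr_ae ?_
      filter_upwards [hfS, ae_restrict_mem measurableSet_Ioo] with x h1 h2
      rw [h1, hwS x h2]
    · refine integral_congr_ae ?_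
      filter_upwards [hfS, coeFn_smul_sub_spheroidalV a ω μ (hSL.toLp S),
        ae_restrict_mem measurableSet_Ioo] with x h1 h2 h3
      rw [h2, h1, hwS x h3]

/-- Weak and classical eigenvalues correspond bijectively under the shift, so the label defined
through classical eigenvalues can be counted in the Hilbert space. -/
lemma encard_isSpheroidalEigenvalue {a ω : ℝ} {m : ℤ}
    (hα : (α : ℝ) ^ 2 = (m + 2) ^ 2) (hβ : (β : ℝ) ^ 2 = (m - 2) ^ 2) (Λ : ℝ) :
    {μ | μ < Λ ∧ IsSpheroidalEigenvalue 2 a m ω μ}.encard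
      = {μ | μ < Λ - spheroidalShift α β ∧ ∃ f, IsSpheroidalWeak α β a ω μ f}.encard := by
  have hinj : Function.Injective fun μ : ℝ => μ - spheroidalShift α β := sub_left_injective
  rw [← hinj.encard_image]
  congr 1
  ext μ
  constructor
  · rintro ⟨μ', ⟨h1, S, hS⟩, rfl⟩
    obtain ⟨f, hf, -⟩ := hS.exists_isSpheroidalWeak hα hβ
    exact ⟨sub_lt_sub_right h1 _, f, hf⟩
  · rintro ⟨h1, f, hf⟩
    refine ⟨μ + spheroidalShift α β, ⟨lt_sub_iff_add_lt.1 h1, ?_⟩, add_sub_cancel_right _ _⟩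
    obtain ⟨u, v, h2, h3, h4, -⟩ := hf.exists_isJacobiSystem
    refine ⟨_, IsJacobiSystem.isSpheroidalEigenfunction hα hβ (v := v) ?_ h3 h4⟩
    rwa [add_sub_cancel_right]

/-- A nontrivial regular solution has a sign close to `1`. -/
lemma IsJacobiSystem.pos_or_neg {u v r : ℝ → ℝ} (hr : Continuous r)
    (h : IsJacobiSystem α β u v fun x => r x * (jacobiSqrt α β x * u x))
    (hC : ∃ C, ∀ x ∈ Ioo (-1 : ℝ) 1, |jacobiSqrt α β x * u x| ≤ C)
    (h0 : ∃ x ∈ Ioo (-1 : ℝ) 1, u x ≠ 0) {R y : ℝ} (hR : ∀ x ∈ Ioo (-1 : ℝ) 1, |r x| ≤ R)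
    (hy : 0 ≤ y) (hyR : 2 ^ β * R * (1 - y) ≤ 1 / 2) :
    (∀ x ∈ Ioo y 1, 0 < u x) ∨ ∀ x ∈ Ioo y 1, u x < 0 := by
  obtain ⟨C, hC⟩ := hC
  obtain ⟨x₀, hx₀, hux₀⟩ := h0
  have hR0 : 0 ≤ R := (abs_nonneg _).trans (hR 0 (by norm_num))
  have hsub : Ioo y 1 ⊆ Ioo (-1 : ℝ) 1 := Ioo_subset_Ioo_left (by linarith)
  have hv : Tendsto v (𝓝[<] 1) (𝓝 0) := by
    refine h.flux_tendsto_zero (N := R * C) (fun x hx => ?_) hC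
    rw [abs_mul]
    exact mul_le_mul (hR x hx) (hC x hx) (abs_nonneg _) hR0
  -- A zero beyond `y` would make `u` vanish up to `1` by contraction, hence on the whole interval
  -- by ODE uniqueness.
  have hne : ∀ x ∈ Ioo y 1, u x ≠ 0 := by
    intro x hx hux
    refine hux₀ (h.eq_zero_of_eqOn_zero hr (hsub hx)
      (h.eq_zero_of_zero hv hC hR (hy.trans hx.1.le) ?_ hux) x₀ hx₀)
    refine le_trans ?_ hyR
    gcongr
    exact hx.1.le
  have huc : ContinuousOn u (Ioo y 1) := fun x hx =>
    (h x (hsub hx)).1.continuousAt.continuousWithinAt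
  by_contra! hc
  obtain ⟨⟨x₁, hx₁, h1⟩, ⟨x₂, hx₂, h2⟩⟩ := hc
  obtain ⟨x, hx, hux⟩ := isPreconnected_Ioo.intermediate_value hx₁ hx₂ huc ⟨h1, h2⟩
  exact hne x hx hux

end SpheroidalBranch

/-! ### Label, normalisation and sign of the analytic branch. -/

section SpheroidalNormalised

variable {α β : ℕ}

lemma norm_sq_eq_integral {f : IooL2} {S : ℝ → ℝ} (h : f =ᵐ[volIoo] S) :
    ‖f‖ ^ 2 = ∫ x in Ioo (-1 : ℝ) 1, S x ^ 2 := by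
  rw [← real_inner_self_eq_norm_sq, L2.inner_def]
  refine integral_congr_ae ?_
  filter_upwards [h] with x hx
  rw [hx]
  simp [sq]

/-- The normalised weak eigenfunction which is positive near `1` represents `spheroidalS`. -/
lemma IsSpheroidalWeak.ae_eq_spheroidalS {a ω μ : ℝ} {m : ℤ} {l n : ℕ} {f : IooL2}
    (hα : (α : ℝ) ^ 2 = (m + 2) ^ 2) (hβ : (β : ℝ) ^ 2 = (m - 2) ^ 2)
    (h : IsSpheroidalWeak α β a ω μ f) (hf : ‖f‖ = 1)
    (hn : {ν | ν < μ ∧ ∃ g, IsSpheroidalWeak α β a ω ν g}.encard = n)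
    (hl : n + max m.natAbs 2 = l)
    (hs : ∀ g, IsSpheroidalWeak α β a ω μ g → ∃ t : ℝ, g = t • f)
    {y : ℝ} (hy : y ∈ Ico (0 : ℝ) 1) {S₀ : ℝ → ℝ} (hfS₀ : f =ᵐ[volIoo] S₀)
    (hpos : ∀ x ∈ Ioo y 1, 0 < S₀ x)
    (hS₀ : IsSpheroidalEigenfunction 2 a m ω (μ + spheroidalShift α β) S₀) :
    f =ᵐ[volIoo] spheroidalS 2 a m l ω := by
  have hnat : (2 : ℤ).natAbs = 2 := rfl
  have hex : ∃ S, IsSpheroidalS 2 a m l ω S := by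
    refine ⟨S₀, ⟨_, hS₀, ?_⟩, ?_, ?_⟩
    · rw [encard_isSpheroidalEigenvalue hα hβ, add_sub_cancel_right, hn, hnat, ← hl]
      push_cast
      rfl
    · rw [← norm_sq_eq_integral hfS₀, hf, one_pow]
    · filter_upwards [Ioo_mem_nhdsLT hy.2] with x hx using hpos x hx
  rw [spheroidalS, dif_pos hex]
  obtain ⟨⟨Λ, hΛ, hcard⟩, hint, hev⟩ := hex.choose_spec
  set S := hex.choose with hS
  obtain ⟨g, hg, hgS⟩ := hΛ.exists_isSpheroidalWeak hα hβ
  have hcard' : {ν | ν < Λ - spheroidalShift α β ∧ ∃ g, IsSpheroidalWeak α β a ω ν g}.encard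
      = n := by
    rw [encard_isSpheroidalEigenvalue hα hβ, hnat, ← hl, Nat.cast_add] at hcard
    exact ENat.add_left_injective_of_ne_top (ENat.natCast_ne_top _) hcard
  have hμ : Λ - spheroidalShift α β = μ :=
    eq_of_encard_lt_eq (S := {ν | ∃ g, IsSpheroidalWeak α β a ω ν g}) ⟨g, hg⟩ ⟨f, h⟩ hcard' hn
  rw [hμ] at hg
  obtain ⟨t, rfl⟩ := hs g hg
  have ht : |t| = 1 := by
    have h1 := norm_sq_eq_integral hgS
    rw [hint, norm_smul, hf, mul_one, Real.norm_eq_abs] at h1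
    exact (pow_eq_one_iff_of_nonneg (abs_nonneg t) two_ne_zero).1 h1
  have ht0 : 0 < t := by
    -- `S` and `S₀` are both positive near `1` and are proportional almost everywhere there, so one
    -- common point decides the sign of `t`.
    obtain ⟨z, hz, hzev⟩ := (mem_nhdsLT_iff_exists_Ioo_subset).1 hev
    have hzy : max y z < 1 := max_lt hy.2 hz
    have hsub : Ioo (max y z) 1 ⊆ Ioo (-1) 1 :=
      Ioo_subset_Ioo_left ((by linarith [hy.1] : (-1 : ℝ) ≤ y).trans (le_max_left _ _))
    have hne : NeBot (ae (volume.restrict (Ioo (max y z) 1))) := by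
      rw [ae_neBot, Ne, Measure.restrict_eq_zero, Real.volume_Ioo]
      simpa using hzy
    have hae : ∀ᵐ x ∂volume.restrict (Ioo (max y z) 1), S x = t * S₀ x := by
      refine ae_restrict_of_ae_restrict_of_subset hsub ?_
      filter_upwards [hgS, hfS₀, Lp.coeFn_smul t f] with x h1 h2 h3
      rw [← h1, h3, Pi.smul_apply, h2, smul_eq_mul]
    obtain ⟨x, hx1, hx2⟩ := (hae.and (ae_restrict_mem measurableSet_Ioo)).exists
    have p1 : 0 < S x := hzev ⟨(le_max_right _ _).trans_lt hx2.1, hx2.2⟩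
    have p2 : 0 < S₀ x := hpos x ⟨(le_max_left _ _).trans_lt hx2.1, hx2.2⟩
    rw [hx1] at p1
    exact pos_of_mul_pos_left p1 p2.le
  rw [abs_of_pos ht0] at ht
  rwa [ht, one_smul] at hgS

/-- The function `S_{ml}(· ; ω)`, as an element of `L²((-1, 1))`, is analytic for small `ω`. -/
theorem exists_analytic_spheroidalS (a : ℝ) (m : ℤ) (l : ℕ) (hm : m.natAbs ≤ l) (hl : 2 ≤ l) :
    ∃ (ε : ℝ) (ψ : ℝ → IooL2), 0 < ε ∧ ∀ ω, |ω| < ε →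
      AnalyticAt ℝ ψ ω ∧ ψ ω =ᵐ[volIoo] spheroidalS 2 a m l ω := by
  obtain ⟨n, hn⟩ := Nat.exists_eq_add_of_le' (max_le hm hl)
  set α := (m + 2).natAbs with hαdef
  set β := (m - 2).natAbs with hβdef
  have hα : (α : ℝ) ^ 2 = (m + 2) ^ 2 := by
    have := Int.natAbs_sq (m + 2)
    exact_mod_cast this
  have hβ : (β : ℝ) ^ 2 = (m - 2) ^ 2 := by
    have := Int.natAbs_sq (m - 2)
    exact_mod_cast this
  obtain ⟨ε, φ, Λ, hε, hφ0, hφ⟩ := exists_analytic_eigenpair (jacobiBasis α β)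
    (jacobiEigenvalue_gap α β) (jacobiEigenvalue_zero α β) (spheroidalV₁ a) (spheroidalV₂ a)
    (inner_spheroidalV₁ a) (inner_spheroidalV₂ a) n
  set ψ : ℝ → IooL2 := fun ω => ‖φ ω‖⁻¹ • φ ω with hψ
  have hφne {ω : ℝ} (h : |ω| < ε) : φ ω ≠ 0 := (hφ ω h).2.2.1.1
  have hψan {ω : ℝ} (h : |ω| < ε) : AnalyticAt ℝ ψ ω := by
    have h1 := (hφ ω h).1
    have h2 : AnalyticAt ℝ (fun ω => ‖φ ω‖) ω :=
      (h1.contDiffAt.norm ℝ (hφne h)).analyticAt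
    exact (h2.inv (norm_ne_zero_iff.2 (hφne h))).smul h1
  have hψ1 {ω : ℝ} (h : |ω| < ε) : ‖ψ ω‖ = 1 := by
    rw [hψ, norm_smul, norm_inv, norm_norm, inv_mul_cancel₀ (norm_ne_zero_iff.2 (hφne h))]
  have hψw {ω : ℝ} (h : |ω| < ε) : IsSpheroidalWeak α β a ω (Λ ω) (ψ ω) :=
    IsSpheroidalWeak.smul (hφ ω h).2.2.1 (inv_ne_zero (norm_ne_zero_iff.2 (hφne h)))
  -- `R` bounds `|Λ ω - spheroidalPot a ω x|` for all `|ω| < 1` in the domain of the branch, so that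
  -- `y`, chosen next to make `2^β R (1 - y) ≤ 1/2`, does not depend on `ω`.
  set R : ℝ := |jacobiEigenvalue α β n| + 1 / 4 + (a ^ 2 + 4 * |a|) with hR
  have hRpos : 0 < R := by positivity
  set y : ℝ := 1 - 1 / (2 ^ (β + 1) * R + 1) with hy
  have hden : 0 < 2 ^ (β + 1) * R + 1 := by positivity
  have hyI : y ∈ Ico (0 : ℝ) 1 := by
    have hnn : 0 ≤ 2 ^ (β + 1) * R := by positivity
    exact ⟨sub_nonneg.2 ((div_le_one hden).2 (by linarith)), sub_lt_self _ (by positivity)⟩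
  have hyR : 2 ^ β * R * (1 - y) ≤ 1 / 2 := by
    rw [hy, sub_sub_cancel, mul_one_div, div_le_iff₀ hden, pow_succ]
    linarith
  have hpot {ω : ℝ} (h : |ω| < ε) (h1 : |ω| < 1) :
      ∀ x ∈ Ioo (-1 : ℝ) 1, |Λ ω - spheroidalPot a ω x| ≤ R := by
    intro x hx
    have hx2 : |1 - x ^ 2| ≤ 1 := by
      rw [abs_le]; constructor <;> nlinarith [hx.1, hx.2]
    have hx1 : |x| ≤ 1 := abs_le.2 ⟨hx.1.le, hx.2.le⟩
    have e1 : |Λ ω| ≤ |jacobiEigenvalue α β n| + 1 / 4 := by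
      have := (hφ ω h).2.1
      rw [abs_sub_comm] at this
      have := abs_sub_abs_le_abs_sub (Λ ω) (jacobiEigenvalue α β n)
      linarith
    have e2 : |spheroidalPot a ω x| ≤ a ^ 2 + 4 * |a| := by
      rw [spheroidalPot]
      refine (abs_add_le _ _).trans (add_le_add ?_ ?_)
      · rw [abs_mul, abs_mul, abs_of_nonneg (sq_nonneg a), abs_of_nonneg (sq_nonneg ω), ← sq_abs ω]
        calc a ^ 2 * |ω| ^ 2 * |1 - x ^ 2| ≤ a ^ 2 * 1 ^ 2 * 1 := by gcongr
          _ = a ^ 2 := by ring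
      · rw [abs_mul, abs_mul, abs_mul, abs_of_pos (by norm_num : (0 : ℝ) < 4)]
        calc 4 * |a| * |ω| * |x| ≤ 4 * |a| * 1 * 1 := by gcongr
          _ = _ := by ring
    exact (abs_sub _ _).trans (add_le_add e1 e2)
  have hsys {ω : ℝ} (h : |ω| < ε) (h1 : |ω| < 1) : ∃ u v : ℝ → ℝ,
      IsSpheroidalEigenfunction 2 a m ω (Λ ω + spheroidalShift α β)
        (fun x => jacobiSqrt α β x * u x) ∧
      ψ ω =ᵐ[volIoo] (fun x => jacobiSqrt α β x * u x) ∧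
      ((∀ x ∈ Ioo y 1, 0 < u x) ∨ ∀ x ∈ Ioo y 1, u x < 0) := by
    obtain ⟨u, v, h2, h3, h4, h5⟩ := (hψw h).exists_isJacobiSystem
    refine ⟨u, v, IsJacobiSystem.isSpheroidalEigenfunction hα hβ (v := v) ?_ h3 h4, h5,
      h2.pos_or_neg (continuous_const.sub (continuous_spheroidalPot a ω)) h3 h4 (hpot h h1)
        hyI.1 hyR⟩
    rwa [add_sub_cancel_right]
  have hsub : Ioo y 1 ⊆ Ioo (-1 : ℝ) 1 := Ioo_subset_Ioo_left (by linarith [hyI.1])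
  -- Pairing with this indicator detects the sign: the eigenfunction has constant sign on `(y, 1)`,
  -- and the pairing is continuous in `ω`.
  set k : IooL2 := (memLp_const (1 : ℝ)).indicator (measurableSet_Ioo (a := y) (b := 1))
    |>.toLp ((Ioo y 1).indicator fun _ => (1 : ℝ)) with hk
  have hkin {f : IooL2} {S : ℝ → ℝ} (h : f =ᵐ[volIoo] S) :
      inner ℝ k f = ∫ x in Ioo y 1, S x := by
    have hm : MeasurableSet (Ioo y 1) := measurableSet_Ioo
    rw [L2.inner_def, ← inter_eq_left.2 hsub, ← Measure.restrict_restrict hm,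
      ← integral_indicator hm]
    refine integral_congr_ae ?_
    filter_upwards [h, ((memLp_const (μ := volIoo) (p := 2) (1 : ℝ)).indicator
      (measurableSet_Ioo (a := y) (b := 1))).coeFn_toLp] with x h1 h2
    rw [hk, h2, h1]
    by_cases hx : x ∈ Ioo y 1 <;> simp [hx]
  have h00 : |(0 : ℝ)| < ε := by rwa [abs_zero]
  -- At `ω = 0` the branch is a positive multiple of `√ρ` times a Jacobi polynomial, which is
  -- normalised to be `1` at `x = 1`.
  have hk0 : 0 < inner ℝ k (ψ 0) := by
    set P := jacobiP α β n with hP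
    set c : ℝ := ‖jacobiJ α β P‖⁻¹ with hc
    have hcpos : 0 < c := inv_pos.2 (norm_pos_iff.2 (jacobiJ_jacobiP_ne_zero α β n))
    have hψ0 : ψ 0 = c • jacobiJ α β P := by
      have : ‖φ 0‖ = 1 := by rw [hφ0]; exact (jacobiBasis α β).orthonormal.1 n
      simp only [hψ]
      rw [this, inv_one, one_smul, hφ0, jacobiBasis_apply]
    obtain ⟨u, v, hS, hψS, hsign⟩ := hsys h00 (by simp)
    have huP : EqOn (fun x => jacobiSqrt α β x * u x) (fun x => jacobiSqrt α β x * (c * P.eval x))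
        (Ioo (-1) 1) := by
      refine Measure.eqOn_open_of_ae_eq (hψS.symm.trans ?_) isOpen_Ioo hS.1.continuousOn
        ((continuous_jacobiSqrt α β).mul (P.continuous.const_mul c)).continuousOn
      rw [hψ0]
      filter_upwards [Lp.coeFn_smul c (jacobiJ α β P), coeFn_jacobiJ α β P] with x h1 h2
      rw [h1, Pi.smul_apply, h2, smul_eq_mul]
      ring
    have huP' : ∀ x ∈ Ioo (-1 : ℝ) 1, u x = c * P.eval x := fun x hx =>
      mul_left_cancel₀ (jacobiSqrt_pos hx).ne' (huP hx)
    have hPev : ∀ᶠ x in 𝓝[<] (1 : ℝ), 0 < P.eval x := by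
      have h1 : Tendsto (fun x => P.eval x) (𝓝[<] 1) (𝓝 (P.eval 1)) :=
        (P.continuous.tendsto 1).mono_left nhdsWithin_le_nhds
      rw [hP, eval_one_jacobiP] at h1
      exact h1.eventually_const_lt zero_lt_one
    have hup : ∀ x ∈ Ioo y 1, 0 < u x := by
      refine hsign.resolve_right fun hneg => ?_
      obtain ⟨x, hx1, hx2⟩ := (hPev.and (Ioo_mem_nhdsLT hyI.2)).exists
      have := hneg x hx2
      rw [huP' x (hsub hx2)] at this
      exact absurd this (not_lt.2 (mul_pos hcpos hx1).le)
    rw [hkin hψS]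
    have hp : ∀ x ∈ Ioo y 1, 0 < jacobiSqrt α β x * u x := fun x hx =>
      mul_pos (jacobiSqrt_pos (hsub hx)) (hup x hx)
    rw [setIntegral_pos_iff_support_of_nonneg_ae]
    · have : Function.support (fun x => jacobiSqrt α β x * u x) ∩ Ioo y 1 = Ioo y 1 :=
        inter_eq_right.2 fun x hx => (hp x hx).ne'
      rw [this, Real.volume_Ioo]
      simpa using hyI.2
    · filter_upwards [ae_restrict_mem measurableSet_Ioo] with x hx using (hp x hx).le
    · have : IntegrableOn (fun x => jacobiSqrt α β x * u x) (Ioo (-1) 1) :=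
        ((Lp.memLp (ψ 0)).integrable (by norm_num)).congr hψS
      exact this.mono_set hsub
  have hcont : ContinuousAt (fun ω => inner ℝ k (ψ ω)) 0 :=
    continuousAt_const.inner (hψan h00).continuousAt
  obtain ⟨ε', hε', hball⟩ := Metric.eventually_nhds_iff.1 (hcont.eventually_const_lt hk0)
  refine ⟨min (min ε 1) ε', ψ, by positivity, fun ω hω => ?_⟩
  have hω1 : |ω| < ε := hω.trans_le ((min_le_left _ _).trans (min_le_left _ _))
  have hω2 : |ω| < 1 := hω.trans_le ((min_le_left _ _).trans (min_le_right _ _))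
  have hω3 : 0 < inner ℝ k (ψ ω) := hball (by
    rw [Real.dist_eq, sub_zero]; exact hω.trans_le (min_le_right _ _))
  refine ⟨hψan hω1, ?_⟩
  obtain ⟨u, v, hS, hψS, hsign⟩ := hsys hω1 hω2
  have hup : ∀ x ∈ Ioo y 1, 0 < u x := by
    refine hsign.resolve_right fun hneg => ?_
    rw [hkin hψS] at hω3
    refine absurd hω3 (not_lt.2 (setIntegral_nonpos measurableSet_Ioo fun x hx => ?_))
    exact mul_nonpos_of_nonneg_of_nonpos (jacobiSqrt_pos (hsub hx)).le (hneg x hx).le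
  refine (hψw hω1).ae_eq_spheroidalS hα hβ (hψ1 hω1) (hφ ω hω1).2.2.2.1 hn.symm
    (fun g hg => ?_) hyI hψS (fun x hx => mul_pos (jacobiSqrt_pos (hsub hx)) (hup x hx)) hS
  obtain ⟨t, ht⟩ := (hφ ω hω1).2.2.2.2 g hg
  refine ⟨t * ‖φ ω‖, ?_⟩
  rw [ht, hψ, smul_smul, mul_assoc, mul_inv_cancel₀ (norm_ne_zero_iff.2 (hφne hω1)), mul_one]

end SpheroidalNormalised

/-! ### The gain from an analytic change of direction. -/

section CoefficientDifference

variable {H : Type*} [NormedAddCommGroup H] [InnerProductSpace ℂ H] [CompleteSpace H]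

/-- The almost everywhere identity for the inverse transform survives the dilation by `2π`, which
preserves null sets and absorbs the `2π` of the multiplier. -/
lemma HasWeakDerivOn.angularFourier {h dh : Lp H 2 (volume : Measure ℝ)}
    (hw : HasWeakDerivOn 1 univ (fun v => h v) (fun v => dh v)) :
    ∀ᵐ x : ℝ, _root_.angularFourier dh x = -((Complex.I * x) • _root_.angularFourier h x) := by
  have h1 := fourierInv_weakDeriv (h := h) (dh := dh) fun χ hχ hχc => by
    have := hw.2.2 χ hχ hχc (subset_univ _)
    simpa using this
  have hq : Measure.QuasiMeasurePreserving (fun x : ℝ => x / (2 * Real.pi)) volume volume := by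
    refine ⟨by fun_prop, ?_⟩
    rw [map_div_two_pi_volume]
    exact Measure.smul_absolutelyContinuous
  filter_upwards [hq.ae h1] with x hx
  rw [_root_.angularFourier, _root_.angularFourier, hx]
  congr 2
  push_cast
  have : (Real.pi : ℂ) ≠ 0 := by exact_mod_cast Real.pi_ne_zero
  field_simp

/-- Extension by cutoff of an analytic curve. -/
lemma AnalyticAt.exists_contDiff_hasCompactSupport {E : Type*} [NormedAddCommGroup E]
    [NormedSpace ℝ E] [CompleteSpace E] {g : ℝ → E} (hg : AnalyticAt ℝ g 0) :
    ∃ (δ : ℝ) (G : ℝ → E), 0 < δ ∧ ContDiff ℝ (⊤ : ℕ∞) G ∧ HasCompactSupport G ∧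
      ∀ x, |x| < δ → G x = g x := by
  obtain ⟨r, hr, hball⟩ := Metric.eventually_nhds_iff.1 hg.eventually_analyticAt
  set χ : ContDiffBump (0 : ℝ) := ⟨r / 4, r / 2, by positivity, by linarith⟩ with hχ
  refine ⟨r / 4, fun x => χ x • g x, by positivity, ?_, χ.hasCompactSupport.smul_right, ?_⟩
  · rw [contDiff_iff_contDiffAt]
    intro x
    rcases lt_or_ge (dist x 0) r with h | h
    · exact χ.contDiffAt.smul (hball h).contDiffAt
    · refine (contDiffAt_const (c := (0 : E))).congr_of_eventuallyEq ?_
      have hx : x ∉ tsupport χ := by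
        rw [χ.tsupport_eq, Metric.mem_closedBall]
        change ¬ dist x 0 ≤ r / 2
        linarith
      filter_upwards [(isClosed_tsupport χ).isOpen_compl.mem_nhds hx] with y hy
      rw [image_eq_zero_of_notMem_tsupport hy, zero_smul]
  · intro x hx
    have : χ x = 1 := χ.one_of_mem_closedBall (by
      rw [mem_closedBall_zero_iff]; exact hx.le)
    simp only [this, one_smul]

/-- Changing the direction of a coefficient analytically costs less than the derivative of the
function. -/
theorem exists_memSobolevNatAddHalf_inner_sub {Y : ℝ → H} (hY : AnalyticAt ℝ Y 0) :
    ∃ δ₀ : ℝ, 0 < δ₀ ∧ ∀ (k : ℕ) (h dh : Lp H 2 (volume : Measure ℝ)),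
      HasWeakDerivOn 1 univ (fun v => h v) (fun v => dh v) →
      (Integrable fun v : ℝ => |v| ^ (2 * k + 1) * ‖dh v‖ ^ 2) →
      ∀ (c : ℂ) (δ : ℝ), δ < δ₀ → MemSobolevNatAddHalf k (Ioo (-δ) δ)
        fun x => c * inner ℂ (Y x - Y 0) (angularFourier h x) := by
  obtain ⟨p, hp⟩ := hY
  obtain ⟨δ₀, G, hδ₀, hG, hGc, hGY⟩ :=
    AnalyticAt.exists_contDiff_hasCompactSupport ⟨_, hp.has_fpower_series_dslope_fslope⟩
  refine ⟨δ₀, hδ₀, fun k h dh hw hdh c δ hδ => ?_⟩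
  -- The inner product is conjugate-linear on the left, so `c'` contributes `i c`; this cancels the
  -- `-i` in the transform of the derivative and leaves `c x`.
  set c' : ℂ := -(Complex.I * (starRingEnd ℂ) c) with hc'
  have hG' : ContDiff ℝ (⊤ : ℕ∞) fun x => c' • G x := hG.const_smul c'
  refine (memSobolevNatAddHalf_inner_angularFourier k (by simp) dh hdh hG'
    (hGc.smul_left (f := fun _ => c'))).congr ?_
  filter_upwards [ae_restrict_of_ae hw.angularFourier, ae_restrict_mem measurableSet_Ioo]
    with x hx hxI
  have h1 : G x = dslope Y 0 x := hGY x ((abs_lt.2 hxI).trans hδ)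
  -- `G` is a cutoff of the divided slope of `Y` at `0`, which is analytic; the extracted factor `x`
  -- is what trades `h` for its derivative.
  have h2 : Y x - Y 0 = (x : ℂ) • G x := by
    rw [h1, ← sub_smul_dslope Y 0 x, sub_zero]
    exact (Complex.coe_smul x _).symm
  rw [hx, h2, inner_smul_left, inner_smul_left, inner_neg_right, inner_smul_right, hc']
  simp only [map_neg, map_mul, Complex.conj_I, Complex.conj_conj, Complex.conj_ofReal]
  linear_combination (-(x : ℂ) * c * inner ℂ (G x) (angularFourier h x)) * Complex.I_sq

end CoefficientDifference

/-! ### From functions of `cos θ` to functions on the sphere. -/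

section SphereEmbedding

/-- Change of variables `x = cos θ`, injective on `(0, π)` with Jacobian `sin θ`. -/
lemma map_cos_withDensity_sin :
    Measure.map Real.cos ((volume.restrict (Ioo 0 Real.pi)).withDensity
      fun θ => ENNReal.ofReal (Real.sin θ)) = volIoo := by
  have h := map_withDensity_abs_det_fderiv_eq_addHaar (volume : Measure ℝ) (s := Ioo 0 Real.pi)
    (f := Real.cos) (f' := fun x => ContinuousLinearMap.toSpanSingleton ℝ (-Real.sin x))
    measurableSet_Ioo.nullMeasurableSet
    (fun x _ => (Real.hasDerivAt_cos x).hasFDerivAt.hasFDerivWithinAt)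
    (Real.injOn_cos.mono Ioo_subset_Icc_self)
  have himage : Real.cos '' Ioo 0 Real.pi = Ioo (-1) 1 := by
    refine Subset.antisymm ?_ fun x hx => ?_
    · rintro _ ⟨θ, hθ, rfl⟩
      have h1 := Real.cos_lt_cos_of_nonneg_of_le_pi le_rfl hθ.2.le hθ.1
      have h2 := Real.cos_lt_cos_of_nonneg_of_le_pi hθ.1.le le_rfl hθ.2
      rw [Real.cos_zero] at h1
      rw [Real.cos_pi] at h2
      exact ⟨h2, h1⟩
    · exact ⟨Real.arccos x, ⟨Real.arccos_pos.2 hx.2, Real.arccos_lt_pi.2 hx.1⟩,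
        Real.cos_arccos hx.1.le hx.2.le⟩
  rw [himage] at h
  rw [volIoo, ← h]
  congr 1
  refine withDensity_congr_ae ?_
  filter_upwards [ae_restrict_mem measurableSet_Ioo] with x hx
  rw [ContinuousLinearMap.det_toSpanSingleton, abs_neg,
    abs_of_pos (Real.sin_pos_of_mem_Ioo hx)]

lemma measurePreserving_cos_fst :
    MeasurePreserving (fun z : ℝ × ℝ => Real.cos z.1) sphereVol
      (ENNReal.ofReal (2 * Real.pi) • volIoo) := by
  refine ⟨by fun_prop, ?_⟩
  have e : (fun z : ℝ × ℝ => Real.cos z.1) = Real.cos ∘ Prod.fst := rfl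
  rw [e, ← Measure.map_map Real.measurable_cos measurable_fst, sphereVol, Measure.map_fst_prod,
    Measure.map_smul, map_cos_withDensity_sin]
  simp

/-- The function `f (cos θ) e^{imφ}` on the sphere. -/
def azimuthal (m : ℤ) (f : ℝ → ℝ) (z : ℝ × ℝ) : ℂ :=
  (f (Real.cos z.1) : ℂ) * Complex.exp (Complex.I * m * z.2)

lemma norm_azimuthal (m : ℤ) (f : ℝ → ℝ) (z : ℝ × ℝ) :
    ‖azimuthal m f z‖ = ‖f (Real.cos z.1)‖ := by
  have e : Complex.I * m * z.2 = ((m * z.2 : ℝ) : ℂ) * Complex.I := by push_cast; ring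
  rw [azimuthal, norm_mul, e, Complex.norm_exp_ofReal_mul_I, mul_one, Complex.norm_real]

lemma azimuthal_congr (m : ℤ) {f g : ℝ → ℝ} (h : f =ᵐ[volIoo] g) :
    azimuthal m f =ᵐ[sphereVol] azimuthal m g := by
  have h' : f =ᵐ[ENNReal.ofReal (2 * Real.pi) • volIoo] g :=
    Measure.smul_absolutelyContinuous.ae_le h
  filter_upwards [measurePreserving_cos_fst.quasiMeasurePreserving.ae h'] with z hz
  rw [azimuthal, azimuthal, hz]

lemma memLp_azimuthal (m : ℤ) (f : IooL2) : MemLp (azimuthal m f) 2 sphereVol := by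
  have h1 : MemLp f 2 (ENNReal.ofReal (2 * Real.pi) • volIoo) :=
    (Lp.memLp f).smul_measure ENNReal.ofReal_ne_top
  have h2 : MemLp (fun z : ℝ × ℝ => f (Real.cos z.1)) 2 sphereVol :=
    h1.comp_measurePreserving measurePreserving_cos_fst
  refine h2.of_le ?_ (Eventually.of_forall fun z => (norm_azimuthal m f z).le)
  exact (Complex.continuous_ofReal.comp_aestronglyMeasurable h2.1).mul
    (by fun_prop : Continuous fun z : ℝ × ℝ =>
      Complex.exp (Complex.I * m * z.2)).aestronglyMeasurable

/-- The embedding `f ↦ f (cos θ) e^{imφ}` of `L²((-1, 1))` into `L²(𝕊²)`. -/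
def azimuthalL2 (m : ℤ) : IooL2 →L[ℝ] SphereL2 :=
  LinearMap.mkContinuous
    { toFun := fun f => (memLp_azimuthal m f).toLp _
      map_add' := fun f g => by
        rw [← MemLp.toLp_add]
        refine MemLp.toLp_congr _ _ ((azimuthal_congr m (Lp.coeFn_add f g)).trans ?_)
        refine Eventually.of_forall fun z => ?_
        simp [azimuthal, add_mul]
      map_smul' := fun c f => by
        rw [RingHom.id_apply, ← MemLp.toLp_const_smul]
        refine MemLp.toLp_congr _ _ ((azimuthal_congr m (Lp.coeFn_smul c f)).trans ?_)
        refine Eventually.of_forall fun z => ?_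
        simp [azimuthal, mul_assoc] }
    ((ENNReal.ofReal (2 * Real.pi)) ^ (1 / (2 : ENNReal)).toReal).toReal fun f => by
      have h1 : AEStronglyMeasurable f (ENNReal.ofReal (2 * Real.pi) • volIoo) :=
        ((Lp.memLp f).smul_measure ENNReal.ofReal_ne_top).1
      have h2 := eLpNorm_comp_measurePreserving (p := 2) h1 measurePreserving_cos_fst
      rw [eLpNorm_smul_measure_of_ne_top (by norm_num), smul_eq_mul] at h2
      have h3 : eLpNorm (azimuthal m f) 2 sphereVol
          = eLpNorm (f ∘ fun z : ℝ × ℝ => Real.cos z.1) 2 sphereVol :=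
        eLpNorm_congr_norm_ae (Eventually.of_forall fun z => norm_azimuthal m f z)
      change ‖(memLp_azimuthal m f).toLp _‖ ≤ _
      rw [Lp.norm_toLp, h3, h2, ENNReal.toReal_mul, Lp.norm_def]

lemma coeFn_azimuthalL2 (m : ℤ) (f : IooL2) : azimuthalL2 m f =ᵐ[sphereVol] azimuthal m f :=
  (memLp_azimuthal m f).coeFn_toLp

/-- The spin-weighted spheroidal harmonics depend analytically on the frequency. -/
theorem exists_analytic_spheroidalY (a : ℝ) (m : ℤ) (l : ℕ) (hm : m.natAbs ≤ l) (hl : 2 ≤ l) :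
    ∃ (ε : ℝ) (Y : ℝ → SphereL2), 0 < ε ∧ AnalyticAt ℝ Y 0 ∧ ∀ ω, |ω| < ε →
      Y ω =ᵐ[sphereVol] spheroidalY 2 a m l ω := by
  obtain ⟨ε, ψ, hε, hψ⟩ := exists_analytic_spheroidalS a m l hm hl
  refine ⟨ε, fun ω => azimuthalL2 m ((√(2 * Real.pi))⁻¹ • ψ ω), hε, ?_, fun ω hω => ?_⟩
  · have hψ0 : AnalyticAt ℝ (fun ω => (√(2 * Real.pi))⁻¹ • ψ ω) 0 :=
      AnalyticAt.fun_const_smul (hψ 0 (by rwa [abs_zero])).1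
    exact ((azimuthalL2 m).analyticAt _).comp hψ0
  · refine (coeFn_azimuthalL2 m _).trans ((azimuthal_congr m
      (g := fun x => (√(2 * Real.pi))⁻¹ * spheroidalS 2 a m l ω x) ?_).trans
      (Eventually.of_forall fun z => rfl))
    filter_upwards [Lp.coeFn_smul (√(2 * Real.pi))⁻¹ (ψ ω), (hψ ω hω).2] with x h1 h2
    rw [h1, Pi.smul_apply, h2, smul_eq_mul]

lemma integral_fourierV_mul_conj {h : LineSphereL2} {y : SphereL2} {Y : ℝ × ℝ → ℂ}
    (hy : y =ᵐ[sphereVol] Y) (ω : ℝ) :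
    ∫ z, fourierV h ω z * (starRingEnd ℂ) (Y z) ∂sphereVol
      = inner ℂ y (((√(2 * Real.pi))⁻¹ : ℂ) • angularFourier h ω) := by
  have e : fourierV h ω = ((√(2 * Real.pi))⁻¹ : ℂ) • angularFourier h ω := by
    rw [fourierV, angularFourier, ← Complex.ofReal_inv]
    exact (Complex.coe_smul _ _).symm
  rw [← e, L2.inner_def]
  refine integral_congr_ae ?_
  filter_upwards [hy] with z hz
  rw [hz, RCLike.inner_apply]

end SphereEmbedding

end

/-! ### Conclusion: the two coefficients differ by an element of `H^(p-1/2)`. -/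

theorem proposition3p8 (a : ℝ) (m₀ : ℤ) (l₀ : ℕ) (hm : m₀.natAbs ≤ l₀) (hl : 2 ≤ l₀) :
    ∃ δ₀ : ℝ, 0 < δ₀ ∧
      ∀ (p : ℕ), 1 ≤ p → ∀ h dh : LineSphereL2,
        HasWeakDerivOn 1 univ (fun v => h v) (fun v => dh v) →
        Integrable (fun v : ℝ => (1 + |v| ^ (2 * (p - 1))) * ‖h v‖ ^ 2) →
        Integrable (fun v : ℝ => (1 + |v| ^ (2 * p - 1)) * ‖dh v‖ ^ 2) →
        ∀ δ : ℝ, 0 < δ → δ < δ₀ →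
          (MemSobolevNatAddHalf (p - 1) (Ioo (-δ) δ) (sphericalCoeff 2 a m₀ l₀ h) ↔
            MemSobolevNatAddHalf (p - 1) (Ioo (-δ) δ) (spheroidalCoeff 2 a m₀ l₀ h)) := by
  obtain ⟨ε, Y, hε, hY, hYω⟩ := exists_analytic_spheroidalY a m₀ l₀ hm hl
  obtain ⟨δ₁, hδ₁, hmem⟩ := exists_memSobolevNatAddHalf_inner_sub hY
  refine ⟨min ε δ₁, lt_min hε hδ₁, fun p hp h dh hw _ hdh δ hδ hδ₀ => ?_⟩
  -- With `k = p - 1` the required weight exponent `2k + 1` is exactly `2p - 1`; the natural-number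
  -- subtraction is harmless because `p ≥ 1`.
  have hint : Integrable fun v : ℝ => |v| ^ (2 * (p - 1) + 1) * ‖dh v‖ ^ 2 := by
    have e : 2 * (p - 1) + 1 = 2 * p - 1 := by omega
    rw [e]
    refine hdh.mono' ?_ (Eventually.of_forall fun v => ?_)
    · exact (by fun_prop : Continuous fun v : ℝ => |v| ^ (2 * p - 1)).aestronglyMeasurable.mul
        ((Lp.aestronglyMeasurable dh).norm.pow 2)
    · rw [Real.norm_of_nonneg (by positivity)]
      gcongr
      linarith
  have hD := hmem (p - 1) h dh hw hint (√(2 * Real.pi))⁻¹ δ (hδ₀.trans_le (min_le_right _ _))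
  have hdiff : ∀ ω ∈ Ioo (-δ) δ, spheroidalCoeff 2 a m₀ l₀ h ω
      = sphericalCoeff 2 a m₀ l₀ h ω + ((√(2 * Real.pi))⁻¹ : ℂ)
        * inner ℂ (Y ω - Y 0) (angularFourier h ω) := by
    intro ω hω
    have hωε : |ω| < ε := (abs_lt.2 hω).trans (hδ₀.trans_le (min_le_left _ _))
    rw [spheroidalCoeff, sphericalCoeff, integral_fourierV_mul_conj (hYω ω hωε),
      integral_fourierV_mul_conj (hYω 0 (by rwa [abs_zero])), inner_smul_right, inner_smul_right,
      inner_sub_left]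
    ring
  have hae {f g : ℝ → ℂ} (hfg : ∀ ω ∈ Ioo (-δ) δ, f ω = g ω) :
      f =ᵐ[volume.restrict (Ioo (-δ) δ)] g := by
    filter_upwards [ae_restrict_mem measurableSet_Ioo] with ω hω using hfg ω hω
  constructor
  · intro hS
    exact (hS.add hD).congr (hae fun ω hω => (hdiff ω hω).symm)
  · intro hS
    refine (hS.add hD.neg).congr (hae fun ω hω => ?_)
    simp only [Pi.add_apply, Pi.neg_apply, hdiff ω hω, add_neg_cancel_right]
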